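/- A *2-coloring* of a finite simple graph $G$ is a map $f:V(G)\to\{\text{red},\text{blue}\}$; an edge is red (blue) if both of its end vertices are red (blue). In the problem *2-Load Coloring*, the input is a finite simple graph $G$ and two integers $k_1,k_2$, and the question is whether $G$ has a 2-coloring with at least $k_1$ red edges and at least $k_2$ blue edges. The *clique-width* of $G$ is the least $w$ such that $G$ can be built with labels from $\{1,\dots,w\}$ by the operations: introduce a new vertex with label $i$; take the disjoint union of two labeled graphs; connect every vertex of label $i$ to every vertex of label $j$, where $i\neq j$; change every label $i$ to $j$. **Theorem.** 2-Load Coloring can be solved in time $n^{O(w)}$, where $n\ge 1$ is the number of vertices and $w$ is the clique-width of the input graph. That is, there are a program $P$ for a random access machine and a constant $C$ such that, for every graph $G$ with $n\geq 1$ vertices and clique-width $w$, given by its adjacency matrix, and all integers $k_1,k_2$, the program $P$ on input $(G,k_1,k_2)$ halts after at most $C\cdot n^{Cw}$ steps with the correct answer. (The machine works with natural numbers; its unit-cost operations are constants, direct and indirect memory access, addition, truncated subtraction, and tests for zero.) -/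

import Mathlib

/-! Two-load colorings, clique-width, and a random access machine with a step count. -/

/-- The two colors. -/
inductive LoadColor where
  | red
  | blue
deriving DecidableEq

/-- The number of edges of `G` both of whose end vertices have color `c` under `f`. -/
noncomputable def monoEdges {V : Type*} (G : SimpleGraph V) (f : V → LoadColor)
    (c : LoadColor) : ℕ :=
  {e ∈ G.edgeSet | ∀ v ∈ e, f v = c}.ncard

/-- `(G, k₁, k₂)` is a yes-instance of 2-Load Coloring: some coloring of the vertices has at
least `k₁` red edges and at least `k₂` blue edges. -/
def HasLoadColoring {V : Type*} (G : SimpleGraph V) (k₁ k₂ : ℤ) : Prop :=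
  ∃ f : V → LoadColor,
    k₁ ≤ (monoEdges G f LoadColor.red : ℤ) ∧ k₂ ≤ (monoEdges G f LoadColor.blue : ℤ)

/-- Clique-width expressions with labels in `Fin w`, for graphs whose vertices come from `V`. -/
inductive CWExpr (V : Type*) (w : ℕ) where
  /-- introduce the vertex `v` with label `i` -/
  | vertex (v : V) (i : Fin w) : CWExpr V w
  /-- disjoint union -/
  | union (Φ Ψ : CWExpr V w) : CWExpr V w
  /-- connect each vertex of label `i` to each vertex of label `j`, where `i ≠ j` -/
  | join (i j : Fin w) (hij : i ≠ j) (Φ : CWExpr V w) : CWExpr V w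
  /-- change each label `i` to `j` -/
  | relabel (i j : Fin w) (Φ : CWExpr V w) : CWExpr V w

namespace CWExpr

variable {V : Type*} {w : ℕ}

/-- The set of vertices of the graph that is built. -/
def verts : CWExpr V w → Set V
  | vertex v _ => {v}
  | union Φ Ψ => Φ.verts ∪ Ψ.verts
  | join _ _ _ Φ => Φ.verts
  | relabel _ _ Φ => Φ.verts

/-- Every union is disjoint, that is, every vertex is introduced only once. -/
def WellFormed : CWExpr V w → Prop
  | vertex _ _ => True
  | union Φ Ψ => Φ.WellFormed ∧ Ψ.WellFormed ∧ Disjoint Φ.verts Ψ.verts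
  | join _ _ _ Φ => Φ.WellFormed
  | relabel _ _ Φ => Φ.WellFormed

/-- `Φ.HasLabel u l`: the graph that is built contains the vertex `u`, with label `l`. -/
def HasLabel : CWExpr V w → V → Fin w → Prop
  | vertex v i, u, l => u = v ∧ l = i
  | union Φ Ψ, u, l => Φ.HasLabel u l ∨ Ψ.HasLabel u l
  | join _ _ _ Φ, u, l => Φ.HasLabel u l
  | relabel i j Φ, u, l => (Φ.HasLabel u l ∧ l ≠ i) ∨ (Φ.HasLabel u i ∧ l = j)

/-- The adjacency of the graph that is built (points outside its vertex set are isolated). -/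
def graph : CWExpr V w → SimpleGraph V
  | vertex _ _ => ⊥
  | union Φ Ψ => Φ.graph ⊔ Ψ.graph
  | join i j _ Φ => Φ.graph ⊔ SimpleGraph.fromRel (fun u v => Φ.HasLabel u i ∧ Φ.HasLabel v j)
  | relabel _ _ Φ => Φ.graph

/-- The expression defines the graph `G` with vertex set `V`. -/
def Defines (Φ : CWExpr V w) (G : SimpleGraph V) : Prop :=
  Φ.WellFormed ∧ Φ.verts = Set.univ ∧ Φ.graph = G

end CWExpr

/-- The clique-width of a graph: the least number of labels of an expression that defines it.
(Every nonempty finite graph has such an expression, with one label per vertex.) -/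
noncomputable def cliqueWidth {V : Type*} (G : SimpleGraph V) : ℕ :=
  sInf {w : ℕ | ∃ Φ : CWExpr V w, Φ.Defines G}

namespace RAM

/-- A memory state: registers, addressed directly, and arrays, whose cells are addressed by
computed indices. All of them hold natural numbers. A program mentions only finitely many
registers and arrays. -/
structure State where
  reg : ℕ → ℕ
  arr : ℕ → ℕ → ℕ

/-- Expressions: constants, registers, array cells, sums and truncated differences. -/
inductive Expr : Type where
  | const (c : ℕ) : Expr
  | reg (x : ℕ) : Expr
  | get (a : ℕ) (idx : Expr) : Expr
  | add (e₁ e₂ : Expr) : Expr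
  | sub (e₁ e₂ : Expr) : Expr

/-- The value of an expression. -/
def Expr.eval (s : State) : Expr → ℕ
  | const c => c
  | reg x => s.reg x
  | get a idx => s.arr a (idx.eval s)
  | add e₁ e₂ => e₁.eval s + e₂.eval s
  | sub e₁ e₂ => e₁.eval s - e₂.eval s

/-- The number of steps of an evaluation: one for each operation. -/
def Expr.cost : Expr → ℕ
  | const _ => 1
  | reg _ => 1
  | get _ idx => idx.cost + 1
  | add e₁ e₂ => e₁.cost + e₂.cost + 1
  | sub e₁ e₂ => e₁.cost + e₂.cost + 1

/-- Programs. Tests compare the value of an expression with `0`. -/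
inductive Prog : Type where
  | skip : Prog
  /-- write the value of `e` to register `x` -/
  | assign (x : ℕ) (e : Expr) : Prog
  /-- write the value of `e` to cell `idx` of array `a` -/
  | put (a : ℕ) (idx e : Expr) : Prog
  | seq (P Q : Prog) : Prog
  /-- if `e ≠ 0` then `P` else `Q` -/
  | ite (e : Expr) (P Q : Prog) : Prog
  /-- while `e ≠ 0` do `P` -/
  | loop (e : Expr) (P : Prog) : Prog

/-- Update of a register. -/
def State.setReg (s : State) (x v : ℕ) : State :=
  { s with reg := Function.update s.reg x v }

/-- Update of an array cell. -/
def State.setArr (s : State) (a i v : ℕ) : State :=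
  { s with arr := Function.update s.arr a (Function.update (s.arr a) i v) }

/-- `Runs P s t s'`: started in state `s`, the program `P` halts after exactly `t` steps, in
state `s'`. -/
inductive Runs : Prog → State → ℕ → State → Prop where
  | skip (s : State) : Runs Prog.skip s 1 s
  | assign (x : ℕ) (e : Expr) (s : State) :
      Runs (Prog.assign x e) s (e.cost + 1) (s.setReg x (e.eval s))
  | put (a : ℕ) (idx e : Expr) (s : State) :
      Runs (Prog.put a idx e) s (idx.cost + e.cost + 1) (s.setArr a (idx.eval s) (e.eval s))
  | seq {P Q : Prog} {s s₁ s₂ : State} {t₁ t₂ : ℕ} (hP : Runs P s t₁ s₁)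
      (hQ : Runs Q s₁ t₂ s₂) : Runs (Prog.seq P Q) s (t₁ + t₂) s₂
  | ite_true {e : Expr} {P Q : Prog} {s s' : State} {t : ℕ} (he : e.eval s ≠ 0)
      (hP : Runs P s t s') : Runs (Prog.ite e P Q) s (e.cost + 1 + t) s'
  | ite_false {e : Expr} {P Q : Prog} {s s' : State} {t : ℕ} (he : e.eval s = 0)
      (hQ : Runs Q s t s') : Runs (Prog.ite e P Q) s (e.cost + 1 + t) s'
  | loop_done {e : Expr} {P : Prog} {s : State} (he : e.eval s = 0) :
      Runs (Prog.loop e P) s (e.cost + 1) s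
  | loop_step {e : Expr} {P : Prog} {s s₁ s₂ : State} {t₁ t₂ : ℕ} (he : e.eval s ≠ 0)
      (hP : Runs P s t₁ s₁) (hL : Runs (Prog.loop e P) s₁ t₂ s₂) :
      Runs (Prog.loop e P) s (e.cost + 1 + t₁ + t₂) s₂

open Classical in
/-- The initial state for the input `(G, k₁, k₂)`. Register `0` holds the number `n` of vertices;
registers `1`, `2` hold the positive and the negative part of `k₁`, registers `3`, `4` those of
`k₂`; array `0` holds the adjacency matrix of `G` row by row, the entry of `(i, j)` in cell
`i * n + j`. Everything else is `0`. -/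
noncomputable def input {n : ℕ} (G : SimpleGraph (Fin n)) (k₁ k₂ : ℤ) : State where
  reg x :=
    match x with
    | 0 => n
    | 1 => k₁.toNat
    | 2 => (-k₁).toNat
    | 3 => k₂.toNat
    | 4 => (-k₂).toNat
    | _ => 0
  arr a c := if a = 0 ∧ ∃ i j : Fin n, c = i.val * n + j.val ∧ G.Adj i j then 1 else 0

open Classical in
/-- On the input `(G, k₁, k₂)`, the program `P` halts within `T` steps with the correct answer
to 2-Load Coloring in register `0`: `1` for yes, `0` for no. -/
def DecidesLoadColoringWithin (P : Prog) {n : ℕ} (G : SimpleGraph (Fin n)) (k₁ k₂ : ℤ)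
    (T : ℕ) : Prop :=
  ∃ (t : ℕ) (s : State), Runs P (input G k₁ k₂) t s ∧ t ≤ T ∧
    s.reg 0 = if HasLoadColoring G k₁ k₂ then 1 else 0

end RAM

/-! Call a vertex set A small if there are 3w + 1 vertices such that, for subsets S of A, their
numbers of neighbors in S determine the number of neighbors in S of every vertex outside A. A
coloring of A with red part S meets the rest of the graph only through these outside counts and
through the numbers of red and blue edges inside A; the blue outside counts follow, since the totals
for A are fixed. This is the relation `Equivalent`. On a small set it has at most (n+1)^(3w+1)
(n²+1)² classes, and it is a congruence for disjoint unions (`Equivalent.union`). So a binary tree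
of small sets, from the whole vertex set down to singletons, allows dynamic programming with one
representative per class (`reps_spec`).

Such a tree is found without constructing a clique-width expression, because every small set with at
least two vertices can be cut into two nonempty small sets (`exists_small_cut`). Let X be a smallest
set that determines A. If X has 3w + 1 elements, descending in an expression leads to a set Z₀ that
contains between w + 1 and 2w of them and whose vertices have at most w types of neighborhoods
outside Z₀. Representatives of the types serve as rows; by a rank argument over ℚ, at most w outside
vertices serve as columns that determine Z₀ (`HasRows.exists_columns`). Then X ∩ Z₀ with the columns
determines A ∩ Z₀, and X \ Z₀ with the row representatives determines A \ Z₀, by at most 3w vertices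
each; minimality of X makes both parts nonempty. If X is smaller, splitting off a single vertex
already works.

The set Z₀ itself cannot be enumerated. It is replaced by the closure of X ∩ Z₀ under adding every
vertex that tells an element of the set from a row representative with the same entries in the
columns. This closure lies in Z₀, meets X in the same set and has the same row representatives. It
is described by at most 4w vertices, hence found among n^(4w) tuples. Smallness is tested by
building one subset of A per key, vertex by vertex (`occ_keyList_iff`).

The program tries 1, 2, … labels. A decomposition into singletons certifies the answer whatever the
clique-width is (`answer_iff`), and one is found with w labels at the latest (`refined_parts`). For
the running time, everything is written in a language in which all loops have the same number N =
(n+1)^(20k+1) of rounds, k being the current number of labels. A fixed command then costs a fixed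
polynomial in N, which is n^(O(k)). Sets and lists are coded as N-bit numbers, and counting lemmas
show that the codes fit. -/

/-! ## A language of bounded loops, compiled to the random access machine -/

namespace BoundedLoop

/-- The read-only data of a computation: the parameters, the first of which is the number of
rounds of every loop, and the cells of the input array. -/
structure Ambient where
  par : ℕ → ℕ
  mat : ℕ → ℕ

/-- The number of rounds of every loop. -/
def Ambient.N (a : Ambient) : ℕ := a.par 0

/-- Expressions over registers, parameters and the input array. -/
inductive Term where
  | const (c : ℕ)
  | var (x : ℕ)
  | par (i : ℕ)
  | mat (t : Term)
  | add (t u : Term)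
  | sub (t u : Term)

namespace Term

/-- The value of an expression. -/
def eval (a : Ambient) (e : ℕ → ℕ) : Term → ℕ
  | const c => c
  | var x => e x
  | par i => a.par i
  | mat t => a.mat (t.eval a e)
  | add t u => t.eval a e + u.eval a e
  | sub t u => t.eval a e - u.eval a e

/-- Compilation: parameters are kept in array `2`. -/
def compile : Term → RAM.Expr
  | const c => .const c
  | var x => .reg x
  | par i => .get 2 (.const i)
  | mat t => .get 0 t.compile
  | add t u => .add t.compile u.compile
  | sub t u => .sub t.compile u.compile

/-- Renaming of registers by a shift. -/
def shift (m : ℕ) : Term → Term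
  | const c => const c
  | var x => var (x + m)
  | par i => par i
  | mat t => mat (t.shift m)
  | add t u => add (t.shift m) (u.shift m)
  | sub t u => sub (t.shift m) (u.shift m)

theorem eval_shift (a : Ambient) (m : ℕ) (e : ℕ → ℕ) (t : Term) :
    (t.shift m).eval a e = t.eval a (fun x => e (x + m)) := by
  induction t <;> simp_all [eval, shift]

end Term

/-- The ambient data stored in a memory state. -/
def ambientOf (s : RAM.State) : Ambient := ⟨s.arr 2, s.arr 0⟩

theorem Term.eval_compile (s : RAM.State) (t : Term) :
    t.compile.eval s = t.eval (ambientOf s) s.reg := by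
  induction t <;> simp_all [Term.compile, Term.eval, RAM.Expr.eval, ambientOf]

/-- Commands. `rep x P` runs `P` for each value of register `x` below the number of rounds. -/
inductive Cmd where
  | assign (x : ℕ) (t : Term)
  | seq (P Q : Cmd)
  | ite (t : Term) (P Q : Cmd)
  | rep (x : ℕ) (P : Cmd)

namespace Cmd

/-- The effect of a command on the registers. -/
def den (a : Ambient) : Cmd → (ℕ → ℕ) → ℕ → ℕ
  | assign x t, e => Function.update e x (t.eval a e)
  | seq P Q, e => Q.den a (P.den a e)
  | ite t P Q, e => if t.eval a e ≠ 0 then P.den a e else Q.den a e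
  | rep x P, e => Nat.rec e (fun i e' => P.den a (Function.update e' x i)) a.N

/-- Compilation: the counter of a loop of nesting depth `d` is kept in cell `d` of array `1`. -/
def compile (d : ℕ) : Cmd → RAM.Prog
  | assign x t => .assign x t.compile
  | seq P Q => .seq (P.compile d) (Q.compile d)
  | ite t P Q => .ite t.compile (P.compile d) (Q.compile d)
  | rep x P =>
    .seq (.put 1 (.const d) (.const 0))
      (.loop (.sub (.get 2 (.const 0)) (.get 1 (.const d)))
        -- The true counter stays in array `1`, out of reach of the body, which may overwrite `x`
        -- freely.
        (.seq (.assign x (.get 1 (.const d)))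
          (.seq (P.compile (d + 1))
            (.put 1 (.const d) (.add (.get 1 (.const d)) (.const 1))))))

/-- A bound on the number of steps, when every loop has `N` rounds. -/
def bound (N : ℕ) : Cmd → ℕ
  | assign _ t => t.compile.cost + 1
  | seq P Q => P.bound N + Q.bound N
  | ite t P Q => t.compile.cost + 1 + (P.bound N + Q.bound N)
  -- A round costs 6 for the test, 3 for copying the counter and 6 for its increment; initialization
  -- and the last test cost 3 and 6. The constants round these up.
  | rep _ P => 10 + N * (P.bound N + 20)

/-- Each loop multiplies the cost of its body by about N, so the degree is governed by the syntax of
the command alone. This is what turns feasibility into time polynomial in N. -/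
theorem exists_bound (P : Cmd) : ∃ C D, ∀ N, P.bound N ≤ C * (N + 1) ^ D := by
  have mono : ∀ {C D C' D' N : ℕ}, C ≤ C' → D ≤ D' →
      C * (N + 1) ^ D ≤ C' * (N + 1) ^ D' := fun h h' =>
    Nat.mul_le_mul h (Nat.pow_le_pow_right (Nat.succ_pos _) h')
  have one : ∀ {N D : ℕ}, 1 ≤ (N + 1) ^ D := Nat.one_le_pow _ _ (Nat.succ_pos _)
  induction P with
  | assign x t => exact ⟨t.compile.cost + 1, 0, fun N => by simp [bound]⟩
  | seq P Q hP hQ =>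
    obtain ⟨C, D, h⟩ := hP
    obtain ⟨C', D', h'⟩ := hQ
    refine ⟨C + C', D + D', fun N => ?_⟩
    have h1 := (h N).trans (mono le_rfl (Nat.le_add_right D D'))
    have h2 := (h' N).trans (mono le_rfl (Nat.le_add_left D' D))
    simp only [bound]
    linarith
  | ite t P Q hP hQ =>
    obtain ⟨C, D, h⟩ := hP
    obtain ⟨C', D', h'⟩ := hQ
    refine ⟨t.compile.cost + 1 + C + C', D + D', fun N => ?_⟩
    have h1 := (h N).trans (mono le_rfl (Nat.le_add_right D D'))
    have h2 := (h' N).trans (mono le_rfl (Nat.le_add_left D' D))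
    have h3 := Nat.mul_le_mul_left (t.compile.cost + 1) (one (N := N) (D := D + D'))
    simp only [bound]
    linarith
  | rep x P hP =>
    obtain ⟨C, D, h⟩ := hP
    refine ⟨C + 30, D + 1, fun N => ?_⟩
    have h1 := h N
    have h2 := one (N := N) (D := D)
    simp only [bound]
    have h3 : N * (P.bound N + 20) ≤ N * ((C + 20) * (N + 1) ^ D) :=
      Nat.mul_le_mul_left _ (by linarith)
    have h4 : 10 ≤ 10 * (N + 1) ^ (D + 1) := Nat.le_mul_of_pos_right _ one
    have h5 : N * ((C + 20) * (N + 1) ^ D) ≤ (C + 20) * (N + 1) ^ (D + 1) := by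
      rw [pow_succ, mul_comm N, mul_assoc]
      exact Nat.mul_le_mul_left _ (Nat.mul_le_mul_left _ (Nat.le_succ N))
    linarith

/-- A compiled command halts within the bound, with the registers that its meaning describes. -/
theorem runs_compile (P : Cmd) : ∀ (d : ℕ) (s : RAM.State), ∃ (t : ℕ) (s' : RAM.State),
    RAM.Runs (P.compile d) s t s' ∧ t ≤ P.bound (s.arr 2 0) ∧
      s'.reg = P.den (ambientOf s) s.reg ∧ s'.arr 0 = s.arr 0 ∧ s'.arr 2 = s.arr 2 ∧
      ∀ i < d, s'.arr 1 i = s.arr 1 i := by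
  induction P with
  | assign x t =>
    intro d s
    exact ⟨_, _, .assign x _ s, le_rfl, by simp [RAM.State.setReg, den, Term.eval_compile],
      rfl, rfl, fun _ _ => rfl⟩
  | seq P Q hP hQ =>
    intro d s
    obtain ⟨t, s', h, hb, hr, h0, h2, h1⟩ := hP d s
    obtain ⟨t', s'', h', hb', hr', h0', h2', h1'⟩ := hQ d s'
    refine ⟨_, _, .seq h h', ?_, ?_, h0'.trans h0, h2'.trans h2,
      fun i hi => (h1' i hi).trans (h1 i hi)⟩
    · rw [h2] at hb'
      exact Nat.add_le_add hb hb'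
    · rw [hr', hr, ambientOf, h0, h2]
      rfl
  | ite t P Q hP hQ =>
    intro d s
    by_cases ht : t.eval (ambientOf s) s.reg = 0
    · obtain ⟨t', s', h, hb, hr, h'⟩ := hQ d s
      refine ⟨_, _, .ite_false (by rwa [Term.eval_compile]) h, ?_, ?_, h'⟩
      · simp only [bound]; omega
      · simp [hr, den, ht]
    · obtain ⟨t', s', h, hb, hr, h'⟩ := hP d s
      refine ⟨_, _, .ite_true (by rwa [Term.eval_compile]) h, ?_, ?_, h'⟩
      · simp only [bound]; omega
      · simp [hr, den, ht]
  | rep x P hP =>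
    intro d s
    set N := s.arr 2 0 with hN
    let R : ℕ → ℕ → ℕ := fun i =>
      Nat.rec s.reg (fun i e' => P.den (ambientOf s) (Function.update e' x i)) i
    -- Induction on the number j of remaining rounds; the state is tied to the meaning after i
    -- rounds, and the counters of the enclosing loops are untouched.
    have key : ∀ j i, i + j = N → ∀ u : RAM.State, u.arr 0 = s.arr 0 → u.arr 2 = s.arr 2 →
        (∀ l < d, u.arr 1 l = s.arr 1 l) → u.arr 1 d = i → u.reg = R i →
        ∃ t u', RAM.Runs (.loop (.sub (.get 2 (.const 0)) (.get 1 (.const d)))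
          (.seq (.assign x (.get 1 (.const d)))
            (.seq (P.compile (d + 1))
              (.put 1 (.const d) (.add (.get 1 (.const d)) (.const 1)))))) u t u' ∧
          t ≤ 6 + j * (P.bound N + 20) ∧ u'.reg = R N ∧ u'.arr 0 = s.arr 0 ∧
          u'.arr 2 = s.arr 2 ∧ ∀ l < d, u'.arr 1 l = s.arr 1 l := by
      intro j
      induction j with
      | zero =>
        intro i hi u h0 h2 h1 hd hr
        obtain rfl : i = N := by omega
        exact ⟨_, u, .loop_done (by simp [RAM.Expr.eval, h2, hd, ← hN]),
          by simp [RAM.Expr.cost], hr, h0, h2, h1⟩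
      | succ j ih =>
        intro i hi u h0 h2 h1 hd hr
        obtain ⟨t, u₁, hrun, hb, hr₁, h0₁, h2₁, h1₁⟩ := hP (d + 1) (u.setReg x i)
        have hamb : ambientOf (u.setReg x i) = ambientOf s := by
          simp [ambientOf, RAM.State.setReg, h0, h2]
        rw [hamb] at hr₁
        have hd₁ : u₁.arr 1 d = i := (h1₁ d (Nat.lt_succ_self d)).trans hd
        obtain ⟨t', u', hrun', hb', hr', hrest⟩ := ih (i + 1) (by omega)
          (u₁.setArr 1 d (i + 1))
          (by simp only [RAM.State.setArr, Function.update_of_ne (show (0 : ℕ) ≠ 1 by simp)]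
              exact h0₁.trans h0)
          (by simp only [RAM.State.setArr, Function.update_of_ne (show (2 : ℕ) ≠ 1 by simp)]
              exact h2₁.trans h2)
          (fun l hl => by
            simp only [RAM.State.setArr, Function.update_self,
              Function.update_of_ne (show l ≠ d by omega)]
            exact (h1₁ l (by omega)).trans (h1 l hl))
          (by simp [RAM.State.setArr])
          (by simp only [RAM.State.setArr, hr₁, RAM.State.setReg, hr, R])
        have hs1 : RAM.Runs (.assign x (.get 1 (.const d))) u 3 (u.setReg x i) := by
          have := RAM.Runs.assign x (.get 1 (.const d)) u
          simp only [RAM.Expr.eval, hd] at this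
          exact this
        have hs2 : RAM.Runs (.put 1 (.const d) (.add (.get 1 (.const d)) (.const 1))) u₁ 6
            (u₁.setArr 1 d (i + 1)) := by
          have := RAM.Runs.put 1 (.const d) (.add (.get 1 (.const d)) (.const 1)) u₁
          simp only [RAM.Expr.eval, hd₁] at this
          exact this
        refine ⟨_, u', .loop_step ?_ (.seq hs1 (.seq hrun hs2)) hrun', ?_, hr', hrest⟩
        · simp only [RAM.Expr.eval, h2, hd, ← hN]; omega
        · have : (u.setReg x i).arr 2 0 = N := by simp [RAM.State.setReg, h2, hN]
          rw [this] at hb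
          simp only [RAM.Expr.cost]
          have : (j + 1) * (P.bound N + 20) = j * (P.bound N + 20) + P.bound N + 20 := by ring
          omega
    obtain ⟨t, u', hrun, hb, hr, h0, h2, h1⟩ := key N 0 (by omega) (s.setArr 1 d 0)
      (by simp [RAM.State.setArr]) (by simp [RAM.State.setArr])
      (fun l hl => by simp [RAM.State.setArr, Function.update_of_ne (show l ≠ d by omega)])
      (by simp [RAM.State.setArr]) rfl
    refine ⟨_, u', .seq (.put 1 (.const d) (.const 0) s) hrun, ?_, hr, h0, h2, h1⟩
    simp only [bound, RAM.Expr.cost]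
    omega

/-- Renaming of registers by a shift. -/
def shift (m : ℕ) : Cmd → Cmd
  | assign x t => assign (x + m) (t.shift m)
  | seq P Q => seq (P.shift m) (Q.shift m)
  | ite t P Q => ite (t.shift m) (P.shift m) (Q.shift m)
  | rep x P => rep (x + m) (P.shift m)

/-- Renaming lets a command run as a subroutine in a fresh block of registers, without disturbing
those of its caller. -/
theorem den_shift (a : Ambient) (m : ℕ) (P : Cmd) : ∀ e : ℕ → ℕ,
    (∀ x < m, (P.shift m).den a e x = e x) ∧
      (fun x => (P.shift m).den a e (x + m)) = P.den a (fun x => e (x + m)) := by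
  have upd : ∀ (e : ℕ → ℕ) (x v : ℕ), (∀ y < m, Function.update e (x + m) v y = e y) ∧
      (fun y => Function.update e (x + m) v (y + m)) =
        Function.update (fun y => e (y + m)) x v := by
    refine fun e x v => ⟨fun y hy => Function.update_of_ne (by omega) _ _, ?_⟩
    funext y
    simp [Function.update_apply]
  induction P with
  | assign x t =>
    intro e
    simp only [shift, den, Term.eval_shift]
    exact upd e x _
  | seq P Q hP hQ =>
    intro e
    simp only [shift, den]
    exact ⟨fun x hx => ((hQ _).1 x hx).trans ((hP e).1 x hx), by rw [(hQ _).2, (hP e).2]⟩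
  | ite t P Q hP hQ =>
    intro e
    simp only [shift, den, Term.eval_shift]
    split_ifs
    exacts [hP e, hQ e]
  | rep x P hP =>
    intro e
    simp only [shift, den]
    induction a.N with
    | zero => exact ⟨fun _ _ => rfl, rfl⟩
    | succ i ih =>
      refine ⟨fun y hy => ((hP _).1 y hy).trans (((upd _ _ _).1 y hy).trans (ih.1 y hy)), ?_⟩
      refine (hP _).2.trans ?_
      rw [(upd _ _ _).2, ih.2]

end Cmd

/-! ## Functions computed by commands -/

/-- `f` is computed by a command from finitely many registers. -/
def Feas (f : Ambient → (ℕ → ℕ) → ℕ) : Prop :=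
  ∃ (P : Cmd) (k : ℕ), (∀ a e e', (∀ i < k, e i = e' i) → f a e = f a e') ∧
    ∀ a e, P.den a e 0 = f a e

/-- A command that copies registers `0, …, k - 1` to `B, …, B + k - 1`. -/
theorem exists_copy (k B : ℕ) (h : k ≤ B) : ∃ P : Cmd, ∀ a e,
    (∀ x < B, P.den a e x = e x) ∧ ∀ x < k, P.den a e (x + B) = e x := by
  induction k with
  | zero => exact ⟨.assign B (.const 0), fun a e =>
      ⟨fun x hx => Function.update_of_ne (by omega) _ _, by simp⟩⟩
  | succ k ih =>
    obtain ⟨P, hP⟩ := ih (by omega)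
    refine ⟨.seq P (.assign (k + B) (.var k)), fun a e => ⟨fun x hx => ?_, fun x hx => ?_⟩⟩
    · simp only [Cmd.den, Function.update_of_ne (show x ≠ k + B by omega), (hP a e).1 x hx]
    · simp only [Cmd.den, Term.eval]
      by_cases hxk : x = k
      · subst hxk
        simp [(hP a e).1 x (by omega)]
      · rw [Function.update_of_ne (by omega), (hP a e).2 x (by omega)]

/-- A feasible function can be evaluated into a given register, with working space from `B` on. -/
theorem Feas.call {f} (hf : Feas f) : ∃ k, (∀ a e e', (∀ i < k, e i = e' i) → f a e = f a e') ∧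
    ∀ B, k ≤ B → ∀ x < B, ∃ P : Cmd, ∀ a e, ∀ y < B,
      P.den a e y = Function.update e x (f a e) y := by
  obtain ⟨Q, k, hk, hQ⟩ := hf
  refine ⟨k, hk, fun B hB x hx => ?_⟩
  obtain ⟨P, hP⟩ := exists_copy k B hB
  refine ⟨.seq P (.seq (Q.shift B) (.assign x (.var B))), fun a e y hy => ?_⟩
  simp only [Cmd.den, Term.eval]
  obtain ⟨h1, h2⟩ := Q.den_shift a B (P.den a e)
  have h3 : (Q.shift B).den a (P.den a e) B = f a e := by
    have := congrFun h2 0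
    simp only [zero_add] at this
    rw [this, hQ]
    exact hk _ _ _ fun i hi => (hP a e).2 i hi
  rw [h3]
  simp only [Function.update_apply]
  split_ifs with hyx
  · rfl
  · rw [h1 y hy, (hP a e).1 y hy]

/-! ### Basic feasible functions and composition -/

theorem Feas.var (i : ℕ) : Feas fun _ e => e i :=
  ⟨.assign 0 (.var i), i + 1, fun _ _ _ h => h i (by omega), fun a e => by
    simp [Cmd.den, Term.eval]⟩

theorem Feas.const (c : ℕ) : Feas fun _ _ => c :=
  ⟨.assign 0 (.const c), 0, fun _ _ _ _ => rfl, fun a e => by simp [Cmd.den, Term.eval]⟩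

theorem Feas.par (i : ℕ) : Feas fun a _ => a.par i :=
  ⟨.assign 0 (.par i), 0, fun _ _ _ _ => rfl, fun a e => by simp [Cmd.den, Term.eval]⟩

/-- Only the first k of the functions `g i` matter. Their arguments lie below some K, so their
values can be collected in the registers from K on without spoiling later evaluations; the command
for f then runs shifted by K. -/
theorem Feas.comp {f} (hf : Feas f) {g : ℕ → Ambient → (ℕ → ℕ) → ℕ} (hg : ∀ i, Feas (g i)) :
    Feas fun a e => f a fun i => g i a e := by
  obtain ⟨Q, k, hk, hQ⟩ := hf
  choose kg hkg hcall using fun i => (hg i).call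
  obtain ⟨K, hK⟩ : ∃ K, ∀ i < k, kg i ≤ K :=
    ⟨(Finset.range k).sup kg, fun i hi => Finset.le_sup (Finset.mem_range.2 hi)⟩
  have key : ∀ j ≤ k, ∃ P : Cmd, ∀ a e,
      (∀ x < K, P.den a e x = e x) ∧ ∀ i < j, P.den a e (i + K) = g i a e := by
    intro j
    induction j with
    | zero => exact fun _ => ⟨.assign K (.const 0), fun a e =>
        ⟨fun x hx => Function.update_of_ne (by omega) _ _, by simp⟩⟩
    | succ j ih =>
      intro hj
      obtain ⟨P, hP⟩ := ih (by omega)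
      obtain ⟨R, hR⟩ := hcall j (K + k) ((hK j hj).trans (by omega)) (j + K) (by omega)
      have hval : ∀ a e, g j a (P.den a e) = g j a e := fun a e =>
        hkg j _ _ _ fun i hi => (hP a e).1 i (hi.trans_le (hK j hj))
      refine ⟨.seq P R, fun a e => ⟨fun x hx => ?_, fun i hi => ?_⟩⟩
      · rw [Cmd.den, hR _ _ _ (by omega), Function.update_of_ne (by omega), (hP a e).1 x hx]
      · rw [Cmd.den, hR _ _ _ (by omega), hval, Function.update_apply]
        split_ifs with hij
        · rw [show i = j by omega]
        · exact (hP a e).2 i (by omega)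
  obtain ⟨P, hP⟩ := key k le_rfl
  refine ⟨.seq P (.seq (Q.shift K) (.assign 0 (.var K))), K, fun a e e' h => ?_, fun a e => ?_⟩
  · exact hk _ _ _ fun i hi => hkg i _ _ _ fun j hj => h j (hj.trans_le (hK i hi))
  · have := congrFun (Q.den_shift a K (P.den a e)).2 0
    simp only [zero_add] at this
    simp only [Cmd.den, Term.eval, Function.update_self]
    rw [this, hQ]
    exact hk _ _ _ fun i hi => (hP a e).2 i hi

theorem Feas.comp₁ {f : Ambient → ℕ → ℕ} (hf : Feas fun a e => f a (e 0)) {g₀}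
    (h₀ : Feas g₀) : Feas fun a e => f a (g₀ a e) :=
  hf.comp (g := fun _ => g₀) fun _ => h₀

theorem Feas.comp₂ {f : Ambient → ℕ → ℕ → ℕ} (hf : Feas fun a e => f a (e 0) (e 1)) {g₀ g₁}
    (h₀ : Feas g₀) (h₁ : Feas g₁) : Feas fun a e => f a (g₀ a e) (g₁ a e) :=
  hf.comp (g := fun | 0 => g₀ | _ => g₁) fun | 0 => h₀ | _ + 1 => h₁

theorem Feas.comp₃ {f : Ambient → ℕ → ℕ → ℕ → ℕ} (hf : Feas fun a e => f a (e 0) (e 1) (e 2))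
    {g₀ g₁ g₂} (h₀ : Feas g₀) (h₁ : Feas g₁) (h₂ : Feas g₂) :
    Feas fun a e => f a (g₀ a e) (g₁ a e) (g₂ a e) :=
  hf.comp (g := fun | 0 => g₀ | 1 => g₁ | _ => g₂) fun | 0 => h₀ | 1 => h₁ | _ + 2 => h₂

theorem Feas.comp₄ {f : Ambient → ℕ → ℕ → ℕ → ℕ → ℕ}
    (hf : Feas fun a e => f a (e 0) (e 1) (e 2) (e 3))
    {g₀ g₁ g₂ g₃} (h₀ : Feas g₀) (h₁ : Feas g₁) (h₂ : Feas g₂) (h₃ : Feas g₃) :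
    Feas fun a e => f a (g₀ a e) (g₁ a e) (g₂ a e) (g₃ a e) :=
  hf.comp (g := fun | 0 => g₀ | 1 => g₁ | 2 => g₂ | _ => g₃)
    fun | 0 => h₀ | 1 => h₁ | 2 => h₂ | _ + 3 => h₃

theorem Feas.add {f g} (hf : Feas f) (hg : Feas g) : Feas fun a e => f a e + g a e :=
  Feas.comp₂ (f := fun _ x y => x + y) ⟨.assign 0 (.add (.var 0) (.var 1)), 2,
    fun _ _ _ h => by simp only [h 0 (by omega), h 1 (by omega)], fun a e => by
      simp [Cmd.den, Term.eval]⟩ hf hg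

theorem Feas.sub {f g} (hf : Feas f) (hg : Feas g) : Feas fun a e => f a e - g a e :=
  Feas.comp₂ (f := fun _ x y => x - y) ⟨.assign 0 (.sub (.var 0) (.var 1)), 2,
    fun _ _ _ h => by simp only [h 0 (by omega), h 1 (by omega)], fun a e => by
      simp [Cmd.den, Term.eval]⟩ hf hg

theorem Feas.mat {f} (hf : Feas f) : Feas fun a e => a.mat (f a e) :=
  Feas.comp₁ (f := fun a x => a.mat x) ⟨.assign 0 (.mat (.var 0)), 1,
    fun _ _ _ h => by simp only [h 0 (by omega)], fun a e => by
      simp [Cmd.den, Term.eval]⟩ hf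

/-- The characteristic number of a proposition. -/
noncomputable def ind (p : Prop) : ℕ := open Classical in if p then 1 else 0

/-- The conditional on an arbitrary proposition. -/
noncomputable def cond (p : Prop) (x y : ℕ) : ℕ := open Classical in if p then x else y

/-- Feasible predicates. -/
def FeasP (p : Ambient → (ℕ → ℕ) → Prop) : Prop := Feas fun a e => ind (p a e)

theorem FeasP.cond {p f g} (hp : FeasP p) (hf : Feas f) (hg : Feas g) :
    Feas fun a e => cond (p a e) (f a e) (g a e) := by
  have := Feas.comp₃ (f := fun _ x y z => if x ≠ 0 then y else z)
    ⟨.ite (.var 0) (.assign 0 (.var 1)) (.assign 0 (.var 2)), 3,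
      fun _ _ _ h => by simp only [h 0 (by omega), h 1 (by omega), h 2 (by omega)], fun a e => by
        by_cases h : e 0 = 0 <;> simp [Cmd.den, Term.eval, h]⟩ hp hf hg
  convert this using 5 with a e
  by_cases h : p a e <;> simp [BoundedLoop.cond, ind, h]

/-! ### Comparisons and propositional connectives -/

theorem Feas.le {f g} (hf : Feas f) (hg : Feas g) : FeasP fun a e => f a e ≤ g a e := by
  -- With d = f - g truncated, d - (d - 1) is min(d, 1), so this is the indicator of d = 0.
  have := (Feas.const 1).sub ((hf.sub hg).sub ((hf.sub hg).sub (Feas.const 1)))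
  refine cast (congrArg Feas ?_) this
  funext a e
  by_cases h : f a e ≤ g a e
  · simp [ind, h]
  · simp only [ind, h, if_false]; omega

theorem FeasP.not {p} (hp : FeasP p) : FeasP fun a e => ¬ p a e := by
  refine cast (congrArg Feas ?_) ((Feas.const 1).sub hp)
  funext a e
  by_cases h : p a e <;> simp [ind, h]

theorem FeasP.and {p q} (hp : FeasP p) (hq : FeasP q) : FeasP fun a e => p a e ∧ q a e := by
  refine cast (congrArg Feas ?_) (hp.cond hq (Feas.const 0))
  funext a e
  by_cases h : p a e <;> by_cases h' : q a e <;> simp [ind, BoundedLoop.cond, h, h']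

theorem FeasP.congr {p q} (hp : FeasP p) (h : ∀ a e, p a e ↔ q a e) : FeasP q := by
  have : p = q := funext fun a => funext fun e => propext (h a e)
  exact this ▸ hp

theorem FeasP.or {p q} (hp : FeasP p) (hq : FeasP q) : FeasP fun a e => p a e ∨ q a e :=
  (hp.not.and hq.not).not.congr fun _ _ => by tauto

theorem FeasP.imp {p q} (hp : FeasP p) (hq : FeasP q) : FeasP fun a e => p a e → q a e :=
  (hp.not.or hq).congr fun _ _ => by tauto

theorem FeasP.iff {p q} (hp : FeasP p) (hq : FeasP q) : FeasP fun a e => p a e ↔ q a e :=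
  ((hp.imp hq).and (hq.imp hp)).congr fun _ _ => by tauto

theorem Feas.lt {f g} (hf : Feas f) (hg : Feas g) : FeasP fun a e => f a e < g a e :=
  (hg.le hf).not.congr fun _ _ => by omega

theorem Feas.eq {f g} (hf : Feas f) (hg : Feas g) : FeasP fun a e => f a e = g a e :=
  ((hf.le hg).and (hg.le hf)).congr fun _ _ => by omega

theorem Feas.congr {f g} (hf : Feas f) (h : ∀ a e, f a e = g a e) : Feas g := by
  have : f = g := funext fun a => funext fun e => h a e
  exact this ▸ hf

/-- Iteration with a counter. -/
def fold (N : ℕ) (f : ℕ → ℕ → ℕ) (x : ℕ) : ℕ := Nat.rec x (fun i y => f i y) N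

theorem fold_succ (N : ℕ) (f : ℕ → ℕ → ℕ) (x : ℕ) :
    fold (N + 1) f x = f N (fold N f x) := rfl

theorem fold_induction {N : ℕ} {f : ℕ → ℕ → ℕ} {x : ℕ} (p : ℕ → ℕ → Prop) (h0 : p 0 x)
    (hs : ∀ i < N, ∀ y, p i y → p (i + 1) (f i y)) : p N (fold N f x) := by
  induction N with
  | zero => exact h0
  | succ N ih => exact hs N (Nat.lt_succ_self N) _ (ih fun i hi => hs i (by omega))

/-- Feasibility of a function with two further arguments, kept in the first two registers. -/
theorem Feas.fold {b : Ambient → ℕ → ℕ → (ℕ → ℕ) → ℕ} {f}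
    (hb : Feas fun a e => b a (e 0) (e 1) fun i => e (i + 2)) (hf : Feas f) :
    Feas fun a e => fold a.N (fun i y => b a i y e) (f a e) := by
  obtain ⟨kb, hkb, -⟩ := hb.call
  obtain ⟨kf, hkf, hf'⟩ := hf.call
  let K := kb + kf
  have dep : ∀ a i y e e', (∀ j < K, e j = e' j) → b a i y e = b a i y e' := by
    intro a i y e e' h
    exact hkb a (fun | 0 => i | 1 => y | j + 2 => e j) (fun | 0 => i | 1 => y | j + 2 => e' j)
      fun j hj => match j with
        | 0 => rfl
        | 1 => rfl
        | j + 2 => h j (by omega)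
  -- Register K holds the accumulator and K + 1 the loop index; both lie above everything that b and
  -- f read from the environment.
  have hb' : Feas fun a e => b a (e (K + 1)) (e K) e :=
    hb.comp (g := fun | 0 => fun _ e => e (K + 1) | 1 => fun _ e => e K | j + 2 => fun _ e => e j)
      fun | 0 => .var _ | 1 => .var _ | j + 2 => .var _
  obtain ⟨k', hk', hcall⟩ := hb'.call
  obtain ⟨P, hP⟩ := hf' (K + 2) (by omega) K (by omega)
  obtain ⟨Q, hQ⟩ := hcall (K + 2 + k') (by omega) K (by omega)
  refine ⟨.seq P (.seq (.rep (K + 1) Q) (.assign 0 (.var K))), K, ?_, ?_⟩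
  · intro a e e' h
    have h1 : (fun i y => b a i y e) = fun i y => b a i y e' :=
      funext fun i => funext fun y => dep a i y e e' h
    simp only [h1, hkf a e e' fun i hi => h i (by omega)]
  · intro a e
    simp only [Cmd.den, Term.eval, Function.update_self]
    have : ∀ M, (∀ x < K, (Nat.rec (P.den a e)
        (fun i e' => Q.den a (Function.update e' (K + 1) i)) M : ℕ → ℕ) x = e x) ∧
        (Nat.rec (P.den a e)
        (fun i e' => Q.den a (Function.update e' (K + 1) i)) M : ℕ → ℕ) K =
          BoundedLoop.fold M (fun i y => b a i y e) (f a e) := by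
      intro M
      induction M with
      | zero =>
        refine ⟨fun x hx => ?_, ?_⟩
        · exact (hP a e x (by omega)).trans (Function.update_of_ne (by omega) _ _)
        · exact (hP a e K (by omega)).trans (Function.update_self _ _ _)
      | succ M ih =>
        refine ⟨fun x hx => ?_, ?_⟩
        · refine (hQ _ _ _ (by omega)).trans ?_
          rw [Function.update_of_ne (by omega), Function.update_of_ne (by omega)]
          exact ih.1 x hx
        · refine (hQ _ _ _ (by omega)).trans ?_
          rw [Function.update_self, Function.update_self, Function.update_of_ne (by omega),
            ih.2, fold_succ]
          refine dep _ _ _ _ _ fun j hj => ?_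
          rw [Function.update_of_ne (by omega)]
          exact ih.1 j hj
    exact (this a.N).2

/-! ### Bounded sums and quantifiers, the bound variable being register 0 -/

theorem Feas.sum {b : Ambient → ℕ → (ℕ → ℕ) → ℕ}
    (hb : Feas fun a e => b a (e 0) fun i => e (i + 1)) :
    Feas fun a e => ∑ i ∈ Finset.range a.N, b a i e := by
  have hb' : Feas fun a e => e 1 + b a (e 0) fun i => e (i + 2) :=
    (Feas.var 1).add (hb.comp (g := fun | 0 => fun _ e => e 0 | j + 1 => fun _ e => e (j + 2))
      fun | 0 => .var _ | j + 1 => .var _)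
  refine (Feas.fold (b := fun a i y e => y + b a i e) hb' (.const 0)).congr fun a e => ?_
  induction a.N with
  | zero => rfl
  | succ M ih => rw [fold_succ, ih, Finset.sum_range_succ]

theorem FeasP.exists {p : Ambient → ℕ → (ℕ → ℕ) → Prop}
    (hp : FeasP fun a e => p a (e 0) fun i => e (i + 1)) :
    FeasP fun a e => ∃ i < a.N, p a i e := by
  have h : Feas fun a e => ∑ i ∈ Finset.range a.N, ind (p a i e) :=
    Feas.sum (b := fun a i e => ind (p a i e)) hp
  refine ((Feas.const 1).le h).congr fun a e => ?_
  rw [Nat.one_le_iff_ne_zero, ne_eq, Finset.sum_eq_zero_iff]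
  simp [ind]

theorem FeasP.forall {p : Ambient → ℕ → (ℕ → ℕ) → Prop}
    (hp : FeasP fun a e => p a (e 0) fun i => e (i + 1)) :
    FeasP fun a e => ∀ i < a.N, p a i e :=
  (FeasP.exists (p := fun a i e => ¬ p a i e) hp.not).not.congr fun a e => by
    push Not
    rfl

theorem FeasP.comp₁ {p : Ambient → ℕ → Prop} (hp : FeasP fun a e => p a (e 0)) {g₀}
    (h₀ : Feas g₀) : FeasP fun a e => p a (g₀ a e) :=
  Feas.comp₁ (f := fun a x => ind (p a x)) hp h₀

theorem FeasP.comp₂ {p : Ambient → ℕ → ℕ → Prop} (hp : FeasP fun a e => p a (e 0) (e 1))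
    {g₀ g₁} (h₀ : Feas g₀) (h₁ : Feas g₁) : FeasP fun a e => p a (g₀ a e) (g₁ a e) :=
  Feas.comp₂ (f := fun a x y => ind (p a x y)) hp h₀ h₁

theorem FeasP.comp₃ {p : Ambient → ℕ → ℕ → ℕ → Prop}
    (hp : FeasP fun a e => p a (e 0) (e 1) (e 2))
    {g₀ g₁ g₂} (h₀ : Feas g₀) (h₁ : Feas g₁) (h₂ : Feas g₂) :
    FeasP fun a e => p a (g₀ a e) (g₁ a e) (g₂ a e) :=
  Feas.comp₃ (f := fun a x y z => ind (p a x y z)) hp h₀ h₁ h₂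

theorem FeasP.comp₄ {p : Ambient → ℕ → ℕ → ℕ → ℕ → Prop}
    (hp : FeasP fun a e => p a (e 0) (e 1) (e 2) (e 3))
    {g₀ g₁ g₂ g₃} (h₀ : Feas g₀) (h₁ : Feas g₁) (h₂ : Feas g₂) (h₃ : Feas g₃) :
    FeasP fun a e => p a (g₀ a e) (g₁ a e) (g₂ a e) (g₃ a e) :=
  Feas.comp₄ (f := fun a x y z w => ind (p a x y z w)) hp h₀ h₁ h₂ h₃

theorem Feas.rounds : Feas fun a _ => a.N := Feas.par 0

theorem Feas.sumIf {p : Ambient → ℕ → (ℕ → ℕ) → Prop} {b : Ambient → ℕ → (ℕ → ℕ) → ℕ}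
    (hp : FeasP fun a e => p a (e 0) fun i => e (i + 1))
    (hb : Feas fun a e => b a (e 0) fun i => e (i + 1)) :
    Feas fun a e => ∑ i ∈ Finset.range a.N, BoundedLoop.cond (p a i e) (b a i e) 0 :=
  Feas.sum (b := fun a i e => BoundedLoop.cond (p a i e) (b a i e) 0) (hp.cond hb (.const 0))

/-! ### Arithmetic -/

/-- Repeated addition in a loop of N rounds caps one factor at N. The same cap reappears as `min _
a.N` in the definitions below, where it has no effect on the arguments that matter. -/
theorem Feas.mul {f g} (hf : Feas f) (hg : Feas g) :
    Feas fun a e => min (f a e) a.N * g a e := by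
  refine Feas.comp₂ (f := fun a x y => min x a.N * y) ?_ hf hg
  refine (Feas.sumIf (p := fun a i e => i < e 0) (b := fun a i e => e 1)
    ((Feas.var 0).lt (.var 1)) (.var 2)).congr fun a e => ?_
  induction a.N with
  | zero => simp
  | succ M ih =>
    rw [Finset.sum_range_succ, ih, BoundedLoop.cond]
    split_ifs with h
    · rw [min_eq_right (by omega), min_eq_right (by omega)]; ring
    · rw [min_eq_left (by omega), min_eq_left (by omega)]; rfl

theorem Feas.twoPow {f} (hf : Feas f) : Feas fun a e => 2 ^ (min (f a e) a.N) := by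
  refine Feas.comp₁ (f := fun a x => 2 ^ (min x a.N)) ?_ hf
  refine (Feas.fold (b := fun a i y e => BoundedLoop.cond (i < e 0) (y + y) y)
    (((Feas.var 0).lt (.var 2)).cond ((Feas.var 1).add (.var 1)) (.var 1))
    (.const 1)).congr fun a e => ?_
  refine fold_induction (fun i y => y = 2 ^ min (e 0) i) (by simp) ?_
  rintro i - y rfl
  simp only [BoundedLoop.cond]
  split_ifs with h
  · rw [min_eq_right (by omega), min_eq_right (by omega), pow_succ, mul_two]
  · rw [min_eq_left (by omega), min_eq_left (by omega)]

/-! ### Sets of numbers below the number of rounds -/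

/-- `i` belongs to the set with code `S`. -/
def bit (N S i : ℕ) : Prop := S < 2 ^ N ∧ S.testBit i = true

theorem bit.lt {N S i} (h : bit N S i) : i < N := by
  by_contra hi
  have := Nat.testBit_lt_two_pow (h.1.trans_le (Nat.pow_le_pow_right (by simp) (not_lt.1 hi)))
  simp [h.2] at this

/-- The code of the set of the numbers below `N` with the property `p`. -/
noncomputable def mk (N : ℕ) (p : ℕ → Prop) : ℕ := ∑ i ∈ Finset.range N, cond (p i) (2 ^ i) 0

theorem mk_lt (N : ℕ) (p : ℕ → Prop) : mk N p < 2 ^ N := by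
  induction N with
  | zero => simp [mk]
  | succ N ih =>
    rw [mk, Finset.sum_range_succ, ← mk, pow_succ, cond]
    split_ifs <;> omega

theorem bit_mk {N : ℕ} {p : ℕ → Prop} {i : ℕ} : bit N (mk N p) i ↔ i < N ∧ p i := by
  simp only [bit, mk_lt, true_and]
  induction N with
  | zero => simp [mk]
  | succ N ih =>
    rw [mk, Finset.sum_range_succ, ← mk]
    rcases lt_trichotomy i N with h | rfl | h
    · rw [cond]
      split_ifs
      · rw [add_comm, Nat.testBit_two_pow_add_gt h, ih]
        exact and_congr_left fun _ => by omega
      · rw [add_zero, ih]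
        exact and_congr_left fun _ => by omega
    · have := Nat.testBit_lt_two_pow (mk_lt i p)
      rw [cond]
      split_ifs with hp
      · rw [add_comm, Nat.testBit_two_pow_add_eq, this]
        simp [hp]
      · simp [this, hp]
    · have : mk N p + cond (p N) (2 ^ N) 0 < 2 ^ i := by
        have h1 := mk_lt N p
        have h2 : 2 ^ (N + 1) ≤ 2 ^ i := Nat.pow_le_pow_right (by simp) h
        rw [pow_succ] at h2
        rw [cond]
        split_ifs <;> omega
      have h3 := Nat.testBit_lt_two_pow this
      simp only [h3]
      constructor
      · simp
      · omega

theorem Feas.mk {p : Ambient → ℕ → (ℕ → ℕ) → Prop}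
    (hp : FeasP fun a e => p a (e 0) fun i => e (i + 1)) :
    Feas fun a e => mk a.N fun i => p a i e := by
  refine (Feas.sumIf (b := fun a i e => 2 ^ min i a.N) hp (.twoPow (.var 0))).congr
    fun a e => Finset.sum_congr rfl fun i hi => ?_
  rw [min_eq_left (Finset.mem_range.1 hi).le]

theorem testBit_iff_le_mod (S i : ℕ) : S.testBit i = true ↔ 2 ^ i ≤ S % 2 ^ (i + 1) := by
  have hS : S % 2 ^ (i + 1) < 2 ^ (i + 1) := Nat.mod_lt _ (by positivity)
  have h : (S % 2 ^ (i + 1)).testBit i = S.testBit i := by simp [Nat.testBit_mod_two_pow]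
  rw [← h]
  refine ⟨Nat.ge_two_pow_of_testBit, fun h => ?_⟩
  obtain ⟨j, hj, hb⟩ := Nat.exists_ge_and_testBit_of_ge_two_pow h
  obtain rfl | hlt := hj.eq_or_lt
  · exact hb
  · have := Nat.testBit_lt_two_pow
      (hS.trans_le (Nat.pow_le_pow_right (by simp) (Nat.succ_le_of_lt hlt)))
    simp [this] at hb

/-- Without division or shifts, the powers 2^(N-1), 2^(N-2), …, 2^(i+1) are subtracted from S where
possible. The remainder is S modulo 2^(i+1), and bit i is set exactly if it is at least 2^i. -/
theorem FeasP.bit {f g} (hf : Feas f) (hg : Feas g) : FeasP fun a e => bit a.N (f a e) (g a e) := by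
  refine FeasP.comp₂ (p := fun a x y => BoundedLoop.bit a.N x y) ?_ hf hg
  have hj : Feas fun a e => a.N - 1 - e 0 := (Feas.rounds.sub (.const 1)).sub (.var 0)
  have hr : Feas fun a e => BoundedLoop.fold a.N (fun z y => BoundedLoop.cond
      (e 1 < a.N - 1 - z ∧ 2 ^ min (a.N - 1 - z) a.N ≤ y) (y - 2 ^ min (a.N - 1 - z) a.N) y)
      (e 0) :=
    Feas.fold (b := fun a z y e => BoundedLoop.cond
      (e 1 < a.N - 1 - z ∧ 2 ^ min (a.N - 1 - z) a.N ≤ y) (y - 2 ^ min (a.N - 1 - z) a.N) y)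
      ((((Feas.var 3).lt hj).and (hj.twoPow.le (.var 1))).cond ((Feas.var 1).sub hj.twoPow)
        (.var 1)) (.var 0)
  refine (((Feas.var 0).lt (Feas.twoPow .rounds)).and (((Feas.var 1).lt .rounds).and
    ((Feas.twoPow (.var 1)).le hr))).congr fun a e => ?_
  rw [min_self]
  constructor
  · rintro ⟨hS, hi, h⟩
    refine ⟨hS, (testBit_iff_le_mod _ _).2 ?_⟩
    rw [min_eq_left hi.le] at h
    refine h.trans_eq ?_
    have := fold_induction (N := a.N) (x := e 0) (f := fun z y => BoundedLoop.cond
      (e 1 < a.N - 1 - z ∧ 2 ^ min (a.N - 1 - z) a.N ≤ y) (y - 2 ^ min (a.N - 1 - z) a.N) y)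
      (fun z y => y = e 0 % 2 ^ max (a.N - z) (e 1 + 1)) ?_ ?_
    · rw [this, Nat.sub_self, Nat.zero_max]
    · rw [Nat.mod_eq_of_lt (hS.trans_le (Nat.pow_le_pow_right (by simp) (by simp)))]
    · rintro z hz y rfl
      exact remainder_step hi hz
  · rintro ⟨hS, hb⟩
    have hi : e 1 < a.N := bit.lt ⟨hS, hb⟩
    refine ⟨hS, hi, ?_⟩
    rw [min_eq_left hi.le]
    refine ((testBit_iff_le_mod _ _).1 hb).trans_eq ?_
    symm
    have := fold_induction (N := a.N) (x := e 0) (f := fun z y => BoundedLoop.cond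
      (e 1 < a.N - 1 - z ∧ 2 ^ min (a.N - 1 - z) a.N ≤ y) (y - 2 ^ min (a.N - 1 - z) a.N) y)
      (fun z y => y = e 0 % 2 ^ max (a.N - z) (e 1 + 1)) ?_ ?_
    · rw [this, Nat.sub_self, Nat.zero_max]
    · rw [Nat.mod_eq_of_lt (hS.trans_le (Nat.pow_le_pow_right (by simp) (by simp)))]
    · rintro z hz y rfl
      exact remainder_step hi hz
where
  remainder_step {S i N z : ℕ} (hi : i < N) (hz : z < N) :
      BoundedLoop.cond (i < N - 1 - z ∧ 2 ^ min (N - 1 - z) N ≤ S % 2 ^ max (N - z) (i + 1))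
        (S % 2 ^ max (N - z) (i + 1) - 2 ^ min (N - 1 - z) N) (S % 2 ^ max (N - z) (i + 1)) =
      S % 2 ^ max (N - (z + 1)) (i + 1) := by
    obtain ⟨j, hj⟩ : ∃ j, N - 1 - z = j := ⟨_, rfl⟩
    rw [hj, min_eq_left (by omega : j ≤ N), show N - (z + 1) = j by omega,
      show N - z = j + 1 by omega, BoundedLoop.cond]
    by_cases hij : i < j
    · rw [max_eq_left (by omega : i + 1 ≤ j + 1), max_eq_left (by omega : i + 1 ≤ j)]
      have h1 : S % 2 ^ (j + 1) < 2 ^ (j + 1) := Nat.mod_lt _ (by positivity)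
      have h2 : S % 2 ^ (j + 1) % 2 ^ j = S % 2 ^ j :=
        Nat.mod_mod_of_dvd _ (pow_dvd_pow 2 (Nat.le_succ j))
      rw [← h2]
      have h3 : 2 ^ (j + 1) = 2 ^ j * 2 := pow_succ 2 j
      split_ifs with h
      · rw [Nat.mod_eq_sub_mod h.2, Nat.mod_eq_of_lt (a := S % 2 ^ (j + 1) - 2 ^ j)]
        omega
      · rw [Nat.mod_eq_of_lt (b := 2 ^ j)]
        omega
    · rw [if_neg (by omega), max_eq_right (by omega), max_eq_right (by omega)]

end BoundedLoop

/-! ## The algorithm -/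

namespace BoundedLoop

/-- The number of vertices. -/
def Ambient.n (a : Ambient) : ℕ := a.par 1

/-- The number of labels that is tried. -/
def Ambient.k (a : Ambient) : ℕ := a.par 2

theorem Feas.numVerts : Feas fun a _ => a.n := Feas.par 1

theorem Feas.numLabels : Feas fun a _ => a.k := Feas.par 2

theorem Feas.weaken {f} (hf : Feas f) : Feas fun a e => f a fun i => e (i + 1) :=
  hf.comp (g := fun j _ e => e (j + 1)) fun _ => .var _

/-- All vertices have the property `p`. -/
def allV (a : Ambient) (p : ℕ → Prop) : Prop := ∀ u < a.N, u < a.n → p u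

/-- Some vertex has the property `p`. -/
def exV (a : Ambient) (p : ℕ → Prop) : Prop := ∃ u < a.N, u < a.n ∧ p u

/-- The code of the set of vertices with the property `p`. -/
noncomputable def vset (a : Ambient) (p : ℕ → Prop) : ℕ := mk a.N fun u => u < a.n ∧ p u

section

variable {p : Ambient → ℕ → (ℕ → ℕ) → Prop} (hp : FeasP fun a e => p a (e 0) fun i => e (i + 1))

include hp

theorem FeasP.allV : FeasP fun a e => allV a fun u => p a u e :=
  FeasP.forall (p := fun a u e => u < a.n → p a u e) (((Feas.var 0).lt .numVerts).imp hp)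

theorem FeasP.exV : FeasP fun a e => exV a fun u => p a u e :=
  FeasP.exists (p := fun a u e => u < a.n ∧ p a u e) (((Feas.var 0).lt .numVerts).and hp)

theorem Feas.vset : Feas fun a e => vset a fun u => p a u e :=
  Feas.mk (p := fun a u e => u < a.n ∧ p a u e) (((Feas.var 0).lt .numVerts).and hp)

end

/-- Adjacency, read from the matrix. -/
def adj (a : Ambient) (u v : ℕ) : Prop := ¬ a.mat (min u a.N * a.n + v) = 0

theorem FeasP.adj {f g} (hf : Feas f) (hg : Feas g) : FeasP fun a e => adj a (f a e) (g a e) :=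
  FeasP.comp₂ (p := fun a u v => BoundedLoop.adj a u v)
    (Feas.eq (.mat (.add (.mul (.var 0) .numVerts) (.var 1))) (.const 0)).not hf hg

/-! ### Lists of pairs of vertex sets -/

/-- The number of bits of an entry. -/
def width (a : Ambient) : ℕ := a.n + a.n + 1

theorem Feas.width : Feas fun a _ => width a := .add (.add .numVerts .numVerts) (.const 1)

/-- The list with code `L` has an entry of index `r`. -/
def occ (a : Ambient) (L r : ℕ) : Prop := bit a.N L (min r a.N * width a)

/-- The first component of the entry of index `r`. -/
noncomputable def fst (a : Ambient) (L r : ℕ) : ℕ :=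
  vset a fun v => bit a.N L (min r a.N * width a + (1 + v))

/-- The second component of the entry of index `r`. -/
noncomputable def snd (a : Ambient) (L r : ℕ) : ℕ :=
  vset a fun v => bit a.N L (min r a.N * width a + (1 + a.n + v))

/-- The list with the entry `(A, S)` added at the front. -/
noncomputable def push (a : Ambient) (L A S : ℕ) : ℕ := mk a.N fun i =>
  i = 0 ∨ (1 ≤ i ∧ i < 1 + a.n ∧ bit a.N A (i - 1)) ∨
    (1 + a.n ≤ i ∧ i < width a ∧ bit a.N S (i - (1 + a.n))) ∨
    (width a ≤ i ∧ bit a.N L (i - width a))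

theorem FeasP.occ {f g} (hf : Feas f) (hg : Feas g) : FeasP fun a e => occ a (f a e) (g a e) :=
  FeasP.comp₂ (p := fun a L r => BoundedLoop.occ a L r)
    (FeasP.bit (.var 0) (.mul (.var 1) .width)) hf hg

theorem Feas.fst {f g} (hf : Feas f) (hg : Feas g) : Feas fun a e => fst a (f a e) (g a e) :=
  Feas.comp₂ (f := fun a L r => BoundedLoop.fst a L r)
    (Feas.vset (p := fun a v e => BoundedLoop.bit a.N (e 0)
      (min (e 1) a.N * BoundedLoop.width a + (1 + v)))
      (FeasP.bit (.var 1) (.add (.mul (.var 2) .width) (.add (.const 1) (.var 0))))) hf hg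

theorem Feas.snd {f g} (hf : Feas f) (hg : Feas g) : Feas fun a e => snd a (f a e) (g a e) :=
  Feas.comp₂ (f := fun a L r => BoundedLoop.snd a L r)
    (Feas.vset (p := fun a v e => BoundedLoop.bit a.N (e 0)
      (min (e 1) a.N * BoundedLoop.width a + (1 + a.n + v)))
      (FeasP.bit (.var 1)
        (.add (.mul (.var 2) .width) (.add (.add (.const 1) .numVerts) (.var 0))))) hf hg

theorem Feas.push {f g h} (hf : Feas f) (hg : Feas g) (hh : Feas h) :
    Feas fun a e => push a (f a e) (g a e) (h a e) := by
  refine Feas.comp₃ (f := fun a L A S => BoundedLoop.push a L A S) (Feas.mk ?_) hf hg hh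
  have h1 : Feas fun a _ => 1 + a.n := (Feas.const 1).add .numVerts
  exact (Feas.eq (.var 0) (.const 0)).or (FeasP.or
    (((Feas.const 1).le (.var 0)).and (((Feas.var 0).lt h1).and
      (FeasP.bit (.var 2) ((Feas.var 0).sub (.const 1))))) (FeasP.or
    ((h1.le (.var 0)).and (((Feas.var 0).lt .width).and
      (FeasP.bit (.var 3) ((Feas.var 0).sub h1))))
    ((Feas.width.le (.var 0)).and (FeasP.bit (.var 1) ((Feas.var 0).sub .width)))))

/-- Some entry of the list has the property `p`. -/
def exE (a : Ambient) (L : ℕ) (p : ℕ → ℕ → Prop) : Prop :=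
  ∃ r < a.N, occ a L r ∧ p (fst a L r) (snd a L r)

/-- Iteration over the entries of a list. -/
noncomputable def foldE (a : Ambient) (L : ℕ) (f : ℕ → ℕ → ℕ → ℕ) (x : ℕ) : ℕ :=
  fold a.N (fun r y => cond (occ a L r) (f (fst a L r) (snd a L r) y) y) x

theorem FeasP.exE {L} {p : Ambient → ℕ → ℕ → (ℕ → ℕ) → Prop} (hL : Feas L)
    (hp : FeasP fun a e => p a (e 0) (e 1) fun i => e (i + 2)) :
    FeasP fun a e => exE a (L a e) fun A S => p a A S e := by
  refine FeasP.exists (p := fun a r e => BoundedLoop.occ a (L a e) r ∧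
    p a (BoundedLoop.fst a (L a e) r) (BoundedLoop.snd a (L a e) r) e)
    ((FeasP.occ hL.weaken (.var 0)).and ?_)
  exact Feas.comp hp
    (g := fun | 0 => fun a e => BoundedLoop.fst a (L a fun i => e (i + 1)) (e 0)
              | 1 => fun a e => BoundedLoop.snd a (L a fun i => e (i + 1)) (e 0)
              | j + 2 => fun _ e => e (j + 1))
    fun | 0 => .fst hL.weaken (.var 0) | 1 => .snd hL.weaken (.var 0) | j + 2 => .var _

theorem Feas.foldE {L x} {f : Ambient → ℕ → ℕ → ℕ → (ℕ → ℕ) → ℕ} (hL : Feas L)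
    (hf : Feas fun a e => f a (e 0) (e 1) (e 2) fun i => e (i + 3)) (hx : Feas x) :
    Feas fun a e => foldE a (L a e) (fun A S y => f a A S y e) (x a e) := by
  have hL' := hL.weaken.weaken
  refine Feas.fold (b := fun a r y e => BoundedLoop.cond (BoundedLoop.occ a (L a e) r)
    (f a (BoundedLoop.fst a (L a e) r) (BoundedLoop.snd a (L a e) r) y e) y)
    ((FeasP.occ hL' (.var 0)).cond ?_ (.var 1)) hx
  exact Feas.comp hf
    (g := fun | 0 => fun a e => BoundedLoop.fst a (L a fun i => e (i + 2)) (e 0)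
              | 1 => fun a e => BoundedLoop.snd a (L a fun i => e (i + 2)) (e 0)
              | 2 => fun a e => e 1
              | j + 3 => fun _ e => e (j + 2))
    fun | 0 => .fst hL' (.var 0) | 1 => .snd hL' (.var 0) | 2 => .var 1 | j + 3 => .var _

/-! ### Tuples of vertices -/

/-- The quotient, for numbers below the number of rounds. -/
noncomputable def quot (a : Ambient) (x y : ℕ) : ℕ :=
  ∑ q ∈ Finset.range a.N, cond (min (q + 1) a.N * y ≤ x) 1 0

/-- The number `g` with its last `j` digits to the base `n` removed. -/
noncomputable def dropDigits (a : Ambient) (g j : ℕ) : ℕ :=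
  fold a.N (fun i y => cond (i < j) (quot a y a.n) y) g

/-- The digit of `g` to the base `n` at position `j`. -/
noncomputable def digit (a : Ambient) (g j : ℕ) : ℕ :=
  dropDigits a g j - min (quot a (dropDigits a g j) a.n) a.N * a.n

/-- `v` is one of the digits of `g` at the positions `l, …, h - 1`. -/
def inTuple (a : Ambient) (g l h v : ℕ) : Prop := ∃ j < a.N, l ≤ j ∧ j < h ∧ digit a g j = v

theorem Feas.quot {f g} (hf : Feas f) (hg : Feas g) : Feas fun a e => quot a (f a e) (g a e) :=
  Feas.comp₂ (f := fun a x y => BoundedLoop.quot a x y)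
    (Feas.sumIf (p := fun a q e => min (q + 1) a.N * (e 1) ≤ e 0) (b := fun _ _ _ => 1)
      (Feas.le (.mul (.add (.var 0) (.const 1)) (.var 2)) (.var 1)) (.const 1)) hf hg

theorem Feas.dropDigits {f g} (hf : Feas f) (hg : Feas g) :
    Feas fun a e => dropDigits a (f a e) (g a e) :=
  Feas.comp₂ (f := fun a x y => BoundedLoop.dropDigits a x y)
    (Feas.fold (b := fun a i y e => BoundedLoop.cond (i < e 1) (BoundedLoop.quot a y a.n) y)
      (FeasP.cond (Feas.lt (.var 0) (.var 3)) (.quot (.var 1) .numVerts) (.var 1)) (.var 0)) hf hg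

theorem Feas.digit {f g} (hf : Feas f) (hg : Feas g) : Feas fun a e => digit a (f a e) (g a e) :=
  have h : Feas fun a e => BoundedLoop.dropDigits a (e 0) (e 1) := .dropDigits (.var 0) (.var 1)
  Feas.comp₂ (f := fun a x y => BoundedLoop.digit a x y)
    (.sub h (.mul (.quot h .numVerts) .numVerts)) hf hg

theorem FeasP.inTuple {f g h i} (hf : Feas f) (hg : Feas g) (hh : Feas h) (hi : Feas i) :
    FeasP fun a e => inTuple a (f a e) (g a e) (h a e) (i a e) :=
  FeasP.comp₄ (p := fun a g l h v => BoundedLoop.inTuple a g l h v)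
    (FeasP.exists (p := fun a j e => e 1 ≤ j ∧ j < e 2 ∧ BoundedLoop.digit a (e 0) j = e 3)
      (FeasP.and (Feas.le (.var 2) (.var 0)) (FeasP.and (Feas.lt (.var 0) (.var 3))
        (Feas.eq (.digit (.var 1) (.var 0)) (.var 4))))) hf hg hh hi

/-! ### Closures -/

/-- The rows of `z` and `b` agree in the columns that `g` describes. -/
def sameRow (a : Ambient) (g z b : ℕ) : Prop :=
  allV a fun c => inTuple a g a.k (a.k + a.k) c → (adj a z c ↔ adj a b c)

/-- One round of the closure. -/
noncomputable def grow (a : Ambient) (g Z : ℕ) : ℕ :=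
  vset a fun u => bit a.N Z u ∨ exV a fun z => bit a.N Z z ∧
    exV a fun b => inTuple a g 0 a.k b ∧ sameRow a g z b ∧ ¬ (adj a z u ↔ adj a b u)

/-- The least set that contains the vertices given by the last part of `g`, and with a vertex `z`
every vertex at which `z` differs from a representative of the row of `z`. -/
noncomputable def closure (a : Ambient) (g : ℕ) : ℕ :=
  fold a.N (fun _ Z => grow a g Z)
    (vset a fun u => inTuple a g (a.k + a.k) (a.k + a.k + a.k + a.k) u)

theorem FeasP.sameRow {f g h} (hf : Feas f) (hg : Feas g) (hh : Feas h) :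
    FeasP fun a e => sameRow a (f a e) (g a e) (h a e) :=
  FeasP.comp₃ (p := fun a g z b => BoundedLoop.sameRow a g z b)
    (FeasP.allV (p := fun a c e => BoundedLoop.inTuple a (e 0) a.k (a.k + a.k) c →
      (BoundedLoop.adj a (e 1) c ↔ BoundedLoop.adj a (e 2) c))
      ((FeasP.inTuple (.var 1) .numLabels (.add .numLabels .numLabels) (.var 0)).imp
        ((FeasP.adj (.var 2) (.var 0)).iff (FeasP.adj (.var 3) (.var 0))))) hf hg hh

theorem Feas.grow {f g} (hf : Feas f) (hg : Feas g) : Feas fun a e => grow a (f a e) (g a e) := by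
  refine Feas.comp₂ (f := fun a g Z => BoundedLoop.grow a g Z) ?_ hf hg
  exact Feas.vset (p := fun a u e => BoundedLoop.bit a.N (e 1) u ∨ BoundedLoop.exV a fun z =>
    BoundedLoop.bit a.N (e 1) z ∧ BoundedLoop.exV a fun b => BoundedLoop.inTuple a (e 0) 0 a.k b ∧
      BoundedLoop.sameRow a (e 0) z b ∧ ¬ (BoundedLoop.adj a z u ↔ BoundedLoop.adj a b u))
    ((FeasP.bit (.var 2) (.var 0)).or (FeasP.exV (p := fun a z e => BoundedLoop.bit a.N (e 2) z ∧
      BoundedLoop.exV a fun b => BoundedLoop.inTuple a (e 1) 0 a.k b ∧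
      BoundedLoop.sameRow a (e 1) z b ∧ ¬ (BoundedLoop.adj a z (e 0) ↔ BoundedLoop.adj a b (e 0)))
      ((FeasP.bit (.var 3) (.var 0)).and (FeasP.exV (p := fun a b e =>
        BoundedLoop.inTuple a (e 2) 0 a.k b ∧ BoundedLoop.sameRow a (e 2) (e 0) b ∧
        ¬ (BoundedLoop.adj a (e 0) (e 1) ↔ BoundedLoop.adj a b (e 1)))
        ((FeasP.inTuple (.var 3) (.const 0) .numLabels (.var 0)).and
          ((FeasP.sameRow (.var 3) (.var 1) (.var 0)).and
            ((FeasP.adj (.var 1) (.var 2)).iff (FeasP.adj (.var 0) (.var 2))).not))))))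

theorem Feas.closure {f} (hf : Feas f) : Feas fun a e => closure a (f a e) :=
  have h2 : Feas fun a _ => a.k + a.k := .add .numLabels .numLabels
  Feas.comp₁ (f := fun a g => BoundedLoop.closure a g)
    (Feas.fold (b := fun a _ Z e => BoundedLoop.grow a (e 0) Z) (.grow (.var 2) (.var 1))
      (Feas.vset (p := fun a u e => BoundedLoop.inTuple a (e 0) (a.k + a.k)
        (a.k + a.k + a.k + a.k) u)
        (FeasP.inTuple (.var 1) h2 (.add (.add h2 .numLabels) .numLabels) (.var 0)))) hf

/-! ### Testing a vertex set -/

/-- The number of neighbors of `u` in `S`. -/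
noncomputable def count (a : Ambient) (S u : ℕ) : ℕ :=
  ∑ v ∈ Finset.range a.N, cond (v < a.n ∧ bit a.N S v ∧ adj a v u) 1 0

/-- The vertices given by the first part of `g` have the same numbers of neighbors in `S`, `S'`. -/
def sameKey (a : Ambient) (g S S' : ℕ) : Prop :=
  allV a fun x => inTuple a g 0 (a.k + a.k + a.k + 1) x → count a S x = count a S' x

/-- The vertices outside of `A` have the same numbers of neighbors in `S` and `S'`. -/
def agree (a : Ambient) (A S S' : ℕ) : Prop :=
  allV a fun u => ¬ bit a.N A u → count a S u = count a S' u

/-- The set `S` with the vertex `x` added. -/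
noncomputable def addVertex (a : Ambient) (S x : ℕ) : ℕ := vset a fun u => bit a.N S u ∨ u = x

/-- Adds `S` to a list of sets with distinct keys. The list is emptied if `S` shares its key with
a set that does not agree with `S`. -/
noncomputable def insertKey (a : Ambient) (g A L S : ℕ) : ℕ :=
  cond (¬ occ a L 0 ∨ exE a L fun _ S' => sameKey a g S' S ∧ ¬ agree a A S' S) 0
    (cond (exE a L fun _ S' => sameKey a g S' S) L (push a L 0 S))

/-- Adds the sets that arise from those in the list by adding the vertex `x`. -/
noncomputable def extend (a : Ambient) (g A x L : ℕ) : ℕ :=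
  foldE a L (fun _ S L' => insertKey a g A L' (addVertex a S x)) L

/-- Subsets of `A`, one for each key; nothing if the key does not determine the numbers of
neighbors. -/
noncomputable def keyList (a : Ambient) (g A : ℕ) : ℕ :=
  fold a.N (fun x L => cond (x < a.n ∧ bit a.N A x) (extend a g A x L) L) (push a 0 0 0)

/-- For some tuple of vertices the keys of the subsets of `A` determine their numbers of neighbors
outside of `A`. -/
def small (a : Ambient) (A : ℕ) : Prop := ∃ g < a.N, occ a (keyList a g A) 0

theorem Feas.count {f g} (hf : Feas f) (hg : Feas g) : Feas fun a e => count a (f a e) (g a e) :=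
  Feas.comp₂ (f := fun a S u => BoundedLoop.count a S u)
    (Feas.sumIf (p := fun a v e => v < a.n ∧ BoundedLoop.bit a.N (e 0) v ∧
      BoundedLoop.adj a v (e 1)) (b := fun _ _ _ => 1)
      ((Feas.lt (.var 0) .numVerts).and ((FeasP.bit (.var 1) (.var 0)).and
        (FeasP.adj (.var 0) (.var 2)))) (.const 1)) hf hg

theorem FeasP.sameKey {f g h} (hf : Feas f) (hg : Feas g) (hh : Feas h) :
    FeasP fun a e => sameKey a (f a e) (g a e) (h a e) :=
  FeasP.comp₃ (p := fun a g S S' => BoundedLoop.sameKey a g S S')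
    (FeasP.allV (p := fun a x e => BoundedLoop.inTuple a (e 0) 0 (a.k + a.k + a.k + 1) x →
      BoundedLoop.count a (e 1) x = BoundedLoop.count a (e 2) x)
      ((FeasP.inTuple (.var 1) (.const 0)
        (.add (.add (.add .numLabels .numLabels) .numLabels) (.const 1)) (.var 0)).imp
        (Feas.eq (.count (.var 2) (.var 0)) (.count (.var 3) (.var 0))))) hf hg hh

theorem FeasP.agree {f g h} (hf : Feas f) (hg : Feas g) (hh : Feas h) :
    FeasP fun a e => agree a (f a e) (g a e) (h a e) :=
  FeasP.comp₃ (p := fun a A S S' => BoundedLoop.agree a A S S')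
    (FeasP.allV (p := fun a u e => ¬ BoundedLoop.bit a.N (e 0) u →
      BoundedLoop.count a (e 1) u = BoundedLoop.count a (e 2) u)
      ((FeasP.bit (.var 1) (.var 0)).not.imp
        (Feas.eq (.count (.var 2) (.var 0)) (.count (.var 3) (.var 0))))) hf hg hh

theorem Feas.addVertex {f g} (hf : Feas f) (hg : Feas g) :
    Feas fun a e => addVertex a (f a e) (g a e) :=
  Feas.comp₂ (f := fun a S x => BoundedLoop.addVertex a S x)
    (Feas.vset (p := fun a u e => BoundedLoop.bit a.N (e 0) u ∨ u = e 1)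
      ((FeasP.bit (.var 1) (.var 0)).or (Feas.eq (.var 0) (.var 2)))) hf hg

theorem Feas.insertKey {f g h i} (hf : Feas f) (hg : Feas g) (hh : Feas h) (hi : Feas i) :
    Feas fun a e => insertKey a (f a e) (g a e) (h a e) (i a e) :=
  Feas.comp₄ (f := fun a g A L S => BoundedLoop.insertKey a g A L S)
    (FeasP.cond ((FeasP.occ (.var 2) (.const 0)).not.or
      (FeasP.exE (p := fun a _ S' e => BoundedLoop.sameKey a (e 0) S' (e 3) ∧
        ¬ BoundedLoop.agree a (e 1) S' (e 3)) (.var 2)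
        ((FeasP.sameKey (.var 2) (.var 1) (.var 5)).and
          (FeasP.agree (.var 3) (.var 1) (.var 5)).not))) (.const 0)
      (FeasP.cond (FeasP.exE (p := fun a _ S' e => BoundedLoop.sameKey a (e 0) S' (e 3)) (.var 2)
        (FeasP.sameKey (.var 2) (.var 1) (.var 5))) (.var 2)
        (.push (.var 2) (.const 0) (.var 3)))) hf hg hh hi

theorem Feas.extend {f g h i} (hf : Feas f) (hg : Feas g) (hh : Feas h) (hi : Feas i) :
    Feas fun a e => extend a (f a e) (g a e) (h a e) (i a e) :=
  Feas.comp₄ (f := fun a g A x L => BoundedLoop.extend a g A x L)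
    (Feas.foldE (f := fun a _ S L' e => BoundedLoop.insertKey a (e 0) (e 1) L'
      (BoundedLoop.addVertex a S (e 2))) (.var 3)
      (.insertKey (.var 3) (.var 4) (.var 2) (.addVertex (.var 1) (.var 5))) (.var 3)) hf hg hh hi

theorem Feas.keyList {f g} (hf : Feas f) (hg : Feas g) :
    Feas fun a e => keyList a (f a e) (g a e) :=
  Feas.comp₂ (f := fun a g A => BoundedLoop.keyList a g A)
    (Feas.fold (b := fun a x L e => BoundedLoop.cond (x < a.n ∧ BoundedLoop.bit a.N (e 1) x)
      (BoundedLoop.extend a (e 0) (e 1) x L) L)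
      (FeasP.cond ((Feas.lt (.var 0) .numVerts).and (FeasP.bit (.var 3) (.var 0)))
        (.extend (.var 2) (.var 3) (.var 0) (.var 1)) (.var 1))
      (.push (.const 0) (.const 0) (.const 0))) hf hg

theorem FeasP.small {f} (hf : Feas f) : FeasP fun a e => small a (f a e) :=
  FeasP.comp₁ (p := fun a A => BoundedLoop.small a A)
    (FeasP.exists (p := fun a g e => BoundedLoop.occ a (BoundedLoop.keyList a g (e 0)) 0)
      (FeasP.occ (.keyList (.var 0) (.var 1)) (.const 0))) hf

/-! ### The decomposition -/

/-- Intersection of vertex sets. -/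
noncomputable def inter (a : Ambient) (A Z : ℕ) : ℕ := vset a fun u => bit a.N A u ∧ bit a.N Z u

/-- Difference of vertex sets. -/
noncomputable def diff (a : Ambient) (A Z : ℕ) : ℕ := vset a fun u => bit a.N A u ∧ ¬ bit a.N Z u

/-- Union of vertex sets. -/
noncomputable def union (a : Ambient) (A Z : ℕ) : ℕ := vset a fun u => bit a.N A u ∨ bit a.N Z u

/-- `Z` cuts `A` into two nonempty small parts. -/
def goodCut (a : Ambient) (A Z : ℕ) : Prop :=
  (exV a fun u => bit a.N (inter a A Z) u) ∧ (exV a fun u => bit a.N (diff a A Z) u) ∧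
    small a (inter a A Z) ∧ small a (diff a A Z)

/-- A closure that cuts `A` into two nonempty small parts, or `0`. -/
noncomputable def cut (a : Ambient) (A : ℕ) : ℕ :=
  fold a.N (fun g Z => cond (Z = 0 ∧ goodCut a A (closure a g)) (closure a g) Z) 0

/-- The intersection of the sets in the list `T` that contain `v`. -/
noncomputable def cell (a : Ambient) (T v : ℕ) : ℕ :=
  vset a fun u => ¬ exE a T fun A _ => bit a.N A v ∧ ¬ bit a.N A u

/-- Adds the two parts of `A` to the list `T`, if `Z` is a cut. -/
noncomputable def pushParts (a : Ambient) (T A Z : ℕ) : ℕ :=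
  cond (Z = 0) T (push a (push a T (inter a A Z) 0) (diff a A Z) 0)

/-- Refines the cell of `v`. -/
noncomputable def refineCell (a : Ambient) (T v : ℕ) : ℕ :=
  pushParts a T (cell a T v) (cut a (cell a T v))

/-- The sets of the decomposition. -/
noncomputable def parts (a : Ambient) : ℕ :=
  fold a.N (fun v T => cond (v < a.n)
    (fold a.N (fun i T => cond (i < a.n) (refineCell a T v) T) T) T)
    (push a 0 (vset a fun _ => True) 0)

/-- All cells are singletons. -/
def refined (a : Ambient) (T : ℕ) : Prop :=
  allV a fun v => allV a fun u => bit a.N (cell a T v) u → u = v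

theorem Feas.inter {f g} (hf : Feas f) (hg : Feas g) : Feas fun a e => inter a (f a e) (g a e) :=
  Feas.comp₂ (f := fun a A Z => BoundedLoop.inter a A Z)
    (Feas.vset (p := fun a u e => BoundedLoop.bit a.N (e 0) u ∧ BoundedLoop.bit a.N (e 1) u)
      ((FeasP.bit (.var 1) (.var 0)).and (FeasP.bit (.var 2) (.var 0)))) hf hg

theorem Feas.diff {f g} (hf : Feas f) (hg : Feas g) : Feas fun a e => diff a (f a e) (g a e) :=
  Feas.comp₂ (f := fun a A Z => BoundedLoop.diff a A Z)
    (Feas.vset (p := fun a u e => BoundedLoop.bit a.N (e 0) u ∧ ¬ BoundedLoop.bit a.N (e 1) u)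
      ((FeasP.bit (.var 1) (.var 0)).and (FeasP.bit (.var 2) (.var 0)).not)) hf hg

theorem Feas.union {f g} (hf : Feas f) (hg : Feas g) : Feas fun a e => union a (f a e) (g a e) :=
  Feas.comp₂ (f := fun a A Z => BoundedLoop.union a A Z)
    (Feas.vset (p := fun a u e => BoundedLoop.bit a.N (e 0) u ∨ BoundedLoop.bit a.N (e 1) u)
      ((FeasP.bit (.var 1) (.var 0)).or (FeasP.bit (.var 2) (.var 0)))) hf hg

theorem FeasP.goodCut {f g} (hf : Feas f) (hg : Feas g) :
    FeasP fun a e => goodCut a (f a e) (g a e) :=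
  have hi : Feas fun a e => BoundedLoop.inter a (e 0) (e 1) := .inter (.var 0) (.var 1)
  have hd : Feas fun a e => BoundedLoop.diff a (e 0) (e 1) := .diff (.var 0) (.var 1)
  FeasP.comp₂ (p := fun a A Z => BoundedLoop.goodCut a A Z)
    ((FeasP.exV (p := fun a u e => BoundedLoop.bit a.N (BoundedLoop.inter a (e 0) (e 1)) u)
      (FeasP.bit hi.weaken (.var 0))).and
    ((FeasP.exV (p := fun a u e => BoundedLoop.bit a.N (BoundedLoop.diff a (e 0) (e 1)) u)
      (FeasP.bit hd.weaken (.var 0))).and ((FeasP.small hi).and (FeasP.small hd)))) hf hg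

theorem Feas.cut {f} (hf : Feas f) : Feas fun a e => cut a (f a e) :=
  Feas.comp₁ (f := fun a A => BoundedLoop.cut a A)
    (Feas.fold (b := fun a g Z e => BoundedLoop.cond
      (Z = 0 ∧ BoundedLoop.goodCut a (e 0) (BoundedLoop.closure a g)) (BoundedLoop.closure a g) Z)
      (FeasP.cond ((Feas.eq (.var 1) (.const 0)).and (FeasP.goodCut (.var 2) (.closure (.var 0))))
        (.closure (.var 0)) (.var 1)) (.const 0)) hf

theorem Feas.cell {f g} (hf : Feas f) (hg : Feas g) : Feas fun a e => cell a (f a e) (g a e) :=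
  Feas.comp₂ (f := fun a T v => BoundedLoop.cell a T v)
    (Feas.vset (p := fun a u e => ¬ BoundedLoop.exE a (e 0) fun A _ =>
      BoundedLoop.bit a.N A (e 1) ∧ ¬ BoundedLoop.bit a.N A u)
      (FeasP.exE (p := fun a A _ e => BoundedLoop.bit a.N A (e 2) ∧ ¬ BoundedLoop.bit a.N A (e 0))
        (.var 1) ((FeasP.bit (.var 0) (.var 4)).and (FeasP.bit (.var 0) (.var 2)).not)).not) hf hg

theorem Feas.pushParts {f g h} (hf : Feas f) (hg : Feas g) (hh : Feas h) :
    Feas fun a e => pushParts a (f a e) (g a e) (h a e) :=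
  Feas.comp₃ (f := fun a T A Z => BoundedLoop.pushParts a T A Z)
    (FeasP.cond (Feas.eq (.var 2) (.const 0)) (.var 0)
      (.push (.push (.var 0) (.inter (.var 1) (.var 2)) (.const 0))
        (.diff (.var 1) (.var 2)) (.const 0))) hf hg hh

theorem Feas.refineCell {f g} (hf : Feas f) (hg : Feas g) :
    Feas fun a e => refineCell a (f a e) (g a e) :=
  Feas.comp₂ (f := fun a T v => BoundedLoop.refineCell a T v)
    (.pushParts (.var 0) (.cell (.var 0) (.var 1)) (.cut (.cell (.var 0) (.var 1)))) hf hg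

theorem Feas.parts : Feas fun a _ => parts a :=
  Feas.fold (b := fun a v T _ => BoundedLoop.cond (v < a.n) (BoundedLoop.fold a.N
      (fun i T => BoundedLoop.cond (i < a.n) (BoundedLoop.refineCell a T v) T) T) T)
    (FeasP.cond (Feas.lt (.var 0) .numVerts)
      (Feas.fold (b := fun a i T e => BoundedLoop.cond (i < a.n)
        (BoundedLoop.refineCell a T (e 0)) T)
        (FeasP.cond (Feas.lt (.var 0) .numVerts) (.refineCell (.var 1) (.var 2)) (.var 1))
        (.var 1)) (.var 1))
    (.push (.const 0) (Feas.vset (p := fun _ _ _ => True)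
      ((Feas.eq (.const 0) (.const 0)).congr fun _ _ => by simp)) (.const 0))

theorem FeasP.refined {f} (hf : Feas f) : FeasP fun a e => refined a (f a e) :=
  FeasP.comp₁ (p := fun a T => BoundedLoop.refined a T)
    (FeasP.allV (p := fun a v e => BoundedLoop.allV a fun u =>
      BoundedLoop.bit a.N (BoundedLoop.cell a (e 0) v) u → u = v)
      (FeasP.allV (p := fun a u e => BoundedLoop.bit a.N (BoundedLoop.cell a (e 1) (e 0)) u →
        u = e 0)
        ((FeasP.bit (.cell (.var 2) (.var 1)) (.var 0)).imp (Feas.eq (.var 0) (.var 1))))) hf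

/-! ### Representative colorings -/

/-- The number of edges with both ends in `S`. -/
noncomputable def edges (a : Ambient) (S : ℕ) : ℕ :=
  ∑ u ∈ Finset.range a.N, ∑ v ∈ Finset.range a.N, cond (u < v ∧
    (u < a.n ∧ bit a.N S u) ∧ (v < a.n ∧ bit a.N S v) ∧ adj a u v) 1 0

/-- The subsets `S` and `S'` of `A` cannot be distinguished from outside of `A`. -/
def equivalent (a : Ambient) (A S S' : ℕ) : Prop :=
  agree a A S S' ∧ edges a S = edges a S' ∧ edges a (diff a A S) = edges a (diff a A S')

/-- Equality of vertex sets. -/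
def sameSet (a : Ambient) (A A' : ℕ) : Prop := allV a fun u => bit a.N A u ↔ bit a.N A' u

/-- `A` is the disjoint union of `B` and `C`. -/
def isUnion (a : Ambient) (A B C : ℕ) : Prop :=
  allV a fun u => (bit a.N A u ↔ bit a.N B u ∨ bit a.N C u) ∧ ¬ (bit a.N B u ∧ bit a.N C u)

/-- `A` is a singleton. -/
def isSingle (a : Ambient) (A : ℕ) : Prop := exV a fun v => allV a fun u => bit a.N A u ↔ u = v

/-- Adds `(A, S)` to the list, unless it has an entry that represents it. -/
noncomputable def insertRep (a : Ambient) (A S L : ℕ) : ℕ :=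
  cond (exE a L fun A' S' => sameSet a A' A ∧ equivalent a A S' S) L (push a L A S)

/-- Adds the subsets of `A` to the list if `A` is a singleton. -/
noncomputable def insertSingle (a : Ambient) (A L : ℕ) : ℕ :=
  cond (isSingle a A) (insertRep a A A (insertRep a A 0 L)) L

/-- Adds representatives of the subsets of `A` to the list. -/
noncomputable def merge (a : Ambient) (A L : ℕ) : ℕ :=
  foldE a L (fun A₁ S₁ L₁ => foldE a L (fun A₂ S₂ L₂ => cond (isUnion a A A₁ A₂)
    (insertRep a A (union a S₁ S₂) L₂) L₂) L₁) (insertSingle a A L)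

/-- Representatives for the sets in the list `T`, which are processed from the front. -/
noncomputable def reps (a : Ambient) (T : ℕ) : ℕ := foldE a T (fun A _ L => merge a A L) 0

/-- Some representative is a coloring with enough edges. -/
def answer (a : Ambient) : Prop := exE a (reps a (parts a)) fun A S =>
  (allV a fun u => bit a.N A u) ∧ a.par 3 ≤ edges a S + a.par 4 ∧
    a.par 5 ≤ edges a (diff a A S) + a.par 6

/-- The outcome of a round: `0` if no decomposition is found, else `1` for no and `2` for yes. -/
noncomputable def attempt (a : Ambient) : ℕ := cond (refined a (parts a)) (cond (answer a) 2 1) 0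

theorem Feas.edges {f} (hf : Feas f) : Feas fun a e => edges a (f a e) := by
  refine Feas.comp₁ (f := fun a S => BoundedLoop.edges a S) ?_ hf
  exact Feas.sum (b := fun a u e => ∑ v ∈ Finset.range a.N, BoundedLoop.cond (u < v ∧
    (u < a.n ∧ BoundedLoop.bit a.N (e 0) u) ∧ (v < a.n ∧ BoundedLoop.bit a.N (e 0) v) ∧
      BoundedLoop.adj a u v) 1 0)
    (Feas.sumIf (p := fun a v e => e 0 < v ∧ (e 0 < a.n ∧ BoundedLoop.bit a.N (e 1) (e 0)) ∧
      (v < a.n ∧ BoundedLoop.bit a.N (e 1) v) ∧ BoundedLoop.adj a (e 0) v) (b := fun _ _ _ => 1)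
      ((Feas.lt (.var 1) (.var 0)).and
        (((Feas.lt (.var 1) .numVerts).and (FeasP.bit (.var 2) (.var 1))).and
        (((Feas.lt (.var 0) .numVerts).and (FeasP.bit (.var 2) (.var 0))).and
          (FeasP.adj (.var 1) (.var 0))))) (.const 1))

theorem FeasP.equivalent {f g h} (hf : Feas f) (hg : Feas g) (hh : Feas h) :
    FeasP fun a e => equivalent a (f a e) (g a e) (h a e) :=
  FeasP.comp₃ (p := fun a A S S' => BoundedLoop.equivalent a A S S')
    ((FeasP.agree (.var 0) (.var 1) (.var 2)).and
      ((Feas.eq (.edges (.var 1)) (.edges (.var 2))).and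
        (Feas.eq (.edges (.diff (.var 0) (.var 1))) (.edges (.diff (.var 0) (.var 2)))))) hf hg hh

theorem FeasP.sameSet {f g} (hf : Feas f) (hg : Feas g) :
    FeasP fun a e => sameSet a (f a e) (g a e) :=
  FeasP.comp₂ (p := fun a A A' => BoundedLoop.sameSet a A A')
    (FeasP.allV (p := fun a u e => BoundedLoop.bit a.N (e 0) u ↔ BoundedLoop.bit a.N (e 1) u)
      ((FeasP.bit (.var 1) (.var 0)).iff (FeasP.bit (.var 2) (.var 0)))) hf hg

theorem FeasP.isUnion {f g h} (hf : Feas f) (hg : Feas g) (hh : Feas h) :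
    FeasP fun a e => isUnion a (f a e) (g a e) (h a e) :=
  have h1 : ∀ i, FeasP fun a e => BoundedLoop.bit a.N (e (i + 1)) (e 0) :=
    fun _ => FeasP.bit (.var _) (.var 0)
  FeasP.comp₃ (p := fun a A B C => BoundedLoop.isUnion a A B C)
    (FeasP.allV (p := fun a u e => (BoundedLoop.bit a.N (e 0) u ↔
      BoundedLoop.bit a.N (e 1) u ∨ BoundedLoop.bit a.N (e 2) u) ∧
      ¬ (BoundedLoop.bit a.N (e 1) u ∧ BoundedLoop.bit a.N (e 2) u))
      (((h1 0).iff ((h1 1).or (h1 2))).and ((h1 1).and (h1 2)).not)) hf hg hh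

theorem FeasP.isSingle {f} (hf : Feas f) : FeasP fun a e => isSingle a (f a e) :=
  FeasP.comp₁ (p := fun a A => BoundedLoop.isSingle a A)
    (FeasP.exV (p := fun a v e => BoundedLoop.allV a fun u => BoundedLoop.bit a.N (e 0) u ↔ u = v)
      (FeasP.allV (p := fun a u e => BoundedLoop.bit a.N (e 1) u ↔ u = e 0)
        ((FeasP.bit (.var 2) (.var 0)).iff (Feas.eq (.var 0) (.var 1))))) hf

theorem Feas.insertRep {f g h} (hf : Feas f) (hg : Feas g) (hh : Feas h) :
    Feas fun a e => insertRep a (f a e) (g a e) (h a e) :=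
  Feas.comp₃ (f := fun a A S L => BoundedLoop.insertRep a A S L)
    (FeasP.cond (FeasP.exE (p := fun a A' S' e => BoundedLoop.sameSet a A' (e 0) ∧
      BoundedLoop.equivalent a (e 0) S' (e 1)) (.var 2)
      ((FeasP.sameSet (.var 0) (.var 2)).and (FeasP.equivalent (.var 2) (.var 1) (.var 3))))
      (.var 2) (.push (.var 2) (.var 0) (.var 1))) hf hg hh

theorem Feas.insertSingle {f g} (hf : Feas f) (hg : Feas g) :
    Feas fun a e => insertSingle a (f a e) (g a e) :=
  Feas.comp₂ (f := fun a A L => BoundedLoop.insertSingle a A L)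
    (FeasP.cond (FeasP.isSingle (.var 0))
      (.insertRep (.var 0) (.var 0) (.insertRep (.var 0) (.const 0) (.var 1))) (.var 1)) hf hg

theorem Feas.merge {f g} (hf : Feas f) (hg : Feas g) : Feas fun a e => merge a (f a e) (g a e) :=
  Feas.comp₂ (f := fun a A L => BoundedLoop.merge a A L)
    (Feas.foldE (f := fun a A₁ S₁ L₁ e => BoundedLoop.foldE a (e 1) (fun A₂ S₂ L₂ =>
      BoundedLoop.cond (BoundedLoop.isUnion a (e 0) A₁ A₂)
        (BoundedLoop.insertRep a (e 0) (BoundedLoop.union a S₁ S₂) L₂) L₂) L₁) (.var 1)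
      (Feas.foldE (f := fun a A₂ S₂ L₂ e => BoundedLoop.cond
        (BoundedLoop.isUnion a (e 3) (e 0) A₂)
        (BoundedLoop.insertRep a (e 3) (BoundedLoop.union a (e 1) S₂) L₂) L₂) (.var 4)
        (FeasP.cond (FeasP.isUnion (.var 6) (.var 3) (.var 0))
          (.insertRep (.var 6) (.union (.var 4) (.var 1)) (.var 2)) (.var 2)) (.var 2))
      (.insertSingle (.var 0) (.var 1))) hf hg

theorem Feas.reps {f} (hf : Feas f) : Feas fun a e => reps a (f a e) :=
  Feas.comp₁ (f := fun a T => BoundedLoop.reps a T)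
    (Feas.foldE (f := fun a A _ L _ => BoundedLoop.merge a A L) (.var 0)
      (.merge (.var 0) (.var 2)) (.const 0)) hf

theorem FeasP.answer : FeasP fun a _ => answer a :=
  FeasP.exE (p := fun a A S _ => (BoundedLoop.allV a fun u => BoundedLoop.bit a.N A u) ∧
    a.par 3 ≤ BoundedLoop.edges a S + a.par 4 ∧
    a.par 5 ≤ BoundedLoop.edges a (BoundedLoop.diff a A S) + a.par 6) (.reps .parts)
    ((FeasP.allV (p := fun a u e => BoundedLoop.bit a.N (e 0) u)
      (FeasP.bit (.var 1) (.var 0))).and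
      ((Feas.le (.par 3) (.add (.edges (.var 1)) (.par 4))).and
        (Feas.le (.par 5) (.add (.edges (.diff (.var 0) (.var 1))) (.par 6)))))

theorem Feas.attempt : Feas fun a _ => attempt a :=
  FeasP.cond (FeasP.refined .parts) (FeasP.cond .answer (.const 2) (.const 1)) (.const 0)

end BoundedLoop

/-! ## The sets and lists that codes stand for -/

open Classical in
/-- The number of neighbors of `u` in `S`. -/
noncomputable def SimpleGraph.countIn {V : Type*} (G : SimpleGraph V) (S : Finset V) (u : V) : ℕ :=
  (S.filter fun v => G.Adj v u).card

open Classical in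
/-- The number of edges with both ends in `S`. -/
noncomputable def SimpleGraph.edgesIn {n : ℕ} (G : SimpleGraph (Fin n)) (S : Finset (Fin n)) : ℕ :=
  ((S ×ˢ S).filter fun p => p.1 < p.2 ∧ G.Adj p.1 p.2).card

namespace BoundedLoop

variable {a : Ambient} {n : ℕ} {G : SimpleGraph (Fin n)}

/-- The ambient data describe the graph `G`. -/
structure Describes (a : Ambient) {n : ℕ} (G : SimpleGraph (Fin n)) : Prop where
  n_eq : a.n = n
  n_lt : n < a.N
  adj_iff : ∀ u v : Fin n, adj a u v ↔ G.Adj u v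

/-- The vertex set with code `S`. -/
noncomputable def dec (a : Ambient) (n S : ℕ) : Finset (Fin n) :=
  open Classical in Finset.univ.filter fun v => bit a.N S v

theorem mem_dec {S : ℕ} {v : Fin n} : v ∈ dec a n S ↔ bit a.N S v := by simp [dec]

theorem dec_zero : dec a n 0 = ∅ := by
  ext v
  simp [mem_dec, bit]

theorem sum_cond_eq_card {α : Type*} (s : Finset α) (p : α → Prop) :
    ∑ x ∈ s, cond (p x) 1 0 = (open Classical in s.filter p).card := by
  classical
  rw [Finset.card_filter]
  exact Finset.sum_congr rfl fun x _ => by simp only [cond]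

namespace Describes

variable (h : Describes a G)

include h

theorem allV_iff {p : ℕ → Prop} : allV a p ↔ ∀ v : Fin n, p v := by
  rw [allV, h.n_eq]
  exact ⟨fun H v => H v (v.2.trans h.n_lt) v.2, fun H u _ hu => H ⟨u, hu⟩⟩

theorem exV_iff {p : ℕ → Prop} : exV a p ↔ ∃ v : Fin n, p v := by
  rw [exV, h.n_eq]
  exact ⟨fun ⟨u, _, hu, H⟩ => ⟨⟨u, hu⟩, H⟩, fun ⟨v, H⟩ => ⟨v, v.2.trans h.n_lt, v.2, H⟩⟩

theorem mem_vset {p : ℕ → Prop} {v : Fin n} : v ∈ dec a n (vset a p) ↔ p v := by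
  rw [mem_dec, vset, bit_mk, h.n_eq]
  simp [v.2, v.2.trans h.n_lt]

theorem sum_range {p : ℕ → Prop} : ∑ v ∈ Finset.range a.N, cond (v < a.n ∧ p v) 1 0 =
    (open Classical in Finset.univ.filter fun v : Fin n => p v).card := by
  classical
  rw [sum_cond_eq_card]
  symm
  refine Finset.card_bij (fun v _ => (v : ℕ)) ?_ (fun _ _ _ _ => Fin.ext) ?_
  · intro v hv
    simp only [Finset.mem_filter, Finset.mem_univ, true_and, Finset.mem_range] at hv ⊢
    exact ⟨v.2.trans h.n_lt, by rw [h.n_eq]; exact v.2, hv⟩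
  · intro u hu
    simp only [Finset.mem_filter, Finset.mem_range, h.n_eq] at hu
    exact ⟨⟨u, hu.2.1⟩, by simpa using hu.2.2, rfl⟩

theorem count_eq (S : ℕ) (u : Fin n) : count a S u = G.countIn (dec a n S) u := by
  classical
  rw [count, h.sum_range, SimpleGraph.countIn, dec, Finset.filter_filter]
  congr 1
  ext v
  simp [h.adj_iff]

theorem edges_eq (S : ℕ) : edges a S = G.edgesIn (dec a n S) := by
  classical
  rw [edges, SimpleGraph.edgesIn, ← Finset.sum_product', sum_cond_eq_card]
  symm
  refine Finset.card_bij (fun p _ => ((p.1 : ℕ), (p.2 : ℕ))) ?_ ?_ ?_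
  · rintro ⟨u, v⟩ hp
    simp only [Finset.mem_filter, Finset.mem_product, mem_dec, Finset.mem_range, h.n_eq,
      h.adj_iff] at hp ⊢
    exact ⟨⟨u.2.trans h.n_lt, v.2.trans h.n_lt⟩, hp.2.1, ⟨u.2, hp.1.1⟩, ⟨v.2, hp.1.2⟩, hp.2.2⟩
  · rintro ⟨u, v⟩ - ⟨u', v'⟩ - hp
    simp only [Prod.mk.injEq] at hp ⊢
    exact ⟨Fin.ext hp.1, Fin.ext hp.2⟩
  · rintro ⟨u, v⟩ hp
    simp only [Finset.mem_filter, h.n_eq] at hp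
    refine ⟨(⟨u, hp.2.2.1.1⟩, ⟨v, hp.2.2.2.1.1⟩), ?_, rfl⟩
    simp only [Finset.mem_filter, Finset.mem_product, mem_dec, ← h.adj_iff]
    exact ⟨⟨hp.2.2.1.2, hp.2.2.2.1.2⟩, hp.2.1, hp.2.2.2.2⟩

theorem width_eq : width a = n + n + 1 := by rw [width, h.n_eq]

end Describes

/-- `L` is the code of the list `l`. -/
def IsList (a : Ambient) (L : ℕ) (l : List (Finset (Fin n) × Finset (Fin n))) : Prop :=
  l.length * width a ≤ a.N ∧ ∀ r j, j < width a → (bit a.N L (r * width a + j) ↔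
    ∃ p, l[r]? = some p ∧ (j = 0 ∨ (∃ v : Fin n, j = 1 + v ∧ v ∈ p.1) ∨
      ∃ v : Fin n, j = 1 + n + v ∧ v ∈ p.2))

namespace IsList

theorem nil : IsList (n := n) a 0 [] := by
  refine ⟨by simp, fun r j _ => ?_⟩
  simp [bit]

variable {L : ℕ} {l : List (Finset (Fin n) × Finset (Fin n))} (hl : IsList a L l)

include hl

theorem length_le : l.length ≤ a.N :=
  (Nat.le_mul_of_pos_right _ (Nat.succ_pos _)).trans hl.1

/-- Bit 0 of each block marks its presence, which distinguishes an entry made of empty sets from no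
entry. -/
theorem occ_iff {r : ℕ} (hr : r < a.N) : occ a L r ↔ r < l.length := by
  have := hl.2 r 0 (Nat.succ_pos _)
  rw [add_zero] at this
  rw [occ, min_eq_left hr.le, this]
  constructor
  · rintro ⟨p, hp, -⟩
    exact (List.getElem?_eq_some_iff.1 hp).1
  · exact fun h => ⟨_, List.getElem?_eq_getElem h, Or.inl rfl⟩

theorem fst_eq (h : Describes a G) {r : ℕ} (hr : r < l.length) :
    dec a n (fst a L r) = l[r].1 := by
  ext v
  rw [fst, h.mem_vset, min_eq_left (hr.le.trans hl.length_le),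
    hl.2 r _ (by rw [h.width_eq]; omega), List.getElem?_eq_getElem hr]
  simp only [Option.some.injEq, exists_eq_left', Nat.add_eq_zero_iff, one_ne_zero, false_and,
    false_or]
  constructor
  · rintro (⟨w, hw, hm⟩ | ⟨w, hw, -⟩)
    · rwa [show v = w from Fin.ext (by omega)]
    · omega
  · exact fun hv => Or.inl ⟨v, rfl, hv⟩

theorem snd_eq (h : Describes a G) {r : ℕ} (hr : r < l.length) :
    dec a n (snd a L r) = l[r].2 := by
  ext v
  rw [snd, h.mem_vset, h.n_eq, min_eq_left (hr.le.trans hl.length_le),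
    hl.2 r _ (by rw [h.width_eq]; omega), List.getElem?_eq_getElem hr]
  simp only [Option.some.injEq, exists_eq_left', Nat.add_eq_zero_iff, one_ne_zero, false_and,
    false_or]
  constructor
  · rintro (⟨w, hw, -⟩ | ⟨w, hw, hm⟩)
    · omega
    · rwa [show v = w from Fin.ext (by omega)]
  · exact fun hv => Or.inr ⟨v, rfl, hv⟩

theorem exE_iff (h : Describes a G) {p : ℕ → ℕ → Prop}
    {q : Finset (Fin n) → Finset (Fin n) → Prop}
    (hpq : ∀ A S, p A S ↔ q (dec a n A) (dec a n S)) : exE a L p ↔ ∃ x ∈ l, q x.1 x.2 := by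
  constructor
  · rintro ⟨r, hr, ho, hp⟩
    have hr' := (hl.occ_iff hr).1 ho
    rw [hpq, hl.fst_eq h hr', hl.snd_eq h hr'] at hp
    exact ⟨_, List.getElem_mem hr', hp⟩
  · rintro ⟨x, hx, hq⟩
    obtain ⟨r, hr, rfl⟩ := List.getElem_of_mem hx
    have hr' := hr.trans_le hl.length_le
    refine ⟨r, hr', (hl.occ_iff hr').2 hr, ?_⟩
    rwa [hpq, hl.fst_eq h hr, hl.snd_eq h hr]

/-- The loop always has N rounds, but rounds beyond the length of the list change nothing; the
invariant is therefore indexed by the minimum of the round and the length. -/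
theorem foldE_induction (h : Describes a G) {f : ℕ → ℕ → ℕ → ℕ} {x : ℕ} (q : ℕ → ℕ → Prop)
    (h0 : q 0 x)
    (hs : ∀ r (hr : r < l.length) A S y, dec a n A = l[r].1 → dec a n S = l[r].2 → q r y →
      q (r + 1) (f A S y)) : q l.length (foldE a L f x) := by
  have := fold_induction (N := a.N) (x := x)
    (f := fun r y => cond (occ a L r) (f (fst a L r) (snd a L r) y) y)
    (fun r y => q (min r l.length) y) (by simpa using h0) ?_
  · rwa [min_eq_right hl.length_le] at this
  · intro r hr y hy
    simp only [cond, hl.occ_iff hr]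
    split_ifs with hr'
    · rw [min_eq_left (Nat.succ_le_of_lt hr')]
      rw [min_eq_left hr'.le] at hy
      exact hs r hr' _ _ _ (hl.fst_eq h hr') (hl.snd_eq h hr') hy
    · rw [min_eq_right (by omega)] at hy ⊢
      exact hy

/-- Room for one more block is the only condition on capacity. The counting lemmas
`length_le_of_keys`, `parts_fit` and `repList_fit` exist to supply it. -/
theorem push (h : Describes a G) (A S : ℕ) (hlen : (l.length + 1) * width a ≤ a.N) :
    IsList a (push a L A S) ((dec a n A, dec a n S) :: l) := by
  refine ⟨hlen, fun r j hj => ?_⟩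
  have hw := h.width_eq
  rw [BoundedLoop.push, bit_mk, h.n_eq]
  cases r with
  | zero =>
    have : 1 * width a ≤ a.N := le_trans (Nat.mul_le_mul_right _ (by omega)) hlen
    have h1 : ¬ width a ≤ j := by omega
    have h2 : j < a.N := by omega
    simp only [zero_mul, zero_add, h1, h2, false_and, or_false, true_and, hj,
      List.getElem?_cons_zero, Option.some.injEq, exists_eq_left', mem_dec]
    refine or_congr_right (or_congr ⟨?_, ?_⟩ ⟨?_, ?_⟩)
    · rintro ⟨h3, h4, h5⟩
      exact ⟨⟨j - 1, by omega⟩, by simp only; omega, h5⟩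
    · rintro ⟨v, rfl, hv⟩
      exact ⟨by omega, by omega, by rwa [Nat.add_sub_cancel_left]⟩
    · rintro ⟨h3, h5⟩
      exact ⟨⟨j - (1 + n), by omega⟩, by simp only; omega, h5⟩
    · rintro ⟨v, rfl, hv⟩
      exact ⟨by omega, by rwa [Nat.add_sub_cancel_left]⟩
  | succ r =>
    rw [List.getElem?_cons_succ, ← hl.2 r j hj]
    have h1 : (r + 1) * width a + j = width a + (r * width a + j) := by ring
    rw [h1, Nat.add_sub_cancel_left]
    constructor
    · rintro ⟨-, h2 | h2 | h2 | h2⟩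
      · omega
      · omega
      · omega
      · exact h2.2
    · intro hb
      refine ⟨?_, Or.inr (Or.inr (Or.inr ⟨by omega, hb⟩))⟩
      obtain ⟨p, hp, -⟩ := (hl.2 r j hj).1 hb
      have hr := (List.getElem?_eq_some_iff.1 hp).1
      have : (r + 2) * width a ≤ a.N := le_trans (Nat.mul_le_mul_right _ (by omega)) hlen
      have h3 : (r + 2) * width a = width a + (r * width a + width a) := by ring
      omega

end IsList

/-! ### Tuples -/

theorem quot_eq {x y : ℕ} (hx : x < a.N) (hy : 0 < y) : quot a x y = x / y := by
  rw [quot, sum_cond_eq_card]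
  refine (congrArg Finset.card ?_).trans (Finset.card_range _)
  ext q
  simp only [Finset.mem_filter, Finset.mem_range]
  constructor
  · rintro ⟨hq, hle⟩
    rw [min_eq_left (by omega)] at hle
    exact (Nat.le_div_iff_mul_le hy).2 hle
  · intro hq
    have := Nat.div_le_self x y
    rw [min_eq_left (by omega)]
    exact ⟨by omega, (Nat.le_div_iff_mul_le hy).1 hq⟩

theorem digit_eq (hn : 0 < a.n) {g j : ℕ} (hg : g < a.N) (hj : j < a.N) :
    digit a g j = g / a.n ^ j % a.n := by
  have h1 : dropDigits a g j = g / a.n ^ j := by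
    have := fold_induction (N := a.N) (x := g)
      (f := fun i y => cond (i < j) (quot a y a.n) y)
      (fun i y => y = g / a.n ^ min i j) (by simp) ?_
    · rwa [min_eq_right hj.le] at this
    · rintro i - y rfl
      simp only [cond]
      split_ifs with h
      · rw [quot_eq ((Nat.div_le_self _ _).trans_lt hg) hn, min_eq_left h.le,
          min_eq_left (Nat.succ_le_of_lt h), Nat.div_div_eq_div_mul, pow_succ]
      · rw [min_eq_right (by omega), min_eq_right (by omega)]
  have h2 : g / a.n ^ j < a.N := (Nat.div_le_self _ _).trans_lt hg
  rw [digit, h1, quot_eq h2 hn, min_eq_left ((Nat.div_le_self _ _).trans h2.le),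
    Nat.mod_eq_sub, mul_comm]

/-- Horner's scheme: an m-tuple of vertices is the digit sequence of a number below n^m, so a loop
over numbers runs through all tuples. -/
theorem exists_digits {n : ℕ} (hn : 0 < n) (m : ℕ) (f : ℕ → ℕ) (hf : ∀ j < m, f j < n) :
    ∃ g < n ^ m, ∀ j < m, g / n ^ j % n = f j := by
  induction m generalizing f with
  | zero => exact ⟨0, by simp, by simp⟩
  | succ m ih =>
    obtain ⟨g, hg, hd⟩ := ih (fun j => f (j + 1)) fun j hj => hf _ (by omega)
    have h0 := hf 0 (by omega)
    refine ⟨g * n + f 0, ?_, fun j hj => ?_⟩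
    · rw [pow_succ]
      nlinarith
    · cases j with
      | zero => simp [Nat.mod_eq_of_lt h0]
      | succ j =>
        rw [pow_succ', ← Nat.div_div_eq_div_mul, Nat.mul_comm g n, Nat.mul_add_div hn,
          Nat.div_eq_of_lt h0, add_zero, hd j (by omega)]

end BoundedLoop

/-! ## Cuts with few types of rows -/

namespace SimpleGraph

variable {V : Type*} {G : SimpleGraph V}

theorem countIn_singleton (v u : V) [Decidable (G.Adj v u)] :
    G.countIn {v} u = if G.Adj v u then 1 else 0 := by
  rw [countIn, Finset.filter_singleton]
  split_ifs <;> rfl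

variable (G)

/-- For subsets of `A`, the numbers of neighbors of the vertices in `X` determine the numbers of
neighbors of all vertices outside of `A`. -/
def Determines (A X : Finset V) : Prop :=
  ∀ S ⊆ A, ∀ S' ⊆ A, (∀ x ∈ X, G.countIn S x = G.countIn S' x) →
    ∀ u ∉ A, G.countIn S u = G.countIn S' u

/-- Towards the outside of `Z`, every vertex of `Z` has the same neighbors as some `b i`. -/
def HasRows (Z : Finset V) {w : ℕ} (b : Fin w → V) : Prop :=
  ∀ z ∈ Z, ∃ i, ∀ u ∉ Z, (G.Adj z u ↔ G.Adj (b i) u)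

/-- `u` tells some `z ∈ Z` from some `b ∈ B`, although no vertex of `C` does. -/
def Separates (B C Z : Finset V) (u : V) : Prop :=
  ∃ z ∈ Z, ∃ b ∈ B, (∀ c ∈ C, (G.Adj z c ↔ G.Adj b c)) ∧ ¬ (G.Adj z u ↔ G.Adj b u)

/-- `Z` is the least set that contains `D` and all vertices that separate it. -/
structure IsClosure (B C D Z : Finset V) : Prop where
  subset : D ⊆ Z
  closed : ∀ u, G.Separates B C Z u → u ∈ Z
  least : ∀ Z', D ⊆ Z' → (∀ u, G.Separates B C Z' u → u ∈ Z') → Z ⊆ Z'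

/-- `A` is determined by at most `m` vertices. -/
def Small (m : ℕ) (A : Finset V) : Prop := ∃ X : Finset V, X.card ≤ m ∧ G.Determines A X

variable {G}

theorem Determines.mono {A X Y : Finset V} (h : G.Determines A X) (hXY : X ⊆ Y) :
    G.Determines A Y :=
  fun S hS S' hS' hx => h S hS S' hS' fun x hx' => hx x (hXY hx')

variable [DecidableEq V]

/-- For u outside Z, the number of neighbors in S ⊆ Z is the scalar product of the vector of class
sizes of S with the column (Adj (b i) u)_i. Columns live in ℚ^w, so at most w of them span all the
others, and a linear functional that vanishes on those vanishes on every column. -/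
theorem HasRows.exists_columns [Fintype V] {Z : Finset V} {w : ℕ} {b : Fin w → V}
    (h : G.HasRows Z b) :
    ∃ C ⊆ Zᶜ, C.card ≤ w ∧ G.Determines Z C := by
  classical
  let col : V → Fin w → ℚ := fun u i => if G.Adj (b i) u then 1 else 0
  obtain rfl | ⟨z₀, hz₀⟩ := Z.eq_empty_or_nonempty
  · exact ⟨∅, by simp, by simp, fun S hS S' hS' _ u _ => by
      rw [Finset.subset_empty.1 hS, Finset.subset_empty.1 hS']⟩
  have : Nonempty V := ⟨z₀⟩
  have : Nonempty (Fin w) := ⟨(h z₀ hz₀).choose⟩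
  choose! cls hcls using h
  let m : Finset V → Fin w → ℚ := fun S i => ((S.filter fun z => cls z = i).card : ℚ)
  have hcount : ∀ S ⊆ Z, ∀ u ∉ Z, (G.countIn S u : ℚ) = ∑ i, m S i * col u i := by
    intro S hS u hu
    simp only [countIn, m, col, Finset.card_filter, Nat.cast_sum, Finset.sum_mul]
    rw [Finset.sum_comm]
    refine Finset.sum_congr rfl fun z hz => ?_
    rw [Finset.sum_eq_single (cls z) (fun i _ hi => by simp [hi.symm]) (by simp)]
    simp [hcls z (hS hz) u hu]
  obtain ⟨t, ht, hspan, hli⟩ :=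
    exists_linearIndependent ℚ (col '' (↑(Zᶜ) : Set V))
  have hfin : t.Finite := hli.setFinite
  choose! g hg using fun y (hy : y ∈ t) => ht hy
  refine ⟨hfin.toFinset.image g, ?_, ?_, ?_⟩
  · intro x hx
    simp only [Finset.mem_image, Set.Finite.mem_toFinset] at hx
    obtain ⟨y, hy, rfl⟩ := hx
    exact Finset.mem_coe.1 (hg y hy).1
  · refine Finset.card_image_le.trans ?_
    have hli' : LinearIndependent ℚ (fun x : hfin.toFinset => (x : Fin w → ℚ)) := by
      have := hli.comp (fun x : hfin.toFinset => (⟨x, hfin.mem_toFinset.1 x.2⟩ : t))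
        (fun x y hxy => Subtype.ext (congrArg (fun z : t => (z : Fin w → ℚ)) hxy))
      exact this
    simpa using hli'.finset_card_le_finrank
  · intro S hS S' hS' hx u hu
    -- The functional whose value at the column of v is the difference of the counts of S and S'.
    let φ : (Fin w → ℚ) →ₗ[ℚ] ℚ := ∑ i, (m S i - m S' i) • LinearMap.proj i
    have hφ : ∀ v ∉ Z, φ (col v) = (G.countIn S v : ℚ) - G.countIn S' v := by
      intro v hv
      rw [hcount S hS v hv, hcount S' hS' v hv, ← Finset.sum_sub_distrib]
      simp [φ, LinearMap.sum_apply, sub_mul]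
    have hker : Submodule.span ℚ t ≤ LinearMap.ker φ := by
      rw [Submodule.span_le]
      intro y hy
      have h1 := hg y hy
      have h2 : g y ∉ Z := by simpa using h1.1
      have h3 := hx (g y) (Finset.mem_image_of_mem g (hfin.mem_toFinset.2 hy))
      simp only [SetLike.mem_coe, LinearMap.mem_ker]
      rw [← h1.2, hφ _ h2, h3, sub_self]
    have hmem : col u ∈ Submodule.span ℚ t := by
      rw [hspan]
      exact Submodule.subset_span ⟨u, by simpa using hu, rfl⟩
    have := hker hmem
    rw [LinearMap.mem_ker, hφ u hu, sub_eq_zero] at this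
    exact_mod_cast this

/-- The columns C settle every vertex outside Z, in particular the members of X there. So all of X
is settled, and X takes care of the vertices of Z outside A. -/
theorem Determines.inter {A X Z C : Finset V} (h : G.Determines A X) (hC : G.Determines Z C) :
    G.Determines (A ∩ Z) (X ∩ Z ∪ C) := by
  intro S hS S' hS' hx u hu
  have hZ := hC S (hS.trans Finset.inter_subset_right) S' (hS'.trans Finset.inter_subset_right)
    fun x hxC => hx x (Finset.mem_union_right _ hxC)
  by_cases huZ : u ∈ Z
  · refine h S (hS.trans Finset.inter_subset_left) S' (hS'.trans Finset.inter_subset_left) ?_ u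
      fun huA => hu (Finset.mem_inter.2 ⟨huA, huZ⟩)
    intro x hxX
    by_cases hxZ : x ∈ Z
    · exact hx x (Finset.mem_union_left _ (Finset.mem_inter.2 ⟨hxX, hxZ⟩))
    · exact hZ x hxZ
  · exact hZ u huZ

/-- A subset of A \ Z lies outside Z, so a vertex of Z has the same number of neighbors in it as its
row representative. The representatives thus settle all of Z, including X ∩ Z. -/
theorem Determines.sdiff {A X Z : Finset V} (h : G.Determines A X) {w : ℕ} {b : Fin w → V}
    (hb : G.HasRows Z b) : G.Determines (A \ Z) (X \ Z ∪ Finset.univ.image b) := by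
  classical
  intro S hS S' hS' hx u hu
  have row : ∀ T ⊆ A \ Z, ∀ z ∈ Z, ∀ i, (∀ u ∉ Z, (G.Adj z u ↔ G.Adj (b i) u)) →
      G.countIn T z = G.countIn T (b i) := by
    intro T hT z _ i hi
    rw [countIn, countIn]
    congr 1
    refine Finset.filter_congr fun v hv => ?_
    rw [G.adj_comm v z, G.adj_comm v (b i)]
    exact hi v (Finset.mem_sdiff.1 (hT hv)).2
  have hZ : ∀ z ∈ Z, G.countIn S z = G.countIn S' z := by
    intro z hz
    obtain ⟨i, hi⟩ := hb z hz
    rw [row S hS z hz i hi, row S' hS' z hz i hi]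
    exact hx _ (Finset.mem_union_right _ (Finset.mem_image_of_mem b (Finset.mem_univ i)))
  by_cases huZ : u ∈ Z
  · exact hZ u huZ
  · refine h S (hS.trans Finset.sdiff_subset) S' (hS'.trans Finset.sdiff_subset) ?_ u
      fun huA => hu (Finset.mem_sdiff.2 ⟨huA, huZ⟩)
    intro x hxX
    by_cases hxZ : x ∈ Z
    · exact hZ x hxZ
    · exact hx x (Finset.mem_union_left _ (Finset.mem_sdiff.2 ⟨hxX, hxZ⟩))

/-- Apply determination to the singletons {z} and {b}: if they agree on C, they agree at every
vertex outside Z. Hence a set determined by C never grows under the closure, which keeps the closure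
inside it. -/
theorem Determines.closed {Z B C : Finset V} (hC : G.Determines Z C) (hB : B ⊆ Z)
    {u : V} (hu : G.Separates B C Z u) : u ∈ Z := by
  classical
  obtain ⟨z, hz, b, hb, hzb, hne⟩ := hu
  by_contra huZ
  apply hne
  have := hC {z} (by simpa using hz) {b} (by simpa using hB hb)
    (fun c hc => by simp only [countIn_singleton, hzb c hc]) u huZ
  simp only [countIn_singleton] at this
  by_cases h1 : G.Adj z u <;> by_cases h2 : G.Adj b u <;> simp_all

/-- The representative of z in the larger set Z still works: it agrees with z on C, which lies
outside Z, so a vertex outside Z' where they differ would have been added to Z'. -/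
theorem HasRows.of_closed [Fintype V] {Z Z' C : Finset V} {w : ℕ} {b : Fin w → V}
    (hZ : G.HasRows Z b)
    (hC : C ⊆ Zᶜ) (hsub : Z' ⊆ Z)
    (hcl : ∀ u, G.Separates (Finset.univ.image b) C Z' u → u ∈ Z') : G.HasRows Z' b := by
  intro z hz
  obtain ⟨i, hi⟩ := hZ z (hsub hz)
  refine ⟨i, fun u hu => ?_⟩
  by_contra hne
  exact hu (hcl u ⟨z, hz, b i, Finset.mem_image_of_mem b (Finset.mem_univ i),
    fun c hc => hi c (Finset.mem_compl.1 (hC hc)), hne⟩)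

end SimpleGraph

/-! ## Clique-width expressions -/

namespace CWExpr

variable {V : Type*} {w : ℕ}

theorem HasLabel.mem_verts {Φ : CWExpr V w} : ∀ {u l}, Φ.HasLabel u l → u ∈ Φ.verts := by
  induction Φ with
  | vertex v i => exact fun h => h.1
  | union Φ Ψ h₁ h₂ => exact fun h => h.imp h₁ h₂
  | join i j hij Φ h => exact fun h' => h h'
  | relabel i j Φ h => exact fun h' => h'.elim (fun h' => h h'.1) fun h' => h h'.1

theorem exists_hasLabel {Φ : CWExpr V w} : ∀ {u}, u ∈ Φ.verts → ∃ l, Φ.HasLabel u l := by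
  induction Φ with
  | vertex v i => exact fun h => ⟨i, h, rfl⟩
  | union Φ Ψ h₁ h₂ =>
    rintro u (h | h)
    · exact (h₁ h).imp fun _ => Or.inl
    · exact (h₂ h).imp fun _ => Or.inr
  | join i j hij Φ h => exact fun h' => h h'
  | relabel i j Φ h =>
    intro u hu
    obtain ⟨l, hl⟩ := h hu
    by_cases hli : l = i
    · exact ⟨j, Or.inr ⟨hli ▸ hl, rfl⟩⟩
    · exact ⟨l, Or.inl ⟨hl, hli⟩⟩

theorem WellFormed.hasLabel_unique {Φ : CWExpr V w} (hΦ : Φ.WellFormed) :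
    ∀ {u l l'}, Φ.HasLabel u l → Φ.HasLabel u l' → l = l' := by
  induction Φ with
  | vertex v i => exact fun h h' => h.2.trans h'.2.symm
  | union Φ Ψ h₁ h₂ =>
    rintro u l l' (h | h) (h' | h')
    · exact h₁ hΦ.1 h h'
    · exact (Set.disjoint_left.1 hΦ.2.2 h.mem_verts h'.mem_verts).elim
    · exact (Set.disjoint_left.1 hΦ.2.2 h'.mem_verts h.mem_verts).elim
    · exact h₂ hΦ.2.1 h h'
  | join i j hij Φ h => exact fun h' => h hΦ h'
  | relabel i j Φ h =>
    rintro u l l' (h₁ | h₁) (h₂ | h₂)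
    · exact h hΦ h₁.1 h₂.1
    · exact (h₁.2 (h hΦ h₁.1 h₂.1)).elim
    · exact (h₂.2 (h hΦ h₂.1 h₁.1)).elim
    · exact h₁.2.trans h₂.2.symm

theorem adj_mem_verts {Φ : CWExpr V w} :
    ∀ {u v}, Φ.graph.Adj u v → u ∈ Φ.verts ∧ v ∈ Φ.verts := by
  induction Φ with
  | vertex v i => exact fun h => h.elim
  | union Φ Ψ h₁ h₂ =>
    rintro u v (h | h)
    · exact (h₁ h).imp Or.inl Or.inl
    · exact (h₂ h).imp Or.inr Or.inr
  | join i j hij Φ h =>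
    rintro u v (h' | ⟨-, h' | h'⟩)
    · exact h h'
    · exact ⟨h'.1.mem_verts, h'.2.mem_verts⟩
    · exact ⟨h'.2.mem_verts, h'.1.mem_verts⟩
  | relabel i j Φ h => exact fun h' => h h'

/-- Vertices of the subset `Z` that look the same within `Φ`, except for their neighbors in `Z`. -/
def Alike (Φ : CWExpr V w) (Z : Finset V) (u v : V) : Prop :=
  (∀ x ∉ Z, (Φ.graph.Adj u x ↔ Φ.graph.Adj v x)) ∧ ∀ l, (Φ.HasLabel u l ↔ Φ.HasLabel v l)

variable [Fintype V] [DecidableEq V]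

-- The end of the descent: the whole vertex set of the current subexpression is taken, with its
-- labels. No edge leaves this set, so likeness reduces to having the same label.
open Classical in
theorem exists_balanced_of_le (X : Finset V) (Φ : CWExpr V w) (hΦ : Φ.WellFormed)
    (hX : w + 1 ≤ (X.filter (· ∈ Φ.verts)).card)
    (hle : (X.filter (· ∈ Φ.verts)).card ≤ 2 * w) :
    ∃ Z : Finset V, w + 1 ≤ (X ∩ Z).card ∧ (X ∩ Z).card ≤ 2 * w ∧ (∀ z ∈ Z, z ∈ Φ.verts) ∧
      ∃ lab : V → Fin w, ∀ u ∈ Z, ∀ v ∈ Z, lab u = lab v → Φ.Alike Z u v := by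
  have hZ : X ∩ Finset.univ.filter (· ∈ Φ.verts) = X.filter (· ∈ Φ.verts) := by
    ext; simp
  refine ⟨Finset.univ.filter (· ∈ Φ.verts), by rwa [hZ], by rwa [hZ], by simp, ?_⟩
  have hl : ∀ u, ∃ l, u ∈ Φ.verts → Φ.HasLabel u l := by
    intro u
    by_cases hu : u ∈ Φ.verts
    · exact (exists_hasLabel hu).imp fun _ h _ => h
    · obtain ⟨x, hx⟩ : (X.filter (· ∈ Φ.verts)).Nonempty := Finset.card_pos.1 (by omega)
      exact ⟨(exists_hasLabel (Finset.mem_filter.1 hx).2).choose, fun h => (hu h).elim⟩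
  choose lab hlab using hl
  refine ⟨lab, fun u hu v hv huv => ⟨fun x hx => ?_, fun l => ?_⟩⟩
  · simp only [Finset.mem_filter, Finset.mem_univ, true_and] at hx
    exact ⟨fun h => (hx (adj_mem_verts h).2).elim, fun h => (hx (adj_mem_verts h).2).elim⟩
  · simp only [Finset.mem_filter, Finset.mem_univ, true_and] at hu hv
    have h1 := hlab u hu
    have h2 := hlab v hv
    rw [← huv] at h2
    exact ⟨fun h => hΦ.hasLabel_unique h1 h ▸ h2, fun h => hΦ.hasLabel_unique h2 h ▸ h1⟩

open Classical in
/-- A set of more than `w` vertices is split in a balanced way by a set of a subexpression. -/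
theorem exists_balanced (X : Finset V) (Φ : CWExpr V w) (hΦ : Φ.WellFormed)
    (hX : w + 1 ≤ (X.filter (· ∈ Φ.verts)).card) :
    ∃ Z : Finset V, w + 1 ≤ (X ∩ Z).card ∧ (X ∩ Z).card ≤ 2 * w ∧ (∀ z ∈ Z, z ∈ Φ.verts) ∧
      ∃ lab : V → Fin w, ∀ u ∈ Z, ∀ v ∈ Z, lab u = lab v → Φ.Alike Z u v := by
  obtain hle | hlt := le_or_gt (X.filter (· ∈ Φ.verts)).card (2 * w)
  · exact exists_balanced_of_le X Φ hΦ hX hle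
  · clear hX
    induction Φ with
    | vertex v i =>
      have h1 : X.filter (· ∈ (vertex v i).verts) ⊆ {v} := fun x hx => by
        simpa [verts] using (Finset.mem_filter.1 hx).2
      have := Finset.card_le_card h1
      have := i.pos
      simp only [Finset.card_singleton] at *
      omega
    | union Φ Ψ h₁ h₂ =>
      have hsum : (X.filter (· ∈ (union Φ Ψ).verts)).card ≤
          (X.filter (· ∈ Φ.verts)).card + (X.filter (· ∈ Ψ.verts)).card := by
        refine (Finset.card_le_card ?_).trans (Finset.card_union_le _ _)
        intro x hx
        simpa [verts, ← and_or_left] using hx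
      -- More than 2w members of X are distributed over the two operands, so one of them receives at
      -- least w + 1. The descent stops there if it has at most 2w and continues otherwise.
      obtain h | h : w + 1 ≤ (X.filter (· ∈ Φ.verts)).card ∨
          w + 1 ≤ (X.filter (· ∈ Ψ.verts)).card := by omega
      · obtain ⟨Z, hZ₁, hZ₂, hsub, lab, hlab⟩ :=
          (le_or_gt (X.filter (· ∈ Φ.verts)).card (2 * w)).elim
            (exists_balanced_of_le X Φ hΦ.1 h) (h₁ hΦ.1)
        refine ⟨Z, hZ₁, hZ₂, fun z hz => Or.inl (hsub z hz), lab, fun u hu v hv huv => ?_⟩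
        have out : ∀ z ∈ Z, z ∉ Ψ.verts := fun z hz => Set.disjoint_left.1 hΦ.2.2 (hsub z hz)
        have adj : ∀ z ∈ Z, ∀ x, (union Φ Ψ).graph.Adj z x ↔ Φ.graph.Adj z x := fun z hz x =>
          ⟨fun h => h.elim id fun h => (out z hz (adj_mem_verts h).1).elim, Or.inl⟩
        have lbl : ∀ z ∈ Z, ∀ l, (union Φ Ψ).HasLabel z l ↔ Φ.HasLabel z l := fun z hz l =>
          ⟨fun h => h.elim id fun h => (out z hz h.mem_verts).elim, Or.inl⟩
        obtain ⟨hadj, hlbl⟩ := hlab u hu v hv huv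
        exact ⟨fun x hx => by rw [adj u hu, adj v hv, hadj x hx],
          fun l => by rw [lbl u hu, lbl v hv, hlbl]⟩
      · obtain ⟨Z, hZ₁, hZ₂, hsub, lab, hlab⟩ :=
          (le_or_gt (X.filter (· ∈ Ψ.verts)).card (2 * w)).elim
            (exists_balanced_of_le X Ψ hΦ.2.1 h) (h₂ hΦ.2.1)
        refine ⟨Z, hZ₁, hZ₂, fun z hz => Or.inr (hsub z hz), lab, fun u hu v hv huv => ?_⟩
        have out : ∀ z ∈ Z, z ∉ Φ.verts := fun z hz => Set.disjoint_right.1 hΦ.2.2 (hsub z hz)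
        have adj : ∀ z ∈ Z, ∀ x, (union Φ Ψ).graph.Adj z x ↔ Ψ.graph.Adj z x := fun z hz x =>
          ⟨fun h => h.elim (fun h => (out z hz (adj_mem_verts h).1).elim) id, Or.inr⟩
        have lbl : ∀ z ∈ Z, ∀ l, (union Φ Ψ).HasLabel z l ↔ Ψ.HasLabel z l := fun z hz l =>
          ⟨fun h => h.elim (fun h => (out z hz h.mem_verts).elim) id, Or.inr⟩
        obtain ⟨hadj, hlbl⟩ := hlab u hu v hv huv
        exact ⟨fun x hx => by rw [adj u hu, adj v hv, hadj x hx],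
          fun l => by rw [lbl u hu, lbl v hv, hlbl]⟩
    | join i j hij Φ h =>
      obtain ⟨Z, hZ₁, hZ₂, hsub, lab, hlab⟩ := h hΦ hlt
      refine ⟨Z, hZ₁, hZ₂, hsub, lab, fun u hu v hv huv => ?_⟩
      obtain ⟨hadj, hlbl⟩ := hlab u hu v hv huv
      refine ⟨fun x hx => ?_, hlbl⟩
      -- The new edges towards x outside Z depend on labels only, apart from the exclusion of loops
      -- by `fromRel`, which is vacuous because u and v lie in Z.
      have hux : u ≠ x := fun h => hx (h ▸ hu)
      have hvx : v ≠ x := fun h => hx (h ▸ hv)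
      simp only [graph, SimpleGraph.sup_adj, SimpleGraph.fromRel_adj, hadj x hx, hlbl, ne_eq, hux,
        hvx, not_false_eq_true, true_and]
    | relabel i j Φ h =>
      obtain ⟨Z, hZ₁, hZ₂, hsub, lab, hlab⟩ := h hΦ hlt
      refine ⟨Z, hZ₁, hZ₂, hsub, lab, fun u hu v hv huv => ?_⟩
      obtain ⟨hadj, hlbl⟩ := hlab u hu v hv huv
      exact ⟨hadj, fun l => by simp only [HasLabel, hlbl]⟩

end CWExpr

/-! ### Balanced cuts and cuts into small sets -/

namespace SimpleGraph

variable {V : Type*} [Fintype V] [DecidableEq V] {G : SimpleGraph V} {w : ℕ}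

/-- One vertex of Z is chosen for each label; vertices of Z with equal labels have the same
neighbors outside Z. Labels not occurring in Z get an arbitrary vertex of Z. -/
theorem exists_balanced_rows {Φ : CWExpr V w} (hΦ : Φ.Defines G) (X : Finset V)
    (hX : w + 1 ≤ X.card) :
    ∃ Z : Finset V, w + 1 ≤ (X ∩ Z).card ∧ (X ∩ Z).card ≤ 2 * w ∧
      ∃ b : Fin w → V, (∀ i, b i ∈ Z) ∧ G.HasRows Z b := by
  classical
  have hX' : X.filter (· ∈ Φ.verts) = X := by simp [hΦ.2.1]
  obtain ⟨Z, h₁, h₂, -, lab, hlab⟩ := CWExpr.exists_balanced X Φ hΦ.1 (by rwa [hX'])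
  obtain ⟨z₀, hz₀⟩ : Z.Nonempty := by
    obtain ⟨x, hx⟩ : (X ∩ Z).Nonempty := Finset.card_pos.1 (by omega)
    exact ⟨x, (Finset.mem_inter.1 hx).2⟩
  have : ∀ i, ∃ b ∈ Z, ∀ z ∈ Z, lab z = i → lab b = i := by
    intro i
    by_cases h : ∃ z ∈ Z, lab z = i
    · obtain ⟨z, hz, hi⟩ := h
      exact ⟨z, hz, fun _ _ _ => hi⟩
    · exact ⟨z₀, hz₀, fun z hz hi => (h ⟨z, hz, hi⟩).elim⟩
  choose b hb hlb using this
  refine ⟨Z, h₁, h₂, b, hb, fun z hz => ⟨lab z, fun u hu => ?_⟩⟩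
  have := (hlab z hz (b (lab z)) (hb _) (hlb _ z hz rfl).symm).1 u hu
  rwa [hΦ.2.2] at this

/-- A small set with at least two vertices is cut into two small sets by the closure of few
vertices, relative to few rows and columns. -/
theorem exists_small_cut {Φ : CWExpr V w} (hΦ : Φ.Defines G) (hw : 0 < w) {A : Finset V}
    (hA : 2 ≤ A.card) (hsmall : G.Small (3 * w + 1) A) :
    ∃ B C D : Finset V, (B.Nonempty ∧ B.card ≤ w) ∧ (C.Nonempty ∧ C.card ≤ w) ∧
      (D.Nonempty ∧ D.card ≤ 2 * w) ∧ ∀ Z, G.IsClosure B C D Z →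
        (A ∩ Z).Nonempty ∧ (A \ Z).Nonempty ∧ G.Small (3 * w + 1) (A ∩ Z) ∧
          G.Small (3 * w + 1) (A \ Z) := by
  classical
  have hex : ∃ m, G.Small m A := ⟨_, hsmall⟩
  -- X is a determining set of least size; minimality later makes both parts of the cut nonempty.
  obtain ⟨X, hXcard, hX⟩ := Nat.find_spec hex
  have hmin : ∀ Y : Finset V, G.Determines A Y → X.card ≤ Y.card := fun Y hY =>
    hXcard.trans (Nat.find_min' hex ⟨Y, le_rfl, hY⟩)
  have hX3 : X.card ≤ 3 * w + 1 := hXcard.trans (Nat.find_min' hex hsmall)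
  -- it suffices to find a good set with few rows
  suffices H : ∃ (Z₀ D : Finset V) (b : Fin w → V), (∀ i, b i ∈ Z₀) ∧ G.HasRows Z₀ b ∧
      Z₀ᶜ.Nonempty ∧ (D.Nonempty ∧ D.card ≤ 2 * w) ∧ D ⊆ Z₀ ∧ ∀ Z, D ⊆ Z → Z ⊆ Z₀ →
      G.HasRows Z b → (A ∩ Z).Nonempty ∧ (A \ Z).Nonempty ∧ G.Small (3 * w + 1) (A ∩ Z) ∧
        G.Small (3 * w + 1) (A \ Z) by
    obtain ⟨Z₀, D, b, hb, hrows, ⟨x, hx⟩, hD, hDZ, hgood⟩ := H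
    obtain ⟨C, hC, hCcard, hCdet⟩ := hrows.exists_columns
    -- The columns are made nonempty because a tuple of vertices always lists at least one; the
    -- complement of Z₀ provides the extra vertex.
    obtain ⟨C', hC', hCC', hne, hcard⟩ : ∃ C', C' ⊆ Z₀ᶜ ∧ C ⊆ C' ∧ C'.Nonempty ∧ C'.card ≤ w := by
      obtain rfl | hne := C.eq_empty_or_nonempty
      · exact ⟨{x}, by simpa using hx, by simp, by simp, by rw [Finset.card_singleton]; exact hw⟩
      · exact ⟨C, hC, subset_rfl, hne, hCcard⟩
    have hCdet' := hCdet.mono hCC'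
    have hBZ : Finset.univ.image b ⊆ Z₀ := by
      intro x hx
      obtain ⟨i, -, rfl⟩ := Finset.mem_image.1 hx
      exact hb i
    refine ⟨Finset.univ.image b, C', D, ⟨⟨b ⟨0, hw⟩, Finset.mem_image_of_mem b (Finset.mem_univ _)⟩,
      Finset.card_image_le.trans (by simp)⟩, ⟨hne, hcard⟩, hD, fun Z hZ => ?_⟩
    have hsub : Z ⊆ Z₀ := hZ.least Z₀ hDZ fun u hu => hCdet'.closed hBZ hu
    exact hgood Z hZ.subset hsub (hrows.of_closed hC' hsub hZ.closed)
  obtain hlt | hge := Nat.lt_or_ge (3 * w) X.card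
  · obtain ⟨Z₀, h₁, h₂, b, hb, hrows⟩ := exists_balanced_rows hΦ X (by omega)
    refine ⟨Z₀, X ∩ Z₀, b, hb, hrows, ?_, ⟨Finset.card_pos.1 (by omega), h₂⟩,
      Finset.inter_subset_right, fun Z hDZ hsub hrowsZ => ?_⟩
    · by_contra hne
      rw [Finset.not_nonempty_iff_eq_empty, Finset.compl_eq_empty_iff] at hne
      rw [hne, Finset.inter_univ] at h₂
      omega
    have hXZ : X ∩ Z = X ∩ Z₀ := by
      ext x
      simp only [Finset.mem_inter]
      exact ⟨fun h => ⟨h.1, hsub h.2⟩, fun h => ⟨h.1, hDZ (Finset.mem_inter.2 h)⟩⟩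
    have hsd : (X \ Z).card + (X ∩ Z).card = X.card := Finset.card_sdiff_add_card_inter X Z
    rw [hXZ] at hsd
    obtain ⟨C, -, hCcard, hCdet⟩ := hrowsZ.exists_columns
    have d₁ := hX.inter hCdet
    have c₁ : (X ∩ Z ∪ C).card ≤ 3 * w := by
      refine (Finset.card_union_le _ _).trans ?_
      rw [hXZ]; omega
    have d₂ := hX.sdiff hrowsZ
    have c₂ : (X \ Z ∪ Finset.univ.image b).card ≤ 3 * w := by
      refine (Finset.card_union_le _ _).trans ?_
      have : (Finset.univ.image b).card ≤ w := Finset.card_image_le.trans (by simp)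
      omega
    refine ⟨?_, ?_, ⟨_, by omega, d₁⟩, ⟨_, by omega, d₂⟩⟩
    -- If Z missed A, then A \ Z = A would be determined by 3w vertices, fewer than X has. The other
    -- part is nonempty for the same reason.
    · by_contra hne
      rw [Finset.not_nonempty_iff_eq_empty, ← Finset.disjoint_iff_inter_eq_empty] at hne
      rw [Finset.sdiff_eq_self_of_disjoint hne] at d₂
      have := hmin _ d₂
      omega
    · by_contra hne
      rw [Finset.not_nonempty_iff_eq_empty, Finset.sdiff_eq_empty_iff_subset] at hne
      rw [Finset.inter_eq_left.2 hne] at d₁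
      have := hmin _ d₁
      omega
  -- With at most 3w determining vertices there is room for one more: {v} has a single row, so
  -- cutting it off costs the rest of A at most the vertex v.
  · obtain ⟨v, hv, v', hv', hne⟩ := Finset.one_lt_card.1 (show 1 < A.card by omega)
    have hrow : ∀ Z : Finset V, Z ⊆ {v} → G.HasRows Z fun _ : Fin w => v := fun Z hZ z hz =>
      ⟨⟨0, hw⟩, fun u _ => by rw [Finset.mem_singleton.1 (hZ hz)]⟩
    refine ⟨{v}, {v}, fun _ => v, by simp, hrow _ subset_rfl, ⟨v', by simpa using hne.symm⟩,
      ⟨by simp, by rw [Finset.card_singleton]; omega⟩, subset_rfl, fun Z hDZ hsub hrowsZ => ?_⟩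
    obtain rfl : Z = {v} := hsub.antisymm hDZ
    obtain ⟨C, -, hCcard, hCdet⟩ := hrowsZ.exists_columns
    refine ⟨⟨v, by simpa using hv⟩, ⟨v', by simpa using ⟨hv', hne.symm⟩⟩,
      ⟨_, ?_, hX.inter hCdet⟩, ⟨_, ?_, hX.sdiff (hrow _ subset_rfl)⟩⟩
    · refine (Finset.card_union_le _ _).trans ?_
      have : (X ∩ {v}).card ≤ 1 :=
        (Finset.card_le_card Finset.inter_subset_right).trans (by simp)
      omega
    · refine (Finset.card_union_le _ _).trans ?_
      have h1 : (Finset.univ.image fun _ : Fin w => v).card ≤ 1 := by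
        rw [Finset.card_le_one]
        simp
      have h2 : (X \ {v}).card ≤ X.card := Finset.card_le_card Finset.sdiff_subset
      omega

end SimpleGraph

/-! ## Equivalent colorings -/

namespace SimpleGraph

variable {n : ℕ} {G : SimpleGraph (Fin n)}

theorem countIn_union {S T : Finset (Fin n)} (h : Disjoint S T) (u : Fin n) :
    G.countIn (S ∪ T) u = G.countIn S u + G.countIn T u := by
  classical
  rw [countIn, Finset.filter_union, Finset.card_union_of_disjoint]
  · rfl
  · exact Finset.disjoint_filter_filter h

theorem countIn_sdiff_add {A S : Finset (Fin n)} (h : S ⊆ A) (u : Fin n) :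
    G.countIn (A \ S) u + G.countIn S u = G.countIn A u := by
  rw [← countIn_union Finset.sdiff_disjoint, Finset.sdiff_union_of_subset h]

theorem sum_countIn_comm (S T : Finset (Fin n)) :
    ∑ u ∈ S, G.countIn T u = ∑ t ∈ T, G.countIn S t := by
  classical
  simp only [countIn, Finset.card_filter]
  rw [Finset.sum_comm]
  simp only [G.adj_comm]

theorem sum_countIn_self (S : Finset (Fin n)) :
    ∑ u ∈ S, G.countIn S u = 2 * G.edgesIn S := by
  classical
  have h1 : ∑ u ∈ S, G.countIn S u = ((S ×ˢ S).filter fun p => G.Adj p.1 p.2).card := by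
    simp only [countIn, Finset.card_filter]
    rw [Finset.sum_product]
    simp only [G.adj_comm]
  have h2 : (S ×ˢ S).filter (fun p => G.Adj p.1 p.2) =
      (S ×ˢ S).filter (fun p => p.1 < p.2 ∧ G.Adj p.1 p.2) ∪
        (S ×ˢ S).filter (fun p => p.2 < p.1 ∧ G.Adj p.1 p.2) := by
    ext p
    simp only [Finset.mem_filter, Finset.mem_union]
    constructor
    · rintro ⟨hp, hadj⟩
      rcases lt_or_gt_of_ne hadj.ne with h | h
      · exact Or.inl ⟨hp, h, hadj⟩
      · exact Or.inr ⟨hp, h, hadj⟩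
    · rintro (h | h)
      · exact ⟨h.1, h.2.2⟩
      · exact ⟨h.1, h.2.2⟩
  have h3 : ((S ×ˢ S).filter fun p => p.2 < p.1 ∧ G.Adj p.1 p.2).card = G.edgesIn S := by
    refine Finset.card_bij (fun p _ => p.swap) ?_ (fun _ _ _ _ h => Prod.swap_injective h) ?_
    · rintro ⟨u, v⟩ h
      simp only [Finset.mem_filter, Finset.mem_product, Prod.swap] at h ⊢
      exact ⟨h.1.symm, h.2.1, h.2.2.symm⟩
    · rintro ⟨u, v⟩ h
      simp only [Finset.mem_filter, Finset.mem_product] at h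
      exact ⟨(v, u), by simpa using ⟨h.1.symm, h.2.1, h.2.2.symm⟩, rfl⟩
  rw [h1, h2, Finset.card_union_of_disjoint, h3, edgesIn]
  · ring
  · rw [Finset.disjoint_filter]
    exact fun p _ h h' => lt_asymm h.1 h'.1

/-- Twice the number of edges is a sum of degrees, which is additive up to the two equal cross
terms. -/
theorem edgesIn_union {S T : Finset (Fin n)} (h : Disjoint S T) :
    G.edgesIn (S ∪ T) = G.edgesIn S + G.edgesIn T + ∑ t ∈ T, G.countIn S t := by
  have h1 := G.sum_countIn_self (S ∪ T)
  rw [Finset.sum_union h] at h1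
  simp only [countIn_union h, Finset.sum_add_distrib] at h1
  rw [sum_countIn_self, sum_countIn_self, sum_countIn_comm S T] at h1
  omega

theorem countIn_lt (S : Finset (Fin n)) (u : Fin n) : G.countIn S u < n + 1 := by
  classical
  have := Finset.card_le_univ (S.filter fun v => G.Adj v u)
  rw [Fintype.card_fin] at this
  exact Nat.lt_succ_of_le this

theorem edgesIn_lt (S : Finset (Fin n)) : G.edgesIn S < n * n + 1 := by
  classical
  have := Finset.card_le_univ ((S ×ˢ S).filter fun p => p.1 < p.2 ∧ G.Adj p.1 p.2)
  rw [Fintype.card_prod, Fintype.card_fin] at this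
  exact Nat.lt_succ_of_le this

variable (G)

/-- The vertices outside of `A` have the same numbers of neighbors in `S` and in `S'`. -/
def Agree (A S S' : Finset (Fin n)) : Prop := ∀ u ∉ A, G.countIn S u = G.countIn S' u

/-- The subsets `S` and `S'` of `A` cannot be distinguished from outside of `A`. -/
def Equivalent (A S S' : Finset (Fin n)) : Prop :=
  G.Agree A S S' ∧ G.edgesIn S = G.edgesIn S' ∧ G.edgesIn (A \ S) = G.edgesIn (A \ S')

/-- `A` is the disjoint union of `B` and `C`. -/
def _root_.Finset.IsUnion (A B C : Finset (Fin n)) : Prop := A = B ∪ C ∧ Disjoint B C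

variable {G}

theorem Equivalent.refl (A S : Finset (Fin n)) : G.Equivalent A S S :=
  ⟨fun _ _ => rfl, rfl, rfl⟩

theorem Equivalent.symm {A S S' : Finset (Fin n)} (h : G.Equivalent A S S') :
    G.Equivalent A S' S :=
  ⟨fun u hu => (h.1 u hu).symm, h.2.1.symm, h.2.2.symm⟩

theorem Equivalent.trans {A S S' S'' : Finset (Fin n)} (h : G.Equivalent A S S')
    (h' : G.Equivalent A S' S'') : G.Equivalent A S S'' :=
  ⟨fun u hu => (h.1 u hu).trans (h'.1 u hu), h.2.1.trans h'.2.1, h.2.2.trans h'.2.2⟩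

/-- The edges between S and T are counted from the side of T, where S may be replaced by S' since T
lies outside B; then from the side of S', where T may be replaced by T'. -/
theorem Agree.edgesIn_union {B C S S' T T' : Finset (Fin n)} (hBC : Disjoint B C) (hS : S ⊆ B)
    (hS' : S' ⊆ B) (hT : T ⊆ C) (hT' : T' ⊆ C) (h : G.Agree B S S') (h' : G.Agree C T T')
    (he : G.edgesIn S = G.edgesIn S') (he' : G.edgesIn T = G.edgesIn T') :
    G.edgesIn (S ∪ T) = G.edgesIn (S' ∪ T') := by
  rw [SimpleGraph.edgesIn_union (Finset.disjoint_of_subset_left hS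
      (Finset.disjoint_of_subset_right hT hBC)),
    SimpleGraph.edgesIn_union (Finset.disjoint_of_subset_left hS'
      (Finset.disjoint_of_subset_right hT' hBC)), he, he']
  congr 1
  calc ∑ t ∈ T, G.countIn S t = ∑ t ∈ T, G.countIn S' t :=
        Finset.sum_congr rfl fun t ht => h t (Finset.disjoint_right.1 hBC (hT ht))
    _ = ∑ s ∈ S', G.countIn T s := sum_countIn_comm _ _
    _ = ∑ s ∈ S', G.countIn T' s :=
        Finset.sum_congr rfl fun s hs => h' s (Finset.disjoint_left.1 hBC (hS' hs))
    _ = ∑ t ∈ T', G.countIn S' t := sum_countIn_comm _ _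

theorem Agree.sdiff {A S S' : Finset (Fin n)} (hS : S ⊆ A) (hS' : S' ⊆ A) (h : G.Agree A S S') :
    G.Agree A (A \ S) (A \ S') := by
  intro u hu
  have h1 := countIn_sdiff_add (G := G) hS u
  have h2 := countIn_sdiff_add (G := G) hS' u
  have := h u hu
  omega

/-- Outside counts add up. The numbers of edges inside are handled by `Agree.edgesIn_union`, once
for the red parts and once for their complements, which agree as well by `Agree.sdiff`. -/
theorem Equivalent.union {A B C S S' T T' : Finset (Fin n)} (hA : A.IsUnion B C) (hS : S ⊆ B)
    (hS' : S' ⊆ B) (hT : T ⊆ C) (hT' : T' ⊆ C) (h : G.Equivalent B S S')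
    (h' : G.Equivalent C T T') : G.Equivalent A (S ∪ T) (S' ∪ T') := by
  obtain ⟨rfl, hd⟩ := hA
  have sd : ∀ {S T : Finset (Fin n)}, S ⊆ B → T ⊆ C → (B ∪ C) \ (S ∪ T) = B \ S ∪ C \ T := by
    intro S T hS hT
    ext x
    have h1 : x ∈ B → x ∉ C := fun h => Finset.disjoint_left.1 hd h
    have h2 : x ∈ S → x ∈ B := fun h => hS h
    have h3 : x ∈ T → x ∈ C := fun h => hT h
    simp only [Finset.mem_sdiff, Finset.mem_union]
    tauto
  refine ⟨fun u hu => ?_, h.1.edgesIn_union hd hS hS' hT hT' h'.1 h.2.1 h'.2.1, ?_⟩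
  · rw [Finset.mem_union, not_or] at hu
    rw [countIn_union (Finset.disjoint_of_subset_left hS (Finset.disjoint_of_subset_right hT hd)),
      countIn_union (Finset.disjoint_of_subset_left hS' (Finset.disjoint_of_subset_right hT' hd)),
      h.1 u hu.1, h'.1 u hu.2]
  · rw [sd hS hT, sd hS' hT']
    exact (h.1.sdiff hS hS').edgesIn_union hd Finset.sdiff_subset Finset.sdiff_subset
      Finset.sdiff_subset Finset.sdiff_subset (h'.1.sdiff hT hT') h.2.2 h'.2.2

end SimpleGraph

/-! ## Decompositions -/

section Decomposition

variable {n : ℕ}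

open Classical in
/-- The intersection of the sets in the list that contain `v`. -/
noncomputable def cellOf (t : List (Finset (Fin n))) (v : Fin n) : Finset (Fin n) :=
  Finset.univ.filter fun u => ∀ A ∈ t, v ∈ A → u ∈ A

theorem mem_cellOf {t : List (Finset (Fin n))} {v u : Fin n} :
    u ∈ cellOf t v ↔ ∀ A ∈ t, v ∈ A → u ∈ A := by simp [cellOf]

theorem self_mem_cellOf (t : List (Finset (Fin n))) (v : Fin n) : v ∈ cellOf t v :=
  mem_cellOf.2 fun _ _ h => h

theorem cellOf_subset {t : List (Finset (Fin n))} {v : Fin n} {A} (hA : A ∈ t) (hv : v ∈ A) :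
    cellOf t v ⊆ A := fun _ hu => mem_cellOf.1 hu A hA hv

theorem cellOf_anti {t t' : List (Finset (Fin n))} (h : t ⊆ t') (v : Fin n) :
    cellOf t' v ⊆ cellOf t v := fun _ hu => mem_cellOf.2 fun A hA => mem_cellOf.1 hu A (h hA)

/-- Lists of sets that arise by adding the parts of cells with the property `p`. -/
inductive Decomposition (p : Finset (Fin n) → Prop) : List (Finset (Fin n)) → Prop
  | init : Decomposition p [Finset.univ]
  | step {t v B C} : Decomposition p t → (cellOf t v).IsUnion B C → B.Nonempty → C.Nonempty →
      p B → p C → Decomposition p (C :: B :: t)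

namespace Decomposition

variable {p : Finset (Fin n) → Prop} {t : List (Finset (Fin n))}

theorem prop_of_mem (hu : p Finset.univ) (h : Decomposition p t) : ∀ A ∈ t, p A := by
  induction h with
  | init => simpa using hu
  | step _ _ _ _ hB hC ih => simpa using ⟨hC, hB, ih⟩

theorem nonempty_of_mem [NeZero n] (h : Decomposition p t) : ∀ A ∈ t, A.Nonempty := by
  induction h with
  | init => simp
  | step _ _ hB hC _ _ ih => simpa using ⟨hC, hB, ih⟩

theorem univ_mem (h : Decomposition p t) : Finset.univ ∈ t := by
  induction h with
  | init => simp
  | step _ _ _ _ _ _ ih => simp [ih]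

/-- Every set is a cell, or the disjoint union of two sets further to the front. -/
theorem structure_aux (h : Decomposition p t) : (∀ v, cellOf t v ∈ t) ∧
    ∀ r (hr : r < t.length), (∀ v ∈ t[r], cellOf t v = t[r]) ∨
      ∃ i j, ∃ (hi : i < r) (hj : j < r), (t[r]).IsUnion t[i] t[j] ∧
        (t[i]).Nonempty ∧ (t[j]).Nonempty := by
  induction h with
  | init =>
    have : ∀ v : Fin n, cellOf [Finset.univ] v = Finset.univ := fun v => by
      ext; simp [mem_cellOf]
    refine ⟨fun v => by simp [this], fun r hr => Or.inl fun v _ => ?_⟩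
    obtain rfl : r = 0 := by simpa using hr
    exact this v
  | @step t v₀ B C ht hA hB hC hpB hpC ih =>
    obtain ⟨ih1, ih2⟩ := ih
    set A := cellOf t v₀ with hAdef
    have hBA : B ⊆ A := by rw [hA.1]; exact Finset.subset_union_left
    have hCA : C ⊆ A := by rw [hA.1]; exact Finset.subset_union_right
    -- The cell A is a member of the list. Were it the union of two disjoint nonempty members, the
    -- one that contains v₀ would contain the whole cell, leaving nothing for the other.
    have hleaf : ∀ v ∈ A, cellOf t v = A := by
      obtain ⟨r, hr, hrA⟩ := List.getElem_of_mem (ih1 v₀)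
      rw [← hAdef] at hrA
      rcases ih2 r hr with h | ⟨i, j, hi, hj, hu, ⟨x, hx⟩, ⟨y, hy⟩⟩
      · rwa [hrA] at h
      · exfalso
        rw [hrA] at hu
        have hv₀ : v₀ ∈ A := self_mem_cellOf t v₀
        have hxA : x ∈ A := by rw [hu.1]; exact Finset.mem_union_left _ hx
        have hyA : y ∈ A := by rw [hu.1]; exact Finset.mem_union_right _ hy
        rw [hu.1, Finset.mem_union] at hv₀
        rcases hv₀ with hv₀ | hv₀
        · exact Finset.disjoint_left.1 hu.2
            (cellOf_subset (List.getElem_mem (hi.trans hr)) hv₀ hyA) hy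
        · exact Finset.disjoint_left.1 hu.2 hx
            (cellOf_subset (List.getElem_mem (hj.trans hr)) hv₀ hxA)
    have hnew : ∀ v u, u ∈ cellOf (C :: B :: t) v ↔
        (v ∈ C → u ∈ C) ∧ (v ∈ B → u ∈ B) ∧ u ∈ cellOf t v := by
      intro v u
      simp [mem_cellOf]
    have hcC : ∀ v ∈ C, cellOf (C :: B :: t) v = C := by
      intro v hv
      ext u
      have hvB : v ∉ B := fun h => Finset.disjoint_left.1 hA.2 h hv
      rw [hnew, hleaf v (hCA hv)]
      have : u ∈ C → u ∈ A := fun h => hCA h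
      tauto
    have hcB : ∀ v ∈ B, cellOf (C :: B :: t) v = B := by
      intro v hv
      ext u
      have hvC : v ∉ C := fun h => Finset.disjoint_left.1 hA.2 hv h
      rw [hnew, hleaf v (hBA hv)]
      have : u ∈ B → u ∈ A := fun h => hBA h
      tauto
    have hcO : ∀ v ∉ A, cellOf (C :: B :: t) v = cellOf t v := by
      intro v hv
      ext u
      have hvC : v ∉ C := fun h => hv (hCA h)
      have hvB : v ∉ B := fun h => hv (hBA h)
      rw [hnew]
      tauto
    refine ⟨fun v => ?_, fun r hr => ?_⟩
    · by_cases hv : v ∈ A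
      · rw [hA.1, Finset.mem_union] at hv
        rcases hv with hv | hv
        · simp [hcB v hv]
        · simp [hcC v hv]
      · rw [hcO v hv]
        simp [ih1 v]
    · match r, hr with
      | 0, _ => exact Or.inl hcC
      | 1, _ => exact Or.inl hcB
      | r + 2, hr =>
        have hr' : r < t.length := by simpa using hr
        simp only [List.getElem_cons_succ]
        -- Only occurrences of A cease to be cells; they become the union of the two sets just added
        -- in front, at indices 1 and 0.
        by_cases hrA : t[r] = A
        · refine Or.inr ⟨1, 0, by omega, by omega, ?_, hB, hC⟩
          rw [hrA]
          exact hA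
        · rcases ih2 r hr' with hl | ⟨i, j, hi, hj, hu⟩
          · refine Or.inl fun v hv => ?_
            rw [hcO v fun hvA => hrA ((hl v hv).symm.trans (hleaf v hvA)), hl v hv]
          · exact Or.inr ⟨i + 2, j + 2, by omega, by omega, hu⟩

end Decomposition

end Decomposition

/-! ## Correctness of the tests for small sets and cuts -/

theorem List.length_le_card_of_pairwise {α β : Type*} [Fintype β] (f : α → β) {l : List α}
    (h : l.Pairwise fun x y => f x ≠ f y) : l.length ≤ Fintype.card β := by
  have : (l.map f).Nodup := List.pairwise_map.2 h
  simpa using this.length_le_card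

/-- Repeating an element pads the enumeration to length m, so tuples of fixed length describe all
nonempty sets with at most m elements. -/
theorem Finset.exists_enumeration {α : Type*} (s : Finset α) (hs : s.Nonempty) {m : ℕ}
    (hm : s.card ≤ m) : ∃ f : ℕ → α, ∀ x, x ∈ s ↔ ∃ j < m, f j = x := by
  classical
  obtain ⟨x₀, hx₀⟩ := hs
  refine ⟨fun j => s.toList.getD j x₀, fun x => ⟨fun hx => ?_, ?_⟩⟩
  · obtain ⟨j, hj, rfl⟩ := List.getElem_of_mem (Finset.mem_toList.2 hx)
    rw [Finset.length_toList] at hj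
    exact ⟨j, hj.trans_le hm, by simp [hj]⟩
  · rintro ⟨j, -, rfl⟩
    beta_reduce
    by_cases hj : j < s.toList.length
    · rw [List.getD_eq_getElem _ _ hj]
      exact Finset.mem_toList.1 (List.getElem_mem hj)
    · rw [List.getD_eq_default _ _ (not_lt.1 hj)]
      exact hx₀

/-- Inflationary iteration on the subsets of a set with `n` elements is stable from step `n` on. -/
theorem Finset.iterate_stable {n : ℕ} (f : Finset (Fin n) → Finset (Fin n)) (hf : ∀ Z, Z ⊆ f Z)
    (D : Finset (Fin n)) {m : ℕ} (hm : n < m) : f (f^[m] D) = f^[m] D := by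
  have key : ∀ i, f (f^[i] D) = f^[i] D ∨ i ≤ (f^[i] D).card := by
    intro i
    induction i with
    | zero => exact Or.inr (Nat.zero_le _)
    | succ i ih =>
      rw [Function.iterate_succ_apply']
      by_cases h : f (f^[i] D) = f^[i] D
      · exact Or.inl (by rw [h, h])
      · refine Or.inr (Nat.succ_le_of_lt ((ih.resolve_left h).trans_lt ?_))
        exact Finset.card_lt_card ((hf _).ssubset_of_ne (Ne.symm h))
  refine (key m).resolve_right fun h => ?_
  have := Finset.card_le_univ (f^[m] D)
  rw [Fintype.card_fin] at this
  omega

namespace BoundedLoop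

variable {a : Ambient} {n : ℕ} {G : SimpleGraph (Fin n)}

/-- The ambient data describe `G`, and the loops have enough rounds. -/
structure Suited (a : Ambient) {n : ℕ} (G : SimpleGraph (Fin n)) : Prop extends
    Describes a G where
  n_pos : 0 < n
  k_pos : 0 < a.k
  large : (n + 1) ^ (20 * a.k + 1) ≤ a.N

open Classical in
/-- The set of the digits of `g` at the positions `l, …, h - 1`. -/
noncomputable def tuple (a : Ambient) (n g l h : ℕ) : Finset (Fin n) :=
  Finset.univ.filter fun v => inTuple a g l h v

theorem mem_tuple {g l h : ℕ} {v : Fin n} : v ∈ tuple a n g l h ↔ inTuple a g l h v := by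
  simp [tuple]

theorem card_tuple_le (a : Ambient) (n g l h : ℕ) : (tuple a n g l h).card ≤ h - l := by
  classical
  rw [← Nat.card_Ico, ← Finset.card_image_of_injective _ Fin.val_injective]
  refine (Finset.card_le_card ?_).trans (Finset.card_image_le (f := digit a g))
  intro x hx
  obtain ⟨v, hv, rfl⟩ := Finset.mem_image.1 hx
  obtain ⟨j, -, hl, hh, hd⟩ := mem_tuple.1 hv
  exact Finset.mem_image.2 ⟨j, Finset.mem_Ico.2 ⟨hl, hh⟩, hd⟩

namespace Suited

variable (h : Suited a G)

include h

theorem pow_le {m : ℕ} (hm : m ≤ 20 * a.k + 1) : (n + 1) ^ m ≤ a.N :=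
  (Nat.pow_le_pow_right (Nat.succ_pos _) hm).trans h.large

theorem labels_lt : 20 * a.k + 1 < a.N := by
  refine Nat.lt_two_pow_self.trans_le (le_trans ?_ h.large)
  exact Nat.pow_le_pow_left (Nat.succ_le_succ h.n_pos) _

theorem exists_tuple {m : ℕ} (hm : m ≤ 20 * a.k + 1) (f : ℕ → Fin n) :
    ∃ g < a.N, ∀ l r, r ≤ m → ∀ v, v ∈ tuple a n g l r ↔ ∃ j, l ≤ j ∧ j < r ∧ f j = v := by
  obtain ⟨g, hg, hd⟩ := exists_digits h.n_pos m (fun j => f j) fun j _ => (f j).2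
  have hgN : g < a.N := hg.trans_le ((Nat.pow_le_pow_left (Nat.le_succ n) m).trans (h.pow_le hm))
  refine ⟨g, hgN, fun l r hr v => ?_⟩
  rw [mem_tuple]
  have hN := h.labels_lt
  have hdig : ∀ j < m, digit a g j = f j := fun j hj => by
    rw [digit_eq (by rw [h.n_eq]; exact h.n_pos) hgN (by omega), h.n_eq, hd j hj]
  constructor
  · rintro ⟨j, -, hl, hjr, hj⟩
    exact ⟨j, hl, hjr, Fin.ext (by rw [← hdig j (by omega), hj])⟩
  · rintro ⟨j, hl, hjr, rfl⟩
    exact ⟨j, by omega, hl, hjr, hdig j (by omega)⟩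

end Suited

/-! ### Closures -/

namespace Describes

variable (h : Describes a G)

include h

theorem sameRow_iff (g : ℕ) (z b : Fin n) : sameRow a g z b ↔
    ∀ c ∈ tuple a n g a.k (a.k + a.k), (G.Adj z c ↔ G.Adj b c) := by
  simp only [sameRow, h.allV_iff, h.adj_iff, mem_tuple]

/-- N rounds exceed the number of vertices, and each round before stabilization adds a vertex, so
the iteration ends in a fixed point; it stays inside every closed set that contains the seeds. -/
theorem isClosure_closure (g : ℕ) : G.IsClosure (tuple a n g 0 a.k)
    (tuple a n g a.k (a.k + a.k)) (tuple a n g (a.k + a.k) (a.k + a.k + a.k + a.k))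
    (dec a n (closure a g)) := by
  classical
  set B := tuple a n g 0 a.k
  set C := tuple a n g a.k (a.k + a.k)
  set D := tuple a n g (a.k + a.k) (a.k + a.k + a.k + a.k)
  let f : Finset (Fin n) → Finset (Fin n) := fun Z => Z ∪ Finset.univ.filter (G.Separates B C Z)
  have hf : ∀ Z u, u ∈ f Z ↔ u ∈ Z ∨ G.Separates B C Z u := by simp [f]
  have hgrow : ∀ Z, dec a n (grow a g Z) = f (dec a n Z) := by
    intro Z
    ext u
    rw [grow, h.mem_vset, hf, mem_dec]
    simp only [h.exV_iff, h.sameRow_iff, h.adj_iff, SimpleGraph.Separates, mem_dec, B, C, mem_tuple]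
  have hiter : dec a n (closure a g) = f^[a.N] D := by
    refine fold_induction (fun i Z => dec a n Z = f^[i] D) ?_ ?_
    · ext u
      rw [h.mem_vset]
      simp [D, mem_tuple]
    · intro i _ Z hZ
      rw [hgrow, hZ, Function.iterate_succ_apply']
  have hinfl : ∀ Z, Z ⊆ f Z := fun Z u hu => (hf Z u).2 (Or.inl hu)
  rw [hiter]
  refine ⟨?_, fun u hu => ?_, fun Z' hD hZ' => ?_⟩
  · have : ∀ i, D ⊆ f^[i] D := by
      intro i
      induction i with
      | zero => exact subset_rfl
      | succ i ih =>
        rw [Function.iterate_succ_apply']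
        exact ih.trans (hinfl _)
    exact this _
  · rw [← Finset.iterate_stable f hinfl D h.n_lt]
    exact (hf _ u).2 (Or.inr hu)
  · have : ∀ i, f^[i] D ⊆ Z' := by
      intro i
      induction i with
      | zero => exact hD
      | succ i ih =>
        rw [Function.iterate_succ_apply']
        intro u hu
        rcases (hf _ u).1 hu with hu | ⟨z, hz, b, hb⟩
        · exact ih hu
        · exact hZ' u ⟨z, ih hz, b, hb⟩
    exact this _

/-! ### Lists of sets with distinct keys -/

theorem agree_iff (A S S' : ℕ) :
    agree a A S S' ↔ G.Agree (dec a n A) (dec a n S) (dec a n S') := by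
  simp only [agree, h.allV_iff, SimpleGraph.Agree, mem_dec, h.count_eq]

theorem dec_addVertex (S : ℕ) (x : Fin n) :
    dec a n (addVertex a S x) = insert x (dec a n S) := by
  ext u
  rw [addVertex, h.mem_vset, Finset.mem_insert, mem_dec, Fin.ext_iff, or_comm]

end Describes

/-- The vertices of `X` have the same numbers of neighbors in `S` and in `S'`. -/
def SameKey (G : SimpleGraph (Fin n)) (X S S' : Finset (Fin n)) : Prop :=
  ∀ x ∈ X, G.countIn S x = G.countIn S' x

theorem countIn_insert {S : Finset (Fin n)} {x : Fin n} (hx : x ∉ S) (u : Fin n) :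
    G.countIn (insert x S) u = G.countIn {x} u + G.countIn S u := by
  rw [Finset.insert_eq, SimpleGraph.countIn_union (by simpa using hx)]

namespace Suited

variable (h : Suited a G)

include h

theorem sameKey_iff (g S S' : ℕ) : sameKey a g S S' ↔
    SameKey G (tuple a n g 0 (a.k + a.k + a.k + 1)) (dec a n S) (dec a n S') := by
  simp only [sameKey, h.allV_iff, SameKey, mem_tuple, h.count_eq]

/-- A key consists of at most 3k + 1 numbers between 0 and n, so at most (n+1)^(3k+1) sets have
distinct keys. This holds whether or not X determines anything, so the test never overflows. -/
theorem length_le_of_keys {X : Finset (Fin n)} (hX : X.card ≤ a.k + a.k + a.k + 1)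
    {l : List (Finset (Fin n) × Finset (Fin n))}
    (hl : l.Pairwise fun p q => ¬ SameKey G X p.2 q.2) : l.length * width a ≤ a.N := by
  have h1 : l.length ≤ (n + 1) ^ X.card := by
    have := List.length_le_card_of_pairwise
      (fun (p : Finset (Fin n) × Finset (Fin n)) (x : X) =>
        (⟨G.countIn p.2 x, G.countIn_lt p.2 x⟩ : Fin (n + 1))) (hl.imp fun {p q} hpq heq => ?_)
    · simpa using this
    · exact hpq fun x hx => congrArg Fin.val (congrFun heq ⟨x, hx⟩)
  have h2 : width a ≤ (n + 1) ^ 2 := by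
    rw [h.width_eq]
    nlinarith
  calc l.length * width a ≤ (n + 1) ^ (a.k + a.k + a.k + 1) * (n + 1) ^ 2 :=
        Nat.mul_le_mul (h1.trans (Nat.pow_le_pow_right (Nat.succ_pos _) hX)) h2
    _ = (n + 1) ^ (a.k + a.k + a.k + 1 + 2) := (pow_add _ _ _).symm
    _ ≤ a.N := h.pow_le (by have := h.k_pos; omega)

/-- The lists that occur in the construction of the key list of `A`: subsets of the part `Y` of `A`,
with distinct keys. -/
structure KeyList (a : Ambient) (G : SimpleGraph (Fin n)) (X Y : Finset (Fin n)) (L : ℕ)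
    (l : List (Finset (Fin n) × Finset (Fin n))) : Prop where
  isList : IsList a L l
  ne_nil : l ≠ []
  subset : ∀ p ∈ l, p.2 ⊆ Y
  pairwise : l.Pairwise fun p q => ¬ SameKey G X p.2 q.2

/-- The code 0 signals failure: it arises from a list in use only when two subsets of A have the
same key but differ outside A, which refutes determination. Otherwise S gets a representative that
agrees with it. -/
theorem insertKey_spec {g A S L : ℕ} {Y l}
    (hl : KeyList a G (tuple a n g 0 (a.k + a.k + a.k + 1)) Y L l)
    (hS : dec a n S ⊆ Y) (hY : Y ⊆ dec a n A) :
    (insertKey a g A L S = 0 ∧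
        ¬ G.Determines (dec a n A) (tuple a n g 0 (a.k + a.k + a.k + 1))) ∨
      ∃ l', KeyList a G (tuple a n g 0 (a.k + a.k + a.k + 1)) Y (insertKey a g A L S) l' ∧
        l ⊆ l' ∧ ∃ p ∈ l', SameKey G (tuple a n g 0 (a.k + a.k + a.k + 1)) p.2 (dec a n S) ∧
          G.Agree (dec a n A) p.2 (dec a n S) := by
  set X := tuple a n g 0 (a.k + a.k + a.k + 1) with hX
  have hocc : occ a L 0 :=
    (hl.isList.occ_iff (by have := h.labels_lt; omega)).2 (List.length_pos_of_ne_nil hl.ne_nil)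
  have e1 := hl.isList.exE_iff h.toDescribes
    (p := fun _ S' => sameKey a g S' S ∧ ¬ agree a A S' S)
    (q := fun _ S' => SameKey G X S' (dec a n S) ∧ ¬ G.Agree (dec a n A) S' (dec a n S))
    fun _ S' => by rw [h.sameKey_iff, h.agree_iff]
  have e2 := hl.isList.exE_iff h.toDescribes (p := fun _ S' => sameKey a g S' S)
    (q := fun _ S' => SameKey G X S' (dec a n S)) fun _ S' => h.sameKey_iff g S' S
  rw [insertKey, cond, cond]
  split_ifs with c1 c2
  · obtain ⟨p, hp, hk, hag⟩ := e1.1 (c1.resolve_left (not_not.2 hocc))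
    exact Or.inl ⟨rfl, fun hdet =>
      hag (hdet _ ((hl.subset p hp).trans hY) _ (hS.trans hY) hk)⟩
  · obtain ⟨p, hp, hk⟩ := e2.1 c2
    refine Or.inr ⟨l, hl, List.Subset.refl l, p, hp, hk, ?_⟩
    by_contra hag
    exact c1 (Or.inr (e1.2 ⟨p, hp, hk, hag⟩))
  · have hpw : ((∅, dec a n S) :: l).Pairwise fun p q => ¬ SameKey G X p.2 q.2 :=
      List.pairwise_cons.2 ⟨fun p hp hk => c2 (e2.2 ⟨p, hp, fun x hx => (hk x hx).symm⟩),
        hl.pairwise⟩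
    have hlist := hl.isList.push h.toDescribes 0 S
      (h.length_le_of_keys (by have := card_tuple_le a n g 0 (a.k + a.k + a.k + 1); omega) hpw)
    rw [dec_zero] at hlist
    exact Or.inr ⟨_, ⟨hlist, by simp, List.forall_mem_cons.2 ⟨hS, hl.subset⟩, hpw⟩,
      List.subset_cons_self _ _, _, List.mem_cons_self, fun _ _ => rfl, fun _ _ => rfl⟩

/-- The list represents all subsets of `Y`. -/
def Complete (G : SimpleGraph (Fin n)) (A X Y : Finset (Fin n))
    (l : List (Finset (Fin n) × Finset (Fin n))) : Prop :=
  ∀ S ⊆ Y, ∃ p ∈ l, SameKey G X p.2 S ∧ G.Agree A p.2 S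

omit h in
theorem foldE_zero (f : ℕ → ℕ → ℕ → ℕ) (x : ℕ) : foldE a 0 f x = x :=
  fold_induction (fun _ y => y = x) rfl fun r _ y hy => by
    simp [cond, occ, bit, hy]

omit h in
theorem insertKey_zero (g A S : ℕ) : insertKey a g A 0 S = 0 := by
  simp [insertKey, cond, occ, bit]

/-- Counts for a set with x added are those of the set plus those of {x}. Hence adding x to a
representative of T gives a set with the key and the outside counts of T with x added, and adding x
to representatives alone suffices. -/
theorem extend_spec {g A L : ℕ} {Y l} {x : Fin n}
    (hl : KeyList a G (tuple a n g 0 (a.k + a.k + a.k + 1)) Y L l)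
    (hc : Complete G (dec a n A) (tuple a n g 0 (a.k + a.k + a.k + 1)) Y l)
    (hY : insert x Y ⊆ dec a n A) (hx : x ∉ Y) :
    (extend a g A x L = 0 ∧
        ¬ G.Determines (dec a n A) (tuple a n g 0 (a.k + a.k + a.k + 1))) ∨
      ∃ l', KeyList a G (tuple a n g 0 (a.k + a.k + a.k + 1)) (insert x Y) (extend a g A x L) l' ∧
        Complete G (dec a n A) (tuple a n g 0 (a.k + a.k + a.k + 1)) (insert x Y) l' := by
  set X := tuple a n g 0 (a.k + a.k + a.k + 1) with hX
  have key := hl.isList.foldE_induction h.toDescribes (x := L)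
    (f := fun _ S L' => insertKey a g A L' (addVertex a S x))
    (fun r L' => (L' = 0 ∧ ¬ G.Determines (dec a n A) X) ∨
      ∃ l', KeyList a G X (insert x Y) L' l' ∧ l ⊆ l' ∧
        ∀ i (hi : i < l.length), i < r → ∃ p ∈ l', SameKey G X p.2 (insert x l[i].2) ∧
          G.Agree (dec a n A) p.2 (insert x l[i].2)) ?_ ?_
  · rcases key with hk | ⟨l', hl', hsub, hk⟩
    · exact Or.inl hk
    · refine Or.inr ⟨l', hl', fun S hS => ?_⟩
      by_cases hxS : x ∈ S
      · have hT : S.erase x ⊆ Y := fun u hu =>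
          (Finset.mem_insert.1 (hS (Finset.mem_of_mem_erase hu))).resolve_left
            (Finset.ne_of_mem_erase hu)
        obtain ⟨p, hp, hpk, hpa⟩ := hc _ hT
        obtain ⟨i, hi, rfl⟩ := List.getElem_of_mem hp
        obtain ⟨q, hq, hqk, hqa⟩ := hk i hi hi
        have hxp : x ∉ l[i].2 := fun hxp => hx (hl.subset _ hp hxp)
        have hcount : ∀ u, G.countIn l[i].2 u = G.countIn (S.erase x) u →
            G.countIn (insert x l[i].2) u = G.countIn S u := by
          intro u hu
          conv_rhs => rw [← Finset.insert_erase hxS]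
          rw [countIn_insert hxp, countIn_insert (Finset.notMem_erase x S), hu]
        exact ⟨q, hq, fun u hu => (hqk u hu).trans (hcount u (hpk u hu)),
          fun u hu => (hqa u hu).trans (hcount u (hpa u hu))⟩
      · obtain ⟨p, hp, hp'⟩ := hc S fun u hu =>
          (Finset.mem_insert.1 (hS hu)).resolve_left fun h => hxS (h ▸ hu)
        exact ⟨p, hsub hp, hp'⟩
  · exact Or.inr ⟨l, ⟨hl.isList, hl.ne_nil, fun p hp => (hl.subset p hp).trans
      (Finset.subset_insert _ _), hl.pairwise⟩, List.Subset.refl l, fun i _ hi => by omega⟩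
  · rintro r hr A' S L' - hS (⟨rfl, hdet⟩ | ⟨l', hl', hsub, hk⟩)
    · exact Or.inl ⟨insertKey_zero _ _ _, hdet⟩
    · have hS' : dec a n (addVertex a S x) = insert x l[r].2 := by
        rw [h.dec_addVertex, hS]
      have hsub' : dec a n (addVertex a S x) ⊆ insert x Y := by
        rw [hS']
        exact Finset.insert_subset_insert _ (hl.subset _ (List.getElem_mem hr))
      rcases h.insertKey_spec hl' hsub' hY with hz | ⟨l'', hl'', hsub'', p, hp, hpk⟩
      · exact Or.inl hz
      · refine Or.inr ⟨l'', hl'', List.Subset.trans hsub hsub'', fun i hi hir => ?_⟩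
        obtain rfl | hlt := Nat.eq_or_lt_of_le (Nat.le_of_lt_succ hir)
        · rw [hS'] at hpk
          exact ⟨p, hp, hpk⟩
        · obtain ⟨q, hq, hq'⟩ := hk i hi hlt
          exact ⟨q, hsub'' hq, hq'⟩

/-- If the construction survives, each subset of A agrees outside A with a listed set of the same
key, and listed sets have distinct keys; so equal keys force equal outside counts. If it fails, a
counterexample was met. -/
theorem occ_keyList_iff (g A : ℕ) : occ a (keyList a g A) 0 ↔
    G.Determines (dec a n A) (tuple a n g 0 (a.k + a.k + a.k + 1)) := by
  classical
  set X := tuple a n g 0 (a.k + a.k + a.k + 1) with hX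
  let Y : ℕ → Finset (Fin n) := fun i => (dec a n A).filter fun v => (v : ℕ) < i
  have key := fold_induction (N := a.N) (x := BoundedLoop.push a 0 0 0)
    (f := fun x L => cond (x < a.n ∧ bit a.N A x) (extend a g A x L) L)
    (fun i L => (L = 0 ∧ ¬ G.Determines (dec a n A) X) ∨
      ∃ l, KeyList a G X (Y i) L l ∧ Complete G (dec a n A) X (Y i) l) ?_ ?_
  · rw [← keyList] at key
    have hN : 0 < a.N := by have := h.n_lt; omega
    rcases key with ⟨h0, hdet⟩ | ⟨l, hl, hc⟩
    · simp only [h0, hdet, iff_false]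
      simp [occ, bit]
    · have hY : Y a.N = dec a n A :=
        Finset.filter_true_of_mem fun v _ => v.2.trans h.n_lt
      rw [hY] at hl hc
      refine iff_of_true ((hl.isList.occ_iff hN).2 (List.length_pos_of_ne_nil hl.ne_nil)) ?_
      intro S hS S' hS' hk
      obtain ⟨p, hp, hpk, hpa⟩ := hc S hS
      obtain ⟨q, hq, hqk, hqa⟩ := hc S' hS'
      have hpq : p = q := by
        by_contra hne
        have hkey : SameKey G X p.2 q.2 := fun x hx =>
          (hpk x hx).trans ((hk x hx).trans (hqk x hx).symm)
        have hsymm : Std.Symm fun p q : Finset (Fin n) × Finset (Fin n) =>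
            ¬ SameKey G X p.2 q.2 := ⟨fun p q h h' => h fun x hx => (h' x hx).symm⟩
        exact hl.pairwise.forall hp hq hne hkey
      subst hpq
      exact fun u hu => (hpa u hu).symm.trans (hqa u hu)
  · have hY : Y 0 = ∅ := Finset.filter_false_of_mem fun v _ => Nat.not_lt_zero _
    have hpw : [((∅ : Finset (Fin n)), (∅ : Finset (Fin n)))].Pairwise
      fun p q => ¬ SameKey G X p.2 q.2 := List.pairwise_singleton _ _
    have hlist := (IsList.nil (a := a) (n := n)).push h.toDescribes 0 0
      (h.length_le_of_keys (by have := card_tuple_le a n g 0 (a.k + a.k + a.k + 1); omega) hpw)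
    rw [dec_zero] at hlist
    refine Or.inr ⟨_, ⟨hlist, by simp, by simp, hpw⟩, fun S hS => ?_⟩
    rw [hY, Finset.subset_empty] at hS
    subst hS
    exact ⟨_, List.mem_cons_self, fun _ _ => rfl, fun _ _ => rfl⟩
  · rintro i hi L hL
    simp only [cond]
    split_ifs with hA
    · rw [h.n_eq] at hA
      let x : Fin n := ⟨i, hA.1⟩
      have hYs : Y (i + 1) = insert x (Y i) := by
        ext v
        simp only [Y, Finset.mem_filter, Finset.mem_insert, Fin.ext_iff, x, mem_dec]
        constructor
        · rintro ⟨h1, h2⟩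
          by_cases hv : (v : ℕ) = i
          · exact Or.inl hv
          · exact Or.inr ⟨h1, by omega⟩
        · rintro (hv | ⟨h1, h2⟩)
          · exact ⟨by rw [hv]; exact hA.2, by omega⟩
          · exact ⟨h1, by omega⟩
      rcases hL with ⟨rfl, hdet⟩ | ⟨l, hl, hc⟩
      · exact Or.inl ⟨by rw [extend, foldE_zero], hdet⟩
      · rw [hYs]
        exact h.extend_spec (x := x) hl hc (by rw [← hYs]; exact Finset.filter_subset _ _)
          (by simp [Y, x])
    · have hYs : Y (i + 1) = Y i := by
        ext v
        simp only [Y, Finset.mem_filter, mem_dec]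
        refine and_congr_right fun hv => ⟨fun h1 => ?_, fun h1 => by omega⟩
        by_contra h2
        obtain rfl : (v : ℕ) = i := by omega
        exact hA ⟨by rw [h.n_eq]; exact v.2, hv⟩
      rwa [hYs]

theorem small_iff (A : ℕ) : small a A ↔ G.Small (3 * a.k + 1) (dec a n A) := by
  constructor
  · rintro ⟨g, -, hocc⟩
    refine ⟨_, ?_, (h.occ_keyList_iff g A).1 hocc⟩
    have := card_tuple_le a n g 0 (a.k + a.k + a.k + 1)
    omega
  · rintro ⟨X, hX, hdet⟩
    obtain ⟨X', hne, hcard, hsub⟩ : ∃ X' : Finset (Fin n), X'.Nonempty ∧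
        X'.card ≤ a.k + a.k + a.k + 1 ∧ X ⊆ X' := by
      obtain rfl | hne := X.eq_empty_or_nonempty
      · exact ⟨{⟨0, h.n_pos⟩}, by simp, by simp, by simp⟩
      · exact ⟨X, hne, by omega, subset_rfl⟩
    obtain ⟨f, hf⟩ := X'.exists_enumeration hne hcard
    have hk := h.k_pos
    obtain ⟨g, hg, hgf⟩ := h.exists_tuple (m := a.k + a.k + a.k + 1) (by omega) f
    refine ⟨g, hg, (h.occ_keyList_iff g A).2 ?_⟩
    have : tuple a n g 0 (a.k + a.k + a.k + 1) = X' := by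
      ext v
      rw [hgf 0 _ le_rfl, hf]
      simp
    rw [this]
    exact hdet.mono hsub

end Suited

end BoundedLoop

/-! ## Correctness of the decomposition -/

namespace BoundedLoop

variable {a : Ambient} {n : ℕ} {G : SimpleGraph (Fin n)}

namespace Describes

variable (h : Describes a G)

include h

theorem dec_inter (A Z : ℕ) : dec a n (inter a A Z) = dec a n A ∩ dec a n Z := by
  ext u
  rw [inter, h.mem_vset, Finset.mem_inter, mem_dec, mem_dec]

theorem dec_diff (A Z : ℕ) : dec a n (diff a A Z) = dec a n A \ dec a n Z := by
  ext u
  rw [diff, h.mem_vset, Finset.mem_sdiff, mem_dec, mem_dec]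

theorem dec_union (A Z : ℕ) : dec a n (union a A Z) = dec a n A ∪ dec a n Z := by
  ext u
  rw [union, h.mem_vset, Finset.mem_union, mem_dec, mem_dec]

theorem dec_cell {T : ℕ} {l : List (Finset (Fin n) × Finset (Fin n))} (hl : IsList a T l)
    (v : Fin n) : dec a n (cell a T v) = cellOf (l.map Prod.fst) v := by
  ext u
  rw [cell, h.mem_vset, hl.exE_iff h (p := fun A _ => bit a.N A v ∧ ¬ bit a.N A u)
    (q := fun A _ => v ∈ A ∧ u ∉ A) fun A _ => by rw [mem_dec, mem_dec], mem_cellOf]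
  simp only [List.mem_map, not_exists, not_and, not_not]
  constructor
  · rintro H A ⟨p, hp, rfl⟩ hv
    exact H p hp hv
  · exact fun H p hp hv => H _ ⟨p, hp, rfl⟩ hv

end Describes

namespace Suited

variable (h : Suited a G)

include h

theorem goodCut_iff (A Z : ℕ) : goodCut a A Z ↔
    (dec a n A ∩ dec a n Z).Nonempty ∧ (dec a n A \ dec a n Z).Nonempty ∧
      G.Small (3 * a.k + 1) (dec a n A ∩ dec a n Z) ∧
        G.Small (3 * a.k + 1) (dec a n A \ dec a n Z) := by
  have hne : ∀ S : ℕ, (exV a fun u => bit a.N S u) ↔ (dec a n S).Nonempty := fun S => by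
    rw [h.exV_iff]
    exact exists_congr fun v => mem_dec.symm
  rw [goodCut, hne, hne, h.small_iff, h.small_iff, h.dec_inter, h.dec_diff]

omit h in
theorem goodCut_cut {A : ℕ} (hc : cut a A ≠ 0) : goodCut a A (cut a A) := by
  have := fold_induction (N := a.N) (x := 0)
    (f := fun g Z => cond (Z = 0 ∧ goodCut a A (closure a g)) (closure a g) Z)
    (fun _ Z => Z ≠ 0 → goodCut a A Z) (fun h => (h rfl).elim) ?_
  · exact this hc
  · intro g _ Z hZ
    simp only [cond]
    split_ifs with hg
    · exact fun _ => hg.2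
    · exact hZ

/-- The value 0 can stand for "no cut yet", since a good cut meets A and so its code is not 0. -/
theorem cut_ne_zero {A g : ℕ} (hg : g < a.N) (hgood : goodCut a A (closure a g)) :
    cut a A ≠ 0 := by
  have hne : closure a g ≠ 0 := by
    intro h0
    obtain ⟨⟨x, hx⟩, -⟩ := (h.goodCut_iff _ _).1 hgood
    rw [h0, dec_zero, Finset.inter_empty] at hx
    simp at hx
  have := fold_induction (N := a.N) (x := 0)
    (f := fun g Z => cond (Z = 0 ∧ goodCut a A (closure a g)) (closure a g) Z)
    (fun i Z => g < i → Z ≠ 0) (fun h => (Nat.not_lt_zero _ h).elim) ?_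
  · exact this hg
  · intro i _ Z hZ hi
    simp only [cond]
    split_ifs with hc
    · rintro h0
      obtain ⟨⟨x, hx⟩, -⟩ := (h.goodCut_iff _ _).1 hc.2
      rw [h0, dec_zero, Finset.inter_empty] at hx
      simp at hx
    · obtain rfl | hlt := Nat.eq_or_lt_of_le (Nat.le_of_lt_succ hi)
      · exact fun h0 => hc ⟨h0, hgood⟩
      · exact hZ hlt

/-- The rows, columns and seeds of `exists_small_cut` are written one after the other into a tuple
of 4k digits, which the search over all g below N encounters. -/
theorem exists_cut {Φ : CWExpr (Fin n) a.k} (hΦ : Φ.Defines G) {A : ℕ}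
    (hA : 2 ≤ (dec a n A).card) (hsmall : G.Small (3 * a.k + 1) (dec a n A)) : cut a A ≠ 0 := by
  obtain ⟨B, C, D, ⟨hB, hBc⟩, ⟨hC, hCc⟩, ⟨hD, hDc⟩, hgood⟩ :=
    SimpleGraph.exists_small_cut hΦ h.k_pos hA hsmall
  obtain ⟨fB, hfB⟩ := B.exists_enumeration hB hBc
  obtain ⟨fC, hfC⟩ := C.exists_enumeration hC hCc
  obtain ⟨fD, hfD⟩ := D.exists_enumeration hD hDc
  have hk := h.k_pos
  obtain ⟨g, hg, hgf⟩ := h.exists_tuple (m := a.k + a.k + a.k + a.k) (by omega) fun j =>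
    if j < a.k then fB j else if j < a.k + a.k then fC (j - a.k) else fD (j - (a.k + a.k))
  refine h.cut_ne_zero hg ((h.goodCut_iff _ _).2 (hgood _ ?_))
  have hcl := h.isClosure_closure g
  have eB : tuple a n g 0 a.k = B := by
    ext v
    rw [hgf 0 _ (by omega), hfB]
    refine exists_congr fun j => ?_
    by_cases hj : j < a.k <;> simp [hj]
  have eC : tuple a n g a.k (a.k + a.k) = C := by
    ext v
    rw [hgf _ _ (by omega), hfC]
    constructor
    · rintro ⟨j, h1, h2, h3⟩
      rw [if_neg (by omega), if_pos h2] at h3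
      exact ⟨j - a.k, by omega, h3⟩
    · rintro ⟨j, h1, h2⟩
      refine ⟨j + a.k, by omega, by omega, ?_⟩
      rwa [if_neg (by omega), if_pos (by omega), Nat.add_sub_cancel]
  have eD : tuple a n g (a.k + a.k) (a.k + a.k + a.k + a.k) = D := by
    ext v
    rw [hgf _ _ (by omega), hfD]
    constructor
    · rintro ⟨j, h1, h2, h3⟩
      rw [if_neg (by omega), if_neg (by omega)] at h3
      exact ⟨j - (a.k + a.k), by omega, h3⟩
    · rintro ⟨j, h1, h2⟩
      refine ⟨j + (a.k + a.k), by omega, by omega, ?_⟩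
      rwa [if_neg (by omega), if_neg (by omega), Nat.add_sub_cancel]
  rwa [eB, eC, eD] at hcl

/-- The list with code `T` is a decomposition into small sets, with at most `m` entries. -/
structure IsParts (a : Ambient) (G : SimpleGraph (Fin n)) (m T : ℕ)
    (l : List (Finset (Fin n) × Finset (Fin n))) : Prop where
  isList : IsList a T l
  decomp : Decomposition (G.Small (3 * a.k + 1)) (l.map Prod.fst)
  length_le : l.length ≤ m

omit h in
theorem small_univ (m : ℕ) : G.Small m Finset.univ :=
  ⟨∅, by simp, fun _ _ _ _ _ u hu => (hu (Finset.mem_univ u)).elim⟩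

theorem parts_fit {m : ℕ} (hm : m ≤ 2 * n * n + 1) : m * width a ≤ a.N := by
  calc m * width a ≤ (n + 1) ^ 3 * (n + 1) ^ 2 := by
        rw [h.width_eq]
        exact Nat.mul_le_mul (by nlinarith [Nat.zero_le n, Nat.zero_le (n * n * n)]) (by nlinarith)
    _ = (n + 1) ^ 5 := (pow_add _ _ _).symm
    _ ≤ a.N := h.pow_le (by have := h.k_pos; omega)

/-- One refinement step; the cell of `v` shrinks, if there are enough cuts. -/
theorem refineCell_spec {m T l} (hl : IsParts a G m T l) (hm : m + 2 ≤ 2 * n * n + 1)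
    (v : Fin n) : ∃ l', IsParts a G (m + 2) (refineCell a T v) l' ∧ l ⊆ l' ∧
      (∀ Φ : CWExpr (Fin n) a.k, Φ.Defines G → ∀ c, 1 ≤ c →
        (cellOf (l.map Prod.fst) v).card ≤ c + 1 → (cellOf (l'.map Prod.fst) v).card ≤ c) := by
  have hcell := h.dec_cell hl.isList v
  rw [refineCell, pushParts, cond]
  split_ifs with h0
  · refine ⟨l, ⟨hl.isList, hl.decomp, hl.length_le.trans (by omega)⟩, List.Subset.refl l,
      fun Φ hΦ c hc hle => ?_⟩
    by_contra hlt
    refine h.exists_cut hΦ (A := cell a T v) (by rw [hcell]; omega) ?_ h0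
    rw [hcell]
    exact hl.decomp.prop_of_mem (small_univ _) _ (hl.decomp.structure_aux.1 v)
  · obtain ⟨hB, hC, hsB, hsC⟩ := (h.goodCut_iff _ _).1 (goodCut_cut h0)
    rw [hcell] at hB hC hsB hsC
    have hlen := hl.length_le
    have p1 := hl.isList.push h.toDescribes (inter a (cell a T v) (cut a (cell a T v))) 0
      (h.parts_fit (by omega))
    have p2 := p1.push h.toDescribes (diff a (cell a T v) (cut a (cell a T v))) 0
      (h.parts_fit (by rw [List.length_cons]; omega))
    rw [h.dec_inter, h.dec_diff, hcell] at p2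
    set A := cellOf (l.map Prod.fst) v
    set Z := dec a n (cut a (cell a T v))
    have hu : A.IsUnion (A ∩ Z) (A \ Z) := by
      refine ⟨?_, ?_⟩
      · ext x
        simp only [Finset.mem_union, Finset.mem_inter, Finset.mem_sdiff]
        tauto
      · rw [Finset.disjoint_left]
        intro x hx hx'
        exact (Finset.mem_sdiff.1 hx').2 (Finset.mem_inter.1 hx).2
    refine ⟨_, ⟨p2, .step hl.decomp hu hB hC hsB hsC, by simp only [List.length_cons]; omega⟩,
      fun p hp => List.mem_cons_of_mem _ (List.mem_cons_of_mem _ hp), fun _ _ c _ hle => ?_⟩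
    have hv : v ∈ A := self_mem_cellOf _ _
    have hcard : (A ∩ Z).card + (A \ Z).card = A.card := by
      rw [add_comm]; exact Finset.card_sdiff_add_card_inter A Z
    -- Both parts are nonempty, so the one containing v is smaller than the old cell by at least
    -- one.
    have := hB.card_pos
    have := hC.card_pos
    by_cases hvZ : v ∈ Z
    · have := Finset.card_le_card (cellOf_subset (t := (A \ Z) :: (A ∩ Z) :: l.map Prod.fst)
        (A := A ∩ Z) (by simp) (Finset.mem_inter.2 ⟨hv, hvZ⟩))
      simp only [List.map_cons]
      omega
    · have := Finset.card_le_card (cellOf_subset (t := (A \ Z) :: (A ∩ Z) :: l.map Prod.fst)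
        (A := A \ Z) (by simp) (Finset.mem_sdiff.2 ⟨hv, hvZ⟩))
      simp only [List.map_cons]
      omega

/-- A cell has at most n vertices and each round for v removes at least one until a single vertex
remains, so n rounds suffice; later refinements only shrink cells. At most n² rounds with at most
two new entries each give the length 2n² + 1. -/
theorem parts_spec : ∃ l, IsParts a G (2 * n * n + 1) (parts a) l ∧
    ∀ Φ : CWExpr (Fin n) a.k, Φ.Defines G → ∀ v, (cellOf (l.map Prod.fst) v).card ≤ 1 := by
  have key := fold_induction (N := a.N) (x := BoundedLoop.push a 0 (vset a fun _ => True) 0)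
    (f := fun v T => cond (v < a.n)
      (fold a.N (fun i T => cond (i < a.n) (refineCell a T v) T) T) T)
    (fun i T => ∃ l, IsParts a G (2 * n * min i n + 1) T l ∧
      ∀ Φ : CWExpr (Fin n) a.k, Φ.Defines G → ∀ v : Fin n, (v : ℕ) < i →
        (cellOf (l.map Prod.fst) v).card ≤ 1) ?_ ?_
  · obtain ⟨l, hl, hc⟩ := key
    rw [min_eq_right h.n_lt.le] at hl
    exact ⟨l, hl, fun Φ hΦ v => hc Φ hΦ v (v.2.trans h.n_lt)⟩
  · have hp := (IsList.nil (a := a) (n := n)).push h.toDescribes (vset a fun _ => True) 0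
      (h.parts_fit (by simp))
    have huniv : dec a n (vset a fun _ => True) = Finset.univ := by
      ext v; simp [h.mem_vset]
    rw [huniv, dec_zero] at hp
    exact ⟨_, ⟨hp, .init, by simp⟩, fun _ _ v hv => (Nat.not_lt_zero _ hv).elim⟩
  · rintro i hi T ⟨l, hl, hc⟩
    simp only [cond, h.n_eq]
    split_ifs with hin
    · rw [min_eq_left hin.le] at hl
      rw [min_eq_left (by omega : i + 1 ≤ n)]
      have hni : 2 * n * (i + 1) = 2 * n * i + 2 * n := by ring
      have hnn : 2 * n * (i + 1) ≤ 2 * n * n := Nat.mul_le_mul_left _ hin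
      let v : Fin n := ⟨i, hin⟩
      have inner := fold_induction (N := a.N) (x := T)
        (f := fun j T => if j < n then refineCell a T i else T)
        (fun j T' => ∃ l', IsParts a G (2 * n * i + 2 * min j n + 1) T' l' ∧ l ⊆ l' ∧
          ∀ Φ : CWExpr (Fin n) a.k, Φ.Defines G →
            (cellOf (l'.map Prod.fst) v).card ≤ max 1 (n - j)) ?_ ?_
      · obtain ⟨l', hl', hsub, hv⟩ := inner
        refine ⟨l', ⟨hl'.isList, hl'.decomp, hl'.length_le.trans ?_⟩, fun Φ hΦ u hu => ?_⟩
        · rw [min_eq_right h.n_lt.le]; omega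
        · obtain hlt | heq := Nat.lt_or_eq_of_le (Nat.le_of_lt_succ hu)
          · exact (Finset.card_le_card (cellOf_anti (List.map_subset _ hsub) u)).trans
              (hc Φ hΦ u hlt)
          · obtain rfl : u = v := Fin.ext heq
            have := hv Φ hΦ
            have := h.n_lt
            omega
      · refine ⟨l, ⟨hl.isList, hl.decomp, hl.length_le.trans (by omega)⟩, List.Subset.refl l,
          fun Φ _ => ?_⟩
        have := Finset.card_le_univ (cellOf (l.map Prod.fst) v)
        rw [Fintype.card_fin] at this
        omega
      · rintro j - T' ⟨l', hl', hsub, hv⟩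
        split_ifs with hj
        · rw [min_eq_left hj.le] at hl'
          obtain ⟨l'', hl'', hsub', hv'⟩ := h.refineCell_spec hl' (by omega) v
          refine ⟨l'', ⟨hl''.isList, hl''.decomp, hl''.length_le.trans (by omega)⟩,
            List.Subset.trans hsub hsub', fun Φ hΦ => ?_⟩
          refine hv' Φ hΦ _ (by omega) ?_
          have := hv Φ hΦ
          omega
        · refine ⟨l', ⟨hl'.isList, hl'.decomp, hl'.length_le.trans (by omega)⟩, hsub,
            fun Φ hΦ => ?_⟩
          have := hv Φ hΦ
          omega
    · rw [min_eq_right (by omega)] at hl ⊢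
      exact ⟨l, hl, fun Φ hΦ v _ => hc Φ hΦ v (by omega)⟩

omit h in
theorem refined_iff (h : Describes a G) {T l} (hl : IsList a T l) :
    refined a T ↔ ∀ v : Fin n, ∀ u ∈ cellOf (l.map Prod.fst) v, u = v := by
  rw [refined, h.allV_iff]
  refine forall_congr' fun v => ?_
  rw [h.allV_iff]
  refine forall_congr' fun u => ?_
  rw [← mem_dec, h.dec_cell hl, Fin.ext_iff]

theorem refined_parts {Φ : CWExpr (Fin n) a.k} (hΦ : Φ.Defines G) : refined a (parts a) := by
  obtain ⟨l, hl, hc⟩ := h.parts_spec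
  rw [refined_iff h.toDescribes hl.isList]
  exact fun v u hu => Finset.card_le_one.1 (hc Φ hΦ v) u hu v (self_mem_cellOf _ v)

end Suited

end BoundedLoop

/-! ## Correctness of the representative colorings -/

namespace BoundedLoop

variable {a : Ambient} {n : ℕ} {G : SimpleGraph (Fin n)}

namespace Describes

variable (h : Describes a G)

include h

theorem equivalent_iff (A S S' : ℕ) :
    equivalent a A S S' ↔ G.Equivalent (dec a n A) (dec a n S) (dec a n S') := by
  rw [equivalent, SimpleGraph.Equivalent, h.agree_iff, h.edges_eq, h.edges_eq, h.edges_eq,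
    h.edges_eq, h.dec_diff, h.dec_diff]

theorem sameSet_iff (A A' : ℕ) : sameSet a A A' ↔ dec a n A = dec a n A' := by
  simp only [sameSet, h.allV_iff, Finset.ext_iff, mem_dec]

theorem isUnion_iff (A B C : ℕ) :
    isUnion a A B C ↔ (dec a n A).IsUnion (dec a n B) (dec a n C) := by
  simp only [isUnion, h.allV_iff, Finset.IsUnion, Finset.ext_iff, Finset.mem_union,
    Finset.disjoint_left, mem_dec, forall_and, not_and]

theorem isSingle_iff (A : ℕ) : isSingle a A ↔ ∃ v, dec a n A = {v} := by
  simp only [isSingle, h.exV_iff, h.allV_iff, Finset.ext_iff, mem_dec, Finset.mem_singleton,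
    Fin.ext_iff]

end Describes

/-- Some entry of the list represents the subset `S` of `A`. -/
def Represents (G : SimpleGraph (Fin n)) (l : List (Finset (Fin n) × Finset (Fin n)))
    (A S : Finset (Fin n)) : Prop := ∃ p ∈ l, p.1 = A ∧ G.Equivalent A p.2 S

theorem Represents.mono {l l' : List (Finset (Fin n) × Finset (Fin n))} {A S}
    (hr : Represents G l A S) (h : l ⊆ l') : Represents G l' A S :=
  let ⟨p, hp, h'⟩ := hr
  ⟨p, h hp, h'⟩

/-- `L` is the code of the list `l` of pairwise inequivalent subsets of the sets in `ts`. -/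
structure RepList (a : Ambient) (G : SimpleGraph (Fin n)) (ts : List (Finset (Fin n))) (L : ℕ)
    (l : List (Finset (Fin n) × Finset (Fin n))) : Prop where
  isList : IsList a L l
  mem : ∀ p ∈ l, p.1 ∈ ts
  subset : ∀ p ∈ l, p.2 ⊆ p.1
  pairwise : l.Pairwise fun p q => ¬ (p.1 = q.1 ∧ G.Equivalent p.1 p.2 q.2)

namespace Suited

variable (h : Suited a G) {ts : List (Finset (Fin n))}
  (hts : ts.length ≤ 2 * n * n + 1) (hsmall : ∀ A ∈ ts, G.Small (3 * a.k + 1) A)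

include h hts hsmall

/-- An entry is determined up to equivalence by its position in `ts`, the counts at 3k + 1 vertices
and two numbers of edges. With the width of a block this needs at most (n+1)^(3k+10) bits. -/
theorem repList_fit {l : List (Finset (Fin n) × Finset (Fin n))} (hmem : ∀ p ∈ l, p.1 ∈ ts)
    (hsub : ∀ p ∈ l, p.2 ⊆ p.1)
    (hl : l.Pairwise fun p q => ¬ (p.1 = q.1 ∧ G.Equivalent p.1 p.2 q.2)) :
    l.length * width a ≤ a.N := by
  -- For each set of the decomposition, fix an enumeration f of determining vertices; sets outside
  -- of `ts` get a dummy.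
  have hX : ∀ A : Finset (Fin n), ∃ f : ℕ → Fin n, A ∈ ts → ∀ S ⊆ A, ∀ S' ⊆ A,
      (∀ j < 3 * a.k + 1, G.countIn S (f j) = G.countIn S' (f j)) → G.Agree A S S' := by
    intro A
    by_cases hA : A ∈ ts
    · obtain ⟨X, hX, hdet⟩ := hsmall A hA
      obtain rfl | hne := X.eq_empty_or_nonempty
      · exact ⟨fun _ => ⟨0, h.n_pos⟩, fun _ S hS S' hS' _ => hdet S hS S' hS' (by simp)⟩
      · obtain ⟨f, hf⟩ := X.exists_enumeration hne hX
        refine ⟨f, fun _ S hS S' hS' hj => hdet S hS S' hS' fun x hx => ?_⟩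
        obtain ⟨j, hjm, rfl⟩ := (hf x).1 hx
        exact hj j hjm
    · exact ⟨fun _ => ⟨0, h.n_pos⟩, fun hA' => (hA hA').elim⟩
  choose f hf using hX
  classical
  have h1 : l.length ≤ (ts.length + 1) * ((n + 1) ^ (3 * a.k + 1) *
      ((n * n + 1) * (n * n + 1))) := by
    have := List.length_le_card_of_pairwise (l := l)
      (fun (p : Finset (Fin n) × Finset (Fin n)) =>
        ((⟨ts.idxOf p.1, Nat.lt_succ_of_le List.idxOf_le_length⟩ : Fin (ts.length + 1)),
          (fun j : Fin (3 * a.k + 1) =>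
            (⟨G.countIn p.2 (f p.1 j), G.countIn_lt _ _⟩ : Fin (n + 1))),
          (⟨G.edgesIn p.2, G.edgesIn_lt _⟩ : Fin (n * n + 1)),
          (⟨G.edgesIn (p.1 \ p.2), G.edgesIn_lt _⟩ : Fin (n * n + 1)))) ?_
    · simpa using this
    · refine hl.imp_of_mem ?_
      intro p q hp hq hpq heq
      refine hpq ?_
      simp only [Prod.mk.injEq, Fin.mk.injEq] at heq
      obtain ⟨h1, h2, h3, h4⟩ := heq
      have hpq1 : p.1 = q.1 := (List.idxOf_inj (hmem p hp)).1 h1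
      refine ⟨hpq1, hf p.1 (hmem p hp) _ (hsub p hp) _ (hpq1 ▸ hsub q hq) fun j hj => ?_, h3, ?_⟩
      · have := congrArg Fin.val (congrFun h2 ⟨j, hj⟩)
        simpa [← hpq1] using this
      · rw [h4, hpq1]
  have h2 : width a ≤ (n + 1) ^ 2 := by
    rw [h.width_eq]
    nlinarith
  have h3 : ts.length + 1 ≤ (n + 1) ^ 3 := by
    have := h.n_pos
    nlinarith [Nat.zero_le (n * n * n), Nat.zero_le (n * n)]
  have h4 : n * n + 1 ≤ (n + 1) ^ 2 := by nlinarith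
  calc l.length * width a ≤ ((n + 1) ^ 3 * ((n + 1) ^ (3 * a.k + 1) *
        ((n + 1) ^ 2 * (n + 1) ^ 2))) * (n + 1) ^ 2 :=
        Nat.mul_le_mul (h1.trans (Nat.mul_le_mul h3 (Nat.mul_le_mul_left _
          (Nat.mul_le_mul h4 h4)))) h2
    _ = (n + 1) ^ (3 * a.k + 10) := by ring
    _ ≤ a.N := h.pow_le (by have := h.k_pos; omega)

theorem insertRep_spec {A S L : ℕ} {l} (hl : RepList a G ts L l) (hA : dec a n A ∈ ts)
    (hS : dec a n S ⊆ dec a n A) : ∃ l', RepList a G ts (insertRep a A S L) l' ∧ l ⊆ l' ∧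
      Represents G l' (dec a n A) (dec a n S) := by
  have e := hl.isList.exE_iff h.toDescribes
    (p := fun A' S' => sameSet a A' A ∧ equivalent a A S' S)
    (q := fun A' S' => A' = dec a n A ∧ G.Equivalent (dec a n A) S' (dec a n S))
    fun A' S' => by rw [h.sameSet_iff, h.equivalent_iff]
  rw [insertRep, cond]
  split_ifs with c
  · exact ⟨l, hl, List.Subset.refl l, e.1 c⟩
  · have hpw : ((dec a n A, dec a n S) :: l).Pairwise
        fun p q => ¬ (p.1 = q.1 ∧ G.Equivalent p.1 p.2 q.2) :=
      List.pairwise_cons.2 ⟨fun p hp hk => c (e.2 ⟨p, hp, hk.1.symm, hk.2.symm⟩), hl.pairwise⟩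
    have hm : ∀ p ∈ (dec a n A, dec a n S) :: l, p.1 ∈ ts := List.forall_mem_cons.2 ⟨hA, hl.mem⟩
    have hs : ∀ p ∈ (dec a n A, dec a n S) :: l, p.2 ⊆ p.1 :=
      List.forall_mem_cons.2 ⟨hS, hl.subset⟩
    exact ⟨_, ⟨hl.isList.push h.toDescribes A S (h.repList_fit hts hsmall hm hs hpw), hm, hs, hpw⟩,
      List.subset_cons_self _ _, _, List.mem_cons_self, rfl, .refl _ _⟩

theorem insertSingle_spec {A L : ℕ} {l} (hl : RepList a G ts L l) (hA : dec a n A ∈ ts) :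
    ∃ l', RepList a G ts (insertSingle a A L) l' ∧ l ⊆ l' ∧
      ((∃ v, dec a n A = {v}) → ∀ S ⊆ dec a n A, Represents G l' (dec a n A) S) := by
  rw [insertSingle, cond, h.isSingle_iff]
  split_ifs with c
  · obtain ⟨l₁, hl₁, hs₁, hr₁⟩ := h.insertRep_spec hts hsmall (S := 0) hl hA (by simp [dec_zero])
    obtain ⟨l₂, hl₂, hs₂, hr₂⟩ := h.insertRep_spec hts hsmall (S := A) hl₁ hA subset_rfl
    refine ⟨l₂, hl₂, List.Subset.trans hs₁ hs₂, fun _ S hS => ?_⟩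
    obtain ⟨v, hv⟩ := c
    rw [hv, Finset.subset_singleton_iff] at hS
    rcases hS with rfl | rfl
    · rw [dec_zero] at hr₁
      exact hr₁.mono hs₂
    · rwa [← hv]
  · exact ⟨l, hl, List.Subset.refl l, fun hc => (c hc).elim⟩

/-- Every pair of listed entries whose sets partition A is combined, so the parent-child relation of
the decomposition need not be stored. -/
theorem merge_spec {A L : ℕ} {l} (hl : RepList a G ts L l) (hA : dec a n A ∈ ts) :
    ∃ l', RepList a G ts (merge a A L) l' ∧ l ⊆ l' ∧
      ((∃ v, dec a n A = {v}) → ∀ S ⊆ dec a n A, Represents G l' (dec a n A) S) ∧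
      ∀ p ∈ l, ∀ q ∈ l, (dec a n A).IsUnion p.1 q.1 →
        Represents G l' (dec a n A) (p.2 ∪ q.2) := by
  obtain ⟨l₀, hl₀, hs₀, hr₀⟩ := h.insertSingle_spec hts hsmall hl hA
  have key := hl.isList.foldE_induction h.toDescribes (x := insertSingle a A L)
    (f := fun A₁ S₁ L₁ => foldE a L (fun A₂ S₂ L₂ => cond (isUnion a A A₁ A₂)
      (insertRep a A (union a S₁ S₂) L₂) L₂) L₁)
    (fun r y => ∃ l', RepList a G ts y l' ∧ l₀ ⊆ l' ∧ ∀ i (hi : i < l.length), i < r →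
      ∀ q ∈ l, (dec a n A).IsUnion l[i].1 q.1 → Represents G l' (dec a n A) (l[i].2 ∪ q.2))
    ⟨l₀, hl₀, List.Subset.refl _, fun i _ hi => (Nat.not_lt_zero _ hi).elim⟩ ?_
  · obtain ⟨l', hl', hs', hr'⟩ := key
    refine ⟨l', hl', List.Subset.trans hs₀ hs', fun hv S hS => (hr₀ hv S hS).mono hs', ?_⟩
    intro p hp q hq hu
    obtain ⟨i, hi, rfl⟩ := List.getElem_of_mem hp
    exact hr' i hi hi q hq hu
  · rintro r hr A₁ S₁ y hA₁ hS₁ ⟨l₁, hl₁, hs₁, hr₁⟩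
    have inner := hl.isList.foldE_induction h.toDescribes (x := y)
      (f := fun A₂ S₂ L₂ => cond (isUnion a A A₁ A₂) (insertRep a A (union a S₁ S₂) L₂) L₂)
      (fun s z => ∃ l', RepList a G ts z l' ∧ l₁ ⊆ l' ∧ ∀ j (hj : j < l.length), j < s →
        (dec a n A).IsUnion l[r].1 l[j].1 → Represents G l' (dec a n A) (l[r].2 ∪ l[j].2))
      ⟨l₁, hl₁, List.Subset.refl _, fun j _ hj => (Nat.not_lt_zero _ hj).elim⟩ ?_
    · obtain ⟨l', hl', hs', hr'⟩ := inner
      refine ⟨l', hl', List.Subset.trans hs₁ hs', fun i hi hir q hq hu => ?_⟩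
      obtain rfl | hlt := Nat.eq_or_lt_of_le (Nat.le_of_lt_succ hir)
      · obtain ⟨j, hj, rfl⟩ := List.getElem_of_mem hq
        exact hr' j hj hj hu
      · exact (hr₁ i hi hlt q hq hu).mono hs'
    · rintro s hs A₂ S₂ z hA₂ hS₂ ⟨l₂, hl₂, hs₂, hr₂⟩
      rw [cond, h.isUnion_iff, hA₁, hA₂]
      split_ifs with c
      · have hun : dec a n (union a S₁ S₂) = l[r].2 ∪ l[s].2 := by rw [h.dec_union, hS₁, hS₂]
        obtain ⟨l₃, hl₃, hs₃, hr₃⟩ := h.insertRep_spec hts hsmall (S := union a S₁ S₂) hl₂ hA (by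
          rw [hun, c.1]
          exact Finset.union_subset_union (hl.subset _ (List.getElem_mem _))
            (hl.subset _ (List.getElem_mem _)))
        rw [hun] at hr₃
        refine ⟨l₃, hl₃, List.Subset.trans hs₂ hs₃, fun j hj hjs hu => ?_⟩
        obtain rfl | hlt := Nat.eq_or_lt_of_le (Nat.le_of_lt_succ hjs)
        · exact hr₃
        · exact (hr₂ j hj hlt hu).mono hs₃
      · refine ⟨l₂, hl₂, hs₂, fun j hj hjs hu => ?_⟩
        obtain rfl | hlt := Nat.eq_or_lt_of_le (Nat.le_of_lt_succ hjs)
        · exact (c hu).elim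
        · exact hr₂ j hj hlt hu

omit hts hsmall

/-- The children of a set stand further to the front of the list, so they are processed first. A set
without children is a cell, hence a singleton, and its two subsets are inserted directly. -/
theorem reps_spec {T : ℕ} {t} (ht : IsParts a G (2 * n * n + 1) T t) (href : refined a T) :
    ∃ l, RepList a G (t.map Prod.fst) (reps a T) l ∧
      ∀ A ∈ t.map Prod.fst, ∀ S ⊆ A, Represents G l A S := by
  have hts : (t.map Prod.fst).length ≤ 2 * n * n + 1 := by simpa using ht.length_le
  have hsmall := ht.decomp.prop_of_mem (small_univ _)
  have hne : NeZero n := ⟨h.n_pos.ne'⟩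
  rw [refined_iff h.toDescribes ht.isList] at href
  have key := ht.isList.foldE_induction h.toDescribes (x := 0) (f := fun A _ L => merge a A L)
    (fun r y => ∃ l, RepList a G (t.map Prod.fst) y l ∧
      ∀ i (hi : i < t.length), i < r → ∀ S ⊆ t[i].1, Represents G l t[i].1 S)
    ⟨[], ⟨.nil, by simp, by simp, .nil⟩, fun i _ hi => (Nat.not_lt_zero _ hi).elim⟩ ?_
  · obtain ⟨l, hl, hr⟩ := key
    refine ⟨l, hl, fun A hA => ?_⟩
    obtain ⟨p, hp, rfl⟩ := List.mem_map.1 hA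
    obtain ⟨i, hi, rfl⟩ := List.getElem_of_mem hp
    exact hr i hi hi
  · rintro r hr A _ y hA - ⟨l, hl, hrep⟩
    have hmem : t[r].1 ∈ t.map Prod.fst := List.mem_map_of_mem (List.getElem_mem hr)
    obtain ⟨l', hl', hs', hsing, hun⟩ := h.merge_spec hts hsmall hl (by rwa [hA])
    rw [hA] at hsing hun
    refine ⟨l', hl', fun i hi hir S hS => ?_⟩
    obtain rfl | hlt := Nat.eq_or_lt_of_le (Nat.le_of_lt_succ hir)
    · rcases ht.decomp.structure_aux.2 i (by simpa using hi) with hleaf | ⟨j, m, hj, hm, hu, -⟩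
      · rw [List.getElem_map] at hleaf
        obtain ⟨v, hv⟩ := ht.decomp.nonempty_of_mem _ hmem
        refine hsing ⟨v, Finset.eq_singleton_iff_unique_mem.2 ⟨hv, fun u hu => ?_⟩⟩ S hS
        rw [← hleaf v hv] at hu
        exact href v u hu
      · simp only [List.getElem_map] at hu
        -- S is split along the two children. Each part is equivalent to a listed set, and the union
        -- of the two listed sets is equivalent to S.
        obtain ⟨p, hp, hpj, hpS⟩ := hrep j (hj.trans hi) hj _ (Finset.inter_subset_right (s₁ := S))
        obtain ⟨q, hq, hqm, hqS⟩ := hrep m (hm.trans hi) hm _ (Finset.inter_subset_right (s₁ := S))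
        obtain ⟨x, hx, hxA, hxS⟩ := hun p hp q hq (by rwa [hpj, hqm])
        refine ⟨x, hx, hxA, hxS.trans ?_⟩
        have hSu : S = S ∩ t[j].1 ∪ S ∩ t[m].1 := by
          rw [← Finset.inter_union_distrib_left, ← hu.1, Finset.inter_eq_left.2 hS]
        have := hpS.union hu (hpj ▸ hl.subset p hp) Finset.inter_subset_right
          (hqm ▸ hl.subset q hq) Finset.inter_subset_right hqS
        rwa [← hSu] at this
    · exact (hrep i hi hlt S hS).mono hs'

/-- No expression is involved: once the cells are singletons, every coloring has a representative
with the same numbers of red and blue edges, and every representative is itself a coloring. -/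
theorem answer_iff (href : refined a (parts a)) : answer a ↔ ∃ S : Finset (Fin n),
    a.par 3 ≤ G.edgesIn S + a.par 4 ∧ a.par 5 ≤ G.edgesIn (Finset.univ \ S) + a.par 6 := by
  obtain ⟨t, ht, -⟩ := h.parts_spec
  obtain ⟨l, hl, hrep⟩ := h.reps_spec ht href
  rw [answer, hl.isList.exE_iff h.toDescribes (q := fun A S => A = Finset.univ ∧
    a.par 3 ≤ G.edgesIn S + a.par 4 ∧ a.par 5 ≤ G.edgesIn (A \ S) + a.par 6) fun A S => by
      rw [h.edges_eq, h.edges_eq, h.dec_diff, h.allV_iff, Finset.eq_univ_iff_forall]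
      simp only [mem_dec]]
  constructor
  · rintro ⟨p, -, hp, h1, h2⟩
    exact ⟨p.2, h1, by rwa [← hp]⟩
  · rintro ⟨S, h1, h2⟩
    obtain ⟨p, hp, hpu, hpS⟩ := hrep _ ht.decomp.univ_mem S (Finset.subset_univ S)
    exact ⟨p, hp, hpu, by rwa [hpS.2.1], by rwa [hpu, hpS.2.2]⟩

end Suited

end BoundedLoop

/-! ## Colorings and vertex sets -/

/-- Each edge corresponds to exactly one ordered pair of ends with the smaller end first. -/
theorem monoEdges_eq {n : ℕ} (G : SimpleGraph (Fin n)) (f : Fin n → LoadColor) (c : LoadColor) :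
    monoEdges G f c = G.edgesIn (Finset.univ.filter fun v => f v = c) := by
  classical
  set S := Finset.univ.filter fun v => f v = c
  have hset : {e ∈ G.edgeSet | ∀ v ∈ e, f v = c} =
      (((S ×ˢ S).filter fun p => p.1 < p.2 ∧ G.Adj p.1 p.2).image
        (fun p => s(p.1, p.2)) : Finset (Sym2 (Fin n))) := by
    ext e
    induction e using Sym2.ind with
    | _ u v =>
    simp only [Set.mem_ofPred_eq, SimpleGraph.mem_edgeSet, Sym2.mem_iff, forall_eq_or_imp,
      forall_eq, Finset.coe_image, Set.mem_image, Finset.mem_coe, Finset.mem_filter,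
      Finset.mem_product, S, Finset.mem_univ, true_and, Prod.exists]
    constructor
    · rintro ⟨hadj, hu, hv⟩
      rcases lt_or_gt_of_ne hadj.ne with h | h
      · exact ⟨u, v, ⟨⟨hu, hv⟩, h, hadj⟩, rfl⟩
      · exact ⟨v, u, ⟨⟨hv, hu⟩, h, hadj.symm⟩, Sym2.eq_swap⟩
    · rintro ⟨x, y, ⟨⟨hx, hy⟩, -, hadj⟩, he⟩
      rcases Sym2.eq_iff.1 he with ⟨rfl, rfl⟩ | ⟨rfl, rfl⟩
      exacts [⟨hadj, hx, hy⟩, ⟨hadj.symm, hy, hx⟩]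
  rw [monoEdges, hset, Set.ncard_coe_finset, SimpleGraph.edgesIn]
  refine Finset.card_image_of_injOn ?_
  rintro ⟨u, v⟩ h ⟨u', v'⟩ h' he
  simp only [Finset.coe_filter, Set.mem_ofPred_eq] at h h'
  rcases Sym2.eq_iff.1 he with ⟨rfl, rfl⟩ | ⟨rfl, rfl⟩
  · rfl
  · exact (lt_asymm h.2.1 h'.2.1).elim

theorem hasLoadColoring_iff {n : ℕ} (G : SimpleGraph (Fin n)) (k₁ k₂ : ℤ) :
    HasLoadColoring G k₁ k₂ ↔ ∃ S : Finset (Fin n), k₁ ≤ (G.edgesIn S : ℤ) ∧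
      k₂ ≤ (G.edgesIn (Finset.univ \ S) : ℤ) := by
  classical
  simp only [HasLoadColoring, monoEdges_eq]
  constructor
  · rintro ⟨f, h1, h2⟩
    refine ⟨_, h1, ?_⟩
    convert h2 using 3
    ext v
    cases hv : f v <;> simp [hv]
  · rintro ⟨S, h1, h2⟩
    refine ⟨fun v => if v ∈ S then .red else .blue, ?_, ?_⟩
    · convert h1 using 3
      ext v
      by_cases hv : v ∈ S <;> simp [hv]
    · convert h2 using 3
      ext v
      by_cases hv : v ∈ S <;> simp [hv]

/-! ## Clique-width -/

namespace CWExpr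

theorem exists_edgeless {n m : ℕ} (hm : 1 ≤ m) : m ≤ n → ∃ Φ : CWExpr (Fin n) n,
    Φ.WellFormed ∧ Φ.verts = {v : Fin n | (v : ℕ) < m} ∧ (∀ u l, Φ.HasLabel u l → u = l) ∧
      Φ.graph = ⊥ := by
  induction m, hm using Nat.le_induction with
  | base =>
    intro h
    refine ⟨.vertex ⟨0, h⟩ ⟨0, h⟩, trivial, ?_, fun u l hul => hul.1.trans hul.2.symm, rfl⟩
    ext v
    simp [verts, Fin.ext_iff]
  | succ m _ ih =>
    intro h
    obtain ⟨Φ, hwf, hv, hl, hg⟩ := ih (by omega)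
    let x : Fin n := ⟨m, h⟩
    refine ⟨.union Φ (.vertex x x), ⟨hwf, trivial, ?_⟩, ?_, ?_, ?_⟩
    · simp [hv, verts, x]
    · ext v
      simp only [verts, hv, Set.mem_union, Set.mem_ofPred_eq, Set.mem_singleton_iff, Fin.ext_iff, x]
      omega
    · rintro u l (hul | hul)
      exacts [hl u l hul, hul.1.trans hul.2.symm]
    · simp [graph, hg]

/-- Each vertex keeps its own label, and every edge is made by one join. Thus the infimum in
`cliqueWidth` is attained and at most n. -/
theorem exists_defines {n : ℕ} (hn : 1 ≤ n) (G : SimpleGraph (Fin n)) :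
    ∃ Φ : CWExpr (Fin n) n, Φ.Defines G := by
  classical
  have key : ∀ E : Finset (Fin n × Fin n), (∀ p ∈ E, p.1 ≠ p.2) → ∃ Φ : CWExpr (Fin n) n,
      Φ.WellFormed ∧ Φ.verts = Set.univ ∧ (∀ u l, Φ.HasLabel u l ↔ u = l) ∧
        ∀ u v, Φ.graph.Adj u v ↔ (u, v) ∈ E ∨ (v, u) ∈ E := by
    intro E
    induction E using Finset.induction_on with
    | empty =>
      intro _
      obtain ⟨Φ, hwf, hv, hl, hg⟩ := exists_edgeless hn le_rfl
      have hv' : Φ.verts = Set.univ := by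
        rw [hv]
        ext v
        simp
      refine ⟨Φ, hwf, hv', fun u l => ⟨hl u l, ?_⟩, by simp [hg]⟩
      rintro rfl
      obtain ⟨l, hul⟩ := exists_hasLabel (Φ := Φ) (u := u) (by rw [hv']; trivial)
      rwa [← hl u l hul] at hul
    | insert p E _ ih =>
      intro hE
      obtain ⟨Φ, hwf, hv, hl, hg⟩ := ih fun q hq => hE q (Finset.mem_insert_of_mem hq)
      obtain ⟨i, j⟩ := p
      have hij : i ≠ j := hE _ (Finset.mem_insert_self _ _)
      refine ⟨.join i j hij Φ, hwf, hv, hl, fun u v => ?_⟩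
      simp only [graph, SimpleGraph.sup_adj, SimpleGraph.fromRel_adj, hl, hg, Finset.mem_insert,
        Prod.mk.injEq]
      have h1 : u = i ∧ v = j → u ≠ v := by
        rintro ⟨rfl, rfl⟩
        exact hij
      have h2 : v = i ∧ u = j → u ≠ v := by
        rintro ⟨rfl, rfl⟩
        exact hij.symm
      tauto
  obtain ⟨Φ, hwf, hv, -, hg⟩ := key (Finset.univ.filter fun p => G.Adj p.1 p.2) fun p hp =>
    ((Finset.mem_filter.1 hp).2).ne
  refine ⟨Φ, hwf, hv, ?_⟩
  ext u v
  simp [hg, G.adj_comm v u]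

theorem labels_pos {V : Type*} {w : ℕ} : CWExpr V w → 0 < w
  | vertex _ i => i.pos
  | union Φ _ => Φ.labels_pos
  | join i _ _ _ => i.pos
  | relabel i _ _ => i.pos

end CWExpr

/-! ## The program -/

namespace BoundedLoop

open RAM

/-- With j = 20 this computes the number of rounds for one more label from the current one, which is
at least n + 1, so that the cap has no effect. -/
theorem Feas.mulPow (j : ℕ) : Feas fun a _ => min (a.n + 1) a.N ^ j * a.N := by
  induction j with
  | zero => exact Feas.rounds.congr fun _ _ => by simp
  | succ j ih =>
    exact (Feas.mul (.add .numVerts (.const 1)) ih).congr fun a _ => by ring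

variable {n : ℕ} {G : SimpleGraph (Fin n)} {k₁ k₂ : ℤ}

/-- The array `2` of the state `s` holds the parameters for the attempt with `i` labels. -/
structure Ready (G : SimpleGraph (Fin n)) (k₁ k₂ : ℤ) (i : ℕ) (s : State) : Prop where
  mat : s.arr 0 = (input G k₁ k₂).arr 0
  rounds : s.arr 2 0 = (n + 1) ^ (20 * i + 1)
  numVerts : s.arr 2 1 = n
  numLabels : s.arr 2 2 = i
  pos₁ : s.arr 2 3 = k₁.toNat
  neg₁ : s.arr 2 4 = (-k₁).toNat
  pos₂ : s.arr 2 5 = k₂.toNat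
  neg₂ : s.arr 2 6 = (-k₂).toNat

theorem Ready.of_eq {i : ℕ} {s s' : State} (h : Ready G k₁ k₂ i s) (h0 : s'.arr 0 = s.arr 0)
    (h2 : s'.arr 2 = s.arr 2) : Ready G k₁ k₂ i s' := by
  obtain ⟨h1, h2, h3, h4, h5, h6, h7, h8⟩ := h
  constructor <;> simp_all

theorem Ready.suited {i : ℕ} {s : State} (h : Ready G k₁ k₂ i s) (hn : 0 < n) (hi : 0 < i) :
    Suited (ambientOf s) G where
  n_eq := h.numVerts
  n_lt := by
    change n < s.arr 2 0
    rw [h.rounds]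
    exact Nat.lt_of_succ_le (Nat.le_self_pow (by omega) _)
  adj_iff u v := by
    have hN : (u : ℕ) ≤ s.arr 2 0 := by
      rw [h.rounds]
      exact (u.2.le.trans (Nat.le_succ n)).trans (Nat.le_self_pow (by omega) _)
    change ¬ s.arr 0 (min (u : ℕ) (s.arr 2 0) * s.arr 2 1 + v) = 0 ↔ G.Adj u v
    rw [min_eq_left hN, h.numVerts, h.mat]
    simp only [input]
    constructor
    · intro hne
      by_contra hadj
      refine hne (if_neg ?_)
      rintro ⟨-, i, j, he, hij⟩
      have hdiv := congrArg (· / n) he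
      have hmod := congrArg (· % n) he
      simp only [mul_comm _ n, Nat.mul_add_div hn, Nat.div_eq_of_lt v.2,
        Nat.div_eq_of_lt j.2, Nat.mul_add_mod, Nat.mod_eq_of_lt v.2, Nat.mod_eq_of_lt j.2]
        at hdiv hmod
      rw [Fin.ext (hdiv : (u : ℕ) = i), Fin.ext (hmod : (v : ℕ) = j)] at hadj
      exact hadj hij
    · intro hadj
      rw [if_pos ⟨rfl, u, v, rfl, hadj⟩]
      simp
  n_pos := hn
  k_pos := by
    change 0 < s.arr 2 2
    rwa [h.numLabels]
  large := by
    change _ ^ (20 * s.arr 2 2 + 1) ≤ s.arr 2 0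
    rw [h.rounds, h.numLabels]

-- Any nonzero outcome is correct, also if fewer labels were tried than the clique-width demands.
-- The parameters hold positive and negative parts, which turns the test with natural numbers into
-- the one with integers.
open Classical in
theorem Ready.attempt_eq {i : ℕ} {s : State} (h : Ready G k₁ k₂ i s) (hn : 0 < n) (hi : 0 < i)
    (hne : attempt (ambientOf s) ≠ 0) :
    attempt (ambientOf s) = (if HasLoadColoring G k₁ k₂ then 1 else 0) + 1 := by
  have href : refined (ambientOf s) (parts (ambientOf s)) := by
    by_contra href
    exact hne (by rw [attempt, cond, if_neg href])
  have hiff : answer (ambientOf s) ↔ HasLoadColoring G k₁ k₂ := by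
    rw [(h.suited hn hi).answer_iff href, hasLoadColoring_iff]
    refine exists_congr fun S => ?_
    change s.arr 2 3 ≤ _ + s.arr 2 4 ∧ s.arr 2 5 ≤ _ + s.arr 2 6 ↔ _
    rw [h.pos₁, h.neg₁, h.pos₂, h.neg₂]
    omega
  rw [attempt, cond, if_pos href, cond, ← hiff]
  split_ifs <;> rfl

theorem Ready.attempt_ne_zero {i : ℕ} {s : State} (h : Ready G k₁ k₂ i s) (hn : 0 < n)
    {Φ : CWExpr (Fin n) i} (hΦ : Φ.Defines G) : attempt (ambientOf s) ≠ 0 := by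
  have hk : (ambientOf s).k = i := h.numLabels
  have href : refined (ambientOf s) (parts (ambientOf s)) := by
    have hs := h.suited hn Φ.labels_pos
    subst hk
    exact hs.refined_parts hΦ
  rw [attempt, cond, if_pos href, cond]
  split_ifs <;> simp

/-- The registers of the input are stored as parameters. -/
def prologue : Prog :=
  .seq (.put 2 (.const 0) (.add (.reg 0) (.const 1)))
    (.seq (.put 2 (.const 1) (.reg 0))
      (.seq (.put 2 (.const 3) (.reg 1))
        (.seq (.put 2 (.const 4) (.reg 2))
          (.seq (.put 2 (.const 5) (.reg 3))
            (.seq (.put 2 (.const 6) (.reg 4)) (.assign 0 (.const 0)))))))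

theorem runs_prologue (G : SimpleGraph (Fin n)) (k₁ k₂ : ℤ) : ∃ s,
    Runs prologue (input G k₁ k₂) 22 s ∧ Ready G k₁ k₂ 0 s ∧ s.reg 0 = 0 := by
  refine ⟨_, .seq (.put _ _ _ _) (.seq (.put _ _ _ _) (.seq (.put _ _ _ _) (.seq (.put _ _ _ _)
    (.seq (.put _ _ _ _) (.seq (.put _ _ _ _) (.assign _ _ _)))))), ?_, ?_⟩
  · constructor <;>
      simp [State.setReg, State.setArr, Expr.eval, input]
  · simp [State.setReg, Expr.eval]

/-- One round: `P` computes the new number of rounds, `Q` makes the attempt. -/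
def attemptNext (P Q : Cmd) : Prog :=
  .seq (P.compile 0)
    (.seq (.put 2 (.const 0) (.reg 0))
      (.seq (.put 2 (.const 2) (.add (.get 2 (.const 2)) (.const 1))) (Q.compile 0)))

theorem runs_attemptNext {P Q : Cmd}
    (hP : ∀ a e, P.den a e 0 = min (a.n + 1) a.N ^ 20 * a.N)
    (hQ : ∀ a e, Q.den a e 0 = attempt a) {i : ℕ} {s : State} (h : Ready G k₁ k₂ i s) :
    ∃ t s', Runs (attemptNext P Q) s t s' ∧
      t ≤ P.bound ((n + 1) ^ (20 * i + 1)) + Q.bound ((n + 1) ^ (20 * (i + 1) + 1)) + 10 ∧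
      Ready G k₁ k₂ (i + 1) s' ∧ s'.reg 0 = attempt (ambientOf s') := by
  obtain ⟨t₁, s₁, hrun₁, ht₁, hreg₁, h0₁, h2₁, -⟩ := P.runs_compile 0 s
  have hs₁ := h.of_eq h0₁ h2₁
  rw [h.rounds] at ht₁
  have hval : s₁.reg 0 = (n + 1) ^ (20 * (i + 1) + 1) := by
    rw [hreg₁, hP]
    change min (s.arr 2 1 + 1) (s.arr 2 0) ^ 20 * s.arr 2 0 = _
    rw [h.rounds, h.numVerts, min_eq_left (Nat.le_self_pow (by omega) _), ← pow_add]
    congr 1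
    ring
  have hput := Runs.put 2 (.const 0) (.reg 0) s₁
  set s₂ := s₁.setArr 2 0 (s₁.reg 0)
  have hput' := Runs.put 2 (.const 2) (.add (.get 2 (.const 2)) (.const 1)) s₂
  set s₃ := s₂.setArr 2 2 (s₂.arr 2 2 + 1)
  have hready : Ready G k₁ k₂ (i + 1) s₃ := by
    obtain ⟨h1, h2, h3, h4, h5, h6, h7, h8⟩ := hs₁
    constructor <;> simp [s₃, s₂, State.setArr, h1, h3, h4, h5, h6, h7, h8, hval]
  obtain ⟨t₄, s₄, hrun₄, ht₄, hreg₄, h0₄, h2₄, -⟩ := Q.runs_compile 0 s₃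
  rw [hready.rounds] at ht₄
  refine ⟨_, s₄, .seq hrun₁ (.seq hput (.seq hput' hrun₄)), ?_, hready.of_eq h0₄ h2₄, ?_⟩
  · simp only [Expr.cost]
    omega
  · rw [hreg₄, hQ, ambientOf, ambientOf, h0₄, h2₄]

/-- The program: attempts with more and more labels. -/
def program (P Q : Cmd) : Prog :=
  .seq prologue (.seq (.loop (.sub (.const 1) (.reg 0)) (attemptNext P Q))
    (.assign 0 (.sub (.reg 0) (.const 1))))

theorem exists_bound_attemptNext (P Q : Cmd) : ∃ C D, ∀ M N, M ≤ N →
    P.bound M + Q.bound N + 10 ≤ C * (N + 1) ^ D := by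
  obtain ⟨C, D, h⟩ := P.exists_bound
  obtain ⟨C', D', h'⟩ := Q.exists_bound
  refine ⟨C + C' + 10, D + D', fun M N hMN => ?_⟩
  have h1 : C * (M + 1) ^ D ≤ C * (N + 1) ^ (D + D') :=
    Nat.mul_le_mul_left _ ((Nat.pow_le_pow_left (Nat.succ_le_succ hMN) D).trans
      (Nat.pow_le_pow_right (Nat.succ_pos _) (Nat.le_add_right _ _)))
  have h2 : C' * (N + 1) ^ D' ≤ C' * (N + 1) ^ (D + D') :=
    Nat.mul_le_mul_left _ (Nat.pow_le_pow_right (Nat.succ_pos _) (Nat.le_add_left _ _))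
  have h3 : 1 ≤ (N + 1) ^ (D + D') := Nat.one_le_pow _ _ (Nat.succ_pos _)
  have := h M
  have := h' N
  linarith

-- The first attempt with a nonzero outcome ends the loop, with w labels at the latest. Induction on
-- the number j + 1 of attempts that are still allowed; each is charged with the cost for w labels,
-- and 4 is the cost of the test.
open Classical in
theorem runs_loop {P Q : Cmd}
    (hP : ∀ a e, P.den a e 0 = min (a.n + 1) a.N ^ 20 * a.N)
    (hQ : ∀ a e, Q.den a e 0 = attempt a) {C D : ℕ}
    (hb : ∀ M N, M ≤ N → P.bound M + Q.bound N + 10 ≤ C * (N + 1) ^ D)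
    (hn : 0 < n) {w : ℕ} {Φ : CWExpr (Fin n) w} (hΦ : Φ.Defines G) (j : ℕ) :
    ∀ {i s}, i + (j + 1) = w → Ready G k₁ k₂ i s → s.reg 0 = 0 →
    ∃ t s', Runs (.loop (.sub (.const 1) (.reg 0)) (attemptNext P Q)) s t s' ∧
      t ≤ (j + 1) * (C * ((n + 1) ^ (20 * w + 1) + 1) ^ D + 4) + 4 ∧
      s'.reg 0 = (if HasLoadColoring G k₁ k₂ then 1 else 0) + 1 := by
  have round : ∀ {i s}, i + 1 ≤ w → Ready G k₁ k₂ i s → ∃ t s', Runs (attemptNext P Q) s t s' ∧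
      t ≤ C * ((n + 1) ^ (20 * w + 1) + 1) ^ D ∧
      Ready G k₁ k₂ (i + 1) s' ∧ s'.reg 0 = attempt (ambientOf s') := by
    intro i s hi hs
    obtain ⟨t, s', hrun, ht, hs', hreg⟩ := runs_attemptNext hP hQ hs
    refine ⟨t, s', hrun, ht.trans ((hb _ _ ?_).trans (Nat.mul_le_mul_left _
      (Nat.pow_le_pow_left (Nat.succ_le_succ ?_) _))), hs', hreg⟩
    all_goals exact Nat.pow_le_pow_right (Nat.succ_pos _) (by omega)
  have done : ∀ {i s}, Ready G k₁ k₂ (i + 1) s → s.reg 0 = attempt (ambientOf s) →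
      attempt (ambientOf s) ≠ 0 →
      Runs (.loop (.sub (.const 1) (.reg 0)) (attemptNext P Q)) s 4 s ∧
        s.reg 0 = (if HasLoadColoring G k₁ k₂ then 1 else 0) + 1 := by
    intro i s hs hreg hne
    have heq := hs.attempt_eq hn (Nat.succ_pos i) hne
    exact ⟨.loop_done (by simp only [Expr.eval]; omega), hreg.trans heq⟩
  induction j with
  | zero =>
    intro i s hi hs h0
    obtain ⟨t, s', hrun, ht, hs', hreg⟩ := round hi.le hs
    have hne : attempt (ambientOf s') ≠ 0 := by
      obtain rfl : i + 1 = w := hi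
      exact hs'.attempt_ne_zero hn hΦ
    obtain ⟨hrun', hval⟩ := done hs' hreg hne
    refine ⟨_, s', .loop_step (by simp [Expr.eval, h0]) hrun hrun', ?_, hval⟩
    simp only [Expr.cost]
    omega
  | succ j ih =>
    intro i s hi hs h0
    obtain ⟨t, s', hrun, ht, hs', hreg⟩ := round (by omega) hs
    have hstep : (Expr.sub (.const 1) (.reg 0)).eval s ≠ 0 := by simp [Expr.eval, h0]
    have hexp : ∀ B, (j + 1 + 1) * (B + 4) = (j + 1) * (B + 4) + (B + 4) := fun B => by ring
    by_cases hne : attempt (ambientOf s') = 0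
    · obtain ⟨t', s'', hrun', ht', hval⟩ := ih (i := i + 1) (by omega) hs' (hreg.trans hne)
      refine ⟨_, s'', .loop_step hstep hrun hrun', ?_, hval⟩
      rw [hexp]
      simp only [Expr.cost]
      omega
    · obtain ⟨hrun', hval⟩ := done hs' hreg hne
      refine ⟨_, s', .loop_step hstep hrun hrun', ?_, hval⟩
      rw [hexp]
      simp only [Expr.cost]
      omega

/-- For n ≥ 2, both n + 1 ≤ n² and 2 ≤ n turn powers of n + 1 into powers of n, and w ≤ n^w absorbs
the number of attempts. For n = 1 the right side does not grow with w, which is why w = 1 is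
required there. The 30 steps are 22 for the prologue, 4 for the last test and 4 for the final
assignment. -/
theorem exists_exponent (C D : ℕ) : ∃ K, ∀ n w, 1 ≤ n → 1 ≤ w → (n = 1 → w = 1) →
    w * (C * ((n + 1) ^ (20 * w + 1) + 1) ^ D + 4) + 30 ≤ K * n ^ (K * w) := by
  refine ⟨(C * (2 ^ 21 + 1) ^ D + 34) + (43 * D + 1), fun n w hn hw h1 => ?_⟩
  set A := C * (2 ^ 21 + 1) ^ D + 34 with hA
  obtain rfl | hn2 := Nat.eq_or_lt_of_le hn
  · obtain rfl := h1 rfl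
    simp only [one_pow, mul_one, one_mul, Nat.reduceAdd]
    omega
  · have e1 : n + 1 ≤ n ^ 2 := by nlinarith
    have e2 : (n + 1) ^ (20 * w + 1) + 1 ≤ n ^ (43 * w) := by
      calc (n + 1) ^ (20 * w + 1) + 1 ≤ (n ^ 2) ^ (20 * w + 1) + (n ^ 2) ^ (20 * w + 1) :=
            Nat.add_le_add (Nat.pow_le_pow_left e1 _)
              (Nat.one_le_pow _ _ (Nat.pow_pos (by omega)))
        _ = (n ^ 2) ^ (20 * w + 1) * 2 := by ring
        _ ≤ (n ^ 2) ^ (20 * w + 1) * n := Nat.mul_le_mul_left _ hn2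
        _ = n ^ (40 * w + 3) := by rw [← pow_mul, ← pow_succ]; congr 1; ring
        _ ≤ n ^ (43 * w) := Nat.pow_le_pow_right (by omega) (by omega)
    have e3 : w ≤ n ^ w := (Nat.lt_pow_self hn2).le
    have e4 : 1 ≤ n ^ (43 * w * D) := Nat.one_le_pow _ _ (by omega)
    have e5 : 1 ≤ n ^ w := Nat.one_le_pow _ _ (by omega)
    have hC : C + 34 ≤ A := by
      have : C * 1 ≤ C * (2 ^ 21 + 1) ^ D :=
        Nat.mul_le_mul_left _ (Nat.one_le_pow _ _ (by norm_num))
      omega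
    calc w * (C * ((n + 1) ^ (20 * w + 1) + 1) ^ D + 4) + 30
        ≤ n ^ w * (C * n ^ (43 * w * D) + 4 * n ^ (43 * w * D)) +
            n ^ w * (30 * n ^ (43 * w * D)) := by
          refine Nat.add_le_add (Nat.mul_le_mul e3
            (Nat.add_le_add (Nat.mul_le_mul_left _ ?_) ?_)) ?_
          · rw [pow_mul]
            exact Nat.pow_le_pow_left e2 _
          · omega
          · nlinarith
      _ = (C + 34) * n ^ (w + 43 * w * D) := by rw [pow_add]; ring
      _ ≤ (A + (43 * D + 1)) * n ^ ((A + (43 * D + 1)) * w) := by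
          refine Nat.mul_le_mul (by omega) (Nat.pow_le_pow_right (by omega) ?_)
          have : (A + (43 * D + 1)) * w = A * w + (w + 43 * w * D) := by ring
          omega

end BoundedLoop

/-- 2-Load Coloring is solvable in time `n ^ O(w)`: one program, which gets the graph and the two
integers only, decides every instance within `C * n ^ (C * w)` steps, where `n ≥ 1` is the number
of vertices and `w` the clique-width of the input graph, and `C` is an absolute constant. -/
theorem theorem1 :
    ∃ (P : RAM.Prog) (C : ℕ), ∀ (n : ℕ), 0 < n → ∀ (G : SimpleGraph (Fin n)) (k₁ k₂ : ℤ),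
      RAM.DecidesLoadColoringWithin P G k₁ k₂ (C * n ^ (C * cliqueWidth G)) := by
  obtain ⟨P, -, -, hP⟩ := BoundedLoop.Feas.mulPow 20
  obtain ⟨Q, -, -, hQ⟩ := BoundedLoop.Feas.attempt
  obtain ⟨C, D, hb⟩ := BoundedLoop.exists_bound_attemptNext P Q
  obtain ⟨K, hK⟩ := BoundedLoop.exists_exponent C D
  refine ⟨BoundedLoop.program P Q, K, fun n hn G k₁ k₂ => ?_⟩
  have hdef := CWExpr.exists_defines hn G
  obtain ⟨Φ, hΦ⟩ : ∃ Φ : CWExpr (Fin n) (cliqueWidth G), Φ.Defines G :=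
    Nat.sInf_mem (s := {w | ∃ Φ : CWExpr (Fin n) w, Φ.Defines G}) ⟨n, hdef⟩
  have hle : cliqueWidth G ≤ n := Nat.sInf_le hdef
  have hpos := Φ.labels_pos
  obtain ⟨s, hrun, hs, h0⟩ := BoundedLoop.runs_prologue G k₁ k₂
  obtain ⟨t, s', hrun', ht, hval⟩ :=
    -- The loop starts at 0 labels, so w = (w - 1) + 1 attempts are allowed.
    BoundedLoop.runs_loop hP hQ hb hn hΦ (cliqueWidth G - 1) (by omega) hs h0
  refine ⟨_, _, .seq hrun (.seq hrun' (.assign _ _ _)), ?_, ?_⟩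
  · refine le_trans ?_ (hK n (cliqueWidth G) hn hpos (by omega))
    rw [Nat.sub_add_cancel hpos] at ht
    simp only [RAM.Expr.cost]
    omega
  · simp [RAM.State.setReg, RAM.Expr.eval, hval]
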